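/- Let $K$ be an algebraically closed field of characteristic different from $2$. A DCEC over $K$ is a nonsingular curve $C=V(P,Q)\subset\mathbb P^3$ with $P=y^2z-f(x,z)$ and $Q=w^2-q(x,y,z)$, where $f=x^3+a_2x^2z+a_4xz^2+a_6z^3$ is a binary cubic form and $q$ is a ternary quadratic form over $K$; then $E=V(P)\subset\mathbb P^2$ is an elliptic curve with origin $O=(0:1:0)$ and $(x:y:z:w)\mapsto(x:y:z)$ is a morphism $C\to E$ of degree $2$. A UDCEC is a DCEC $C$ with a unique elliptic quotient of degree two, i.e. for any two morphisms $\varphi:C\to E'$, $\varphi':C\to E''$ of degree $2$ onto curves of genus $1$ there is an isomorphism $\theta:E'\to E''$ with $\theta\circ\varphi=\varphi'$. Let $C_1=V(P_1,Q_1)$ and $C_2=V(P_2,Q_2)$ be UDCECs, with $E_i=V(P_i)$ and $q_i=w^2-Q_i$. For an isomorphism of curves $\psi:E_1\to E_2$ (not necessarily preserving origins) and $c\in K\setminus\{0\}$, write $\psi^*q_2=c\,q_1$ if $\psi$ can be given in homogeneous coordinates by $(F_0/H:F_1/H:F_2/H)$, with forms $F_0,F_1,F_2\in K[x,y,z]$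 of degree $e+1$, not all vanishing identically on $E_1$, and a form $H$ of degree $e$ not vanishing identically on $E_1$ (for some $e\ge 0$), such that $q_2(F_0/H,F_1/H,F_2/H)=c\,q_1$ on $E_1$, that is, $q_2(F_0,F_1,F_2)=c\,H^2q_1$ on $E_1$. **Proposition.** The curves $C_1$ and $C_2$ are isomorphic if and only if 1. $j(E_1)=j(E_2)$, and 2. there are an isomorphism of curves $\psi:E_1\to E_2$ and $c\in K\setminus\{0\}$ with $\psi^*q_2=c\,q_1$. Moreover, if $\psi$ is any isomorphism as in (2), then $E_1$ and $E_2$ are isomorphic as elliptic curves, and for every isomorphism of elliptic curves $\iota:E_1\to E_2$ (so $\iota(O)=O$) used to identify $E_1=E_2=E$, the isomorphism $\iota^{-1}\circ\psi:E\to E$ is the composition $\tau_R\circ\rho$ of the translation $\tau_R$ by a point $R\in E[6]$ and an automorphism $\rho$ of the elliptic curve $E$ (so $\rho(O)=O$). -/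

import Mathlib

open scoped LinearAlgebra.Projectivization

noncomputable section

namespace CoverCurve

open MvPolynomial Filter

variable {K : Type*} [Field K]

/-! ### Projective algebraic sets and their morphisms (over an algebraically closed field) -/

/-- Projective space of dimension `n - 1`, with homogeneous coordinates indexed by `Fin n`. -/
abbrev PSpace (K : Type*) [Field K] (n : ℕ) : Type _ := ℙ K (Fin n → K)

/-- The set of zeros in projective space of a set of homogeneous polynomials. -/
def zeroLocus {n : ℕ} (S : Set (MvPolynomial (Fin n) K)) : Set (PSpace K n) :=
  {p | ∀ G ∈ S, eval p.rep G = 0}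

/-- The vector of values of a tuple of polynomials at a vector. -/
def evalVec {n m : ℕ} (F : Fin m → MvPolynomial (Fin n) K) (v : Fin n → K) : Fin m → K :=
  fun i => eval v (F i)

/-- `F` (homogeneous polynomials of one degree `d`) represents the map `φ` wherever the
polynomials have no common zero. -/
def Represents {n m : ℕ} {X : Set (PSpace K n)} {Y : Set (PSpace K m)} (d : ℕ)
    (F : Fin m → MvPolynomial (Fin n) K) (φ : X → Y) : Prop :=
  (∀ i, (F i).IsHomogeneous d) ∧
    ∀ (x : X) (h : evalVec F x.1.rep ≠ 0), (φ x).1 = Projectivization.mk K _ h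

/-- Morphisms of projective algebraic sets: maps that near every point are given by homogeneous
polynomials of one degree without a common zero. -/
def IsMorphism {n m : ℕ} {X : Set (PSpace K n)} {Y : Set (PSpace K m)} (φ : X → Y) : Prop :=
  ∀ x : X, ∃ (d : ℕ) (F : Fin m → MvPolynomial (Fin n) K),
    Represents d F φ ∧ evalVec F x.1.rep ≠ 0

/-- Isomorphisms of projective algebraic sets. -/
structure Iso {n m : ℕ} (X : Set (PSpace K n)) (Y : Set (PSpace K m)) extends X ≃ Y where
  isMorphism_toFun : IsMorphism toFun
  isMorphism_invFun : IsMorphism invFun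

instance {n m : ℕ} (X : Set (PSpace K n)) (Y : Set (PSpace K m)) :
    CoeFun (Iso X Y) (fun _ => X → Y) := ⟨fun f => f.toEquiv⟩

/-! ### Rational functions on curves and the degree of a morphism of curves -/

/-- `r` is a rational function on the irreducible projective curve `X`: outside finitely many points
it is a quotient of two forms of the same degree.  Two such functions are the same element of the
function field iff they agree outside finitely many points. -/
def IsRational {n : ℕ} {X : Set (PSpace K n)} (r : X → K) : Prop :=
  ∃ (d : ℕ) (G H : MvPolynomial (Fin n) K), G.IsHomogeneous d ∧ H.IsHomogeneous d ∧
    ∀ᶠ x : X in cofinite, eval x.1.rep H ≠ 0 ∧ r x = eval x.1.rep G / eval x.1.rep H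

/-- The morphism `φ : X → Y` of irreducible projective curves has degree `d`, that is,
`[K(X) : φ^* K(Y)] = d`: the function field `K(X)` has a basis with `d` elements over `φ^* K(Y)`. -/
def HasDegree {n m : ℕ} {X : Set (PSpace K n)} {Y : Set (PSpace K m)} (φ : X → Y) (d : ℕ) :
    Prop :=
  ∃ g : Fin d → X → K, (∀ i, IsRational (g i)) ∧
    (∀ r : X → K, IsRational r → ∃ a : Fin d → Y → K, (∀ i, IsRational (a i)) ∧
      ∀ᶠ x : X in cofinite, r x = ∑ i, a i (φ x) * g i x) ∧
    (∀ a : Fin d → Y → K, (∀ i, IsRational (a i)) →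
      (∀ᶠ x : X in cofinite, ∑ i, a i (φ x) * g i x = 0) →
      ∀ i, ∀ᶠ y : Y in cofinite, a i y = 0)

/-! ### Elliptic quotients of degree two -/

/-- The gradient of a polynomial at a vector. -/
def grad {n : ℕ} (G : MvPolynomial (Fin n) K) (v : Fin n → K) : Fin n → K :=
  fun i => eval v (pderiv i G)

/-- `G` is a ternary cubic form whose zero locus in the projective plane is nonsingular; over an
algebraically closed field the curves `zeroLocus {G}` are the curves of genus one. -/
def IsSmoothCubic (G : MvPolynomial (Fin 3) K) : Prop :=
  G.IsHomogeneous 3 ∧ ∀ v : Fin 3 → K, v ≠ 0 → eval v G = 0 → grad G v ≠ 0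

/-- `φ` makes the genus-one curve `zeroLocus {G}` an elliptic quotient of degree two of `X`. -/
def IsEllipticQuotient {n : ℕ} (X : Set (PSpace K n)) (G : MvPolynomial (Fin 3) K)
    (φ : X → zeroLocus {G}) : Prop :=
  IsSmoothCubic G ∧ IsMorphism φ ∧ HasDegree φ 2

/-- `X` has a unique elliptic quotient of degree two: there is one, and every other one is
isomorphic to it by an isomorphism compatible with the maps from `X`. -/
def HasUniqueEllipticQuotient {n : ℕ} (X : Set (PSpace K n)) : Prop :=
  ∃ (G : MvPolynomial (Fin 3) K) (φ : X → zeroLocus {G}), IsEllipticQuotient X G φ ∧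
    ∀ (G' : MvPolynomial (Fin 3) K) (φ' : X → zeroLocus {G'}), IsEllipticQuotient X G' φ' →
      ∃ θ : Iso (zeroLocus {G}) (zeroLocus {G'}), ∀ x, θ (φ x) = φ' x

end CoverCurve

open CoverCurve MvPolynomial

/-- The data of the equations `y²z = f(x,z)`, `w² = q(x,y,z)` in projective 3-space, with
`f = x³ + a₂x²z + a₄xz² + a₆z³` and `q` a ternary quadratic form. -/
structure CoverData (K : Type*) [Field K] where
  a₂ : K
  a₄ : K
  a₆ : K
  q : MvPolynomial (Fin 3) K
  isHomogeneous_q : q.IsHomogeneous 2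

namespace CoverData

variable {K : Type*} [Field K] (D : CoverData K)

/-- The form `y²z - f(x,z)` in `K[x,y,z]`. -/
def cubic : MvPolynomial (Fin 3) K :=
  X 1 ^ 2 * X 2 - (X 0 ^ 3 + C D.a₂ * X 0 ^ 2 * X 2 + C D.a₄ * X 0 * X 2 ^ 2 + C D.a₆ * X 2 ^ 3)

/-- The form `P = y²z - f(x,z)` in `K[x,y,z,w]`. -/
def P : MvPolynomial (Fin 4) K := rename Fin.castSucc D.cubic

/-- The form `Q = w² - q(x,y,z)` in `K[x,y,z,w]`. -/
def Q : MvPolynomial (Fin 4) K := X 3 ^ 2 - rename Fin.castSucc D.q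

/-- The space curve `V(P, Q)`. -/
def curve : Set (PSpace K 4) := zeroLocus {D.P, D.Q}

/-- The plane curve `E = V(P)`. -/
def base : Set (PSpace K 3) := zeroLocus {D.cubic}

/-- Jacobian criterion: the Jacobian matrix of `(P, Q)` has rank two at every point of `V(P, Q)`. -/
def IsNonsingular : Prop :=
  ∀ v : Fin 4 → K, v ≠ 0 → eval v D.P = 0 → eval v D.Q = 0 →
    LinearIndependent K ![grad D.P v, grad D.Q v]

/-- A DCEC is a nonsingular curve `V(P, Q)`; a UDCEC is a DCEC with a unique elliptic quotient of
degree two. -/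
def IsUDCEC : Prop := D.IsNonsingular ∧ HasUniqueEllipticQuotient D.curve

/-- The Weierstrass equation `y² = x³ + a₂x² + a₄x + a₆` of `E`. -/
abbrev weierstrass : WeierstrassCurve K := ⟨0, D.a₂, 0, D.a₄, D.a₆⟩

theorem cubic_eq : D.cubic = WeierstrassCurve.Projective.polynomial D.weierstrass := by
  simp [cubic, WeierstrassCurve.Projective.polynomial]

theorem isHomogeneous_cubic : D.cubic.IsHomogeneous 3 := by
  have hX : ∀ i : Fin 3, (X i : MvPolynomial (Fin 3) K).IsHomogeneous 1 := isHomogeneous_X K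
  have hC : ∀ c : K, (C c : MvPolynomial (Fin 3) K).IsHomogeneous 0 := isHomogeneous_C _
  refine (((hX 1).pow 2).mul (hX 2)).sub (.add (.add (.add ((hX 0).pow 3) ?_) ?_) ?_)
  · exact ((hC _).mul ((hX 0).pow 2)).mul (hX 2)
  · exact ((hC _).mul (hX 0)).mul ((hX 2).pow 2)
  · exact (hC _).mul ((hX 2).pow 3)

/-- If `V(P, Q)` is nonsingular then so is `E`. -/
theorem isElliptic [IsAlgClosed K] (h2 : (2 : K) ≠ 0) (h : D.IsNonsingular) :
    D.weierstrass.IsElliptic := by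
  refine ⟨isUnit_iff_ne_zero.mpr fun hΔ => ?_⟩
  let c : Cubic K := ⟨1, D.a₂, D.a₄, D.a₆⟩
  have hc : c.a ≠ 0 := one_ne_zero
  obtain ⟨r, s, t, hroots⟩ := (Cubic.splits_iff_roots_eq_three (φ := RingHom.id K) hc).mp
    (IsAlgClosed.splits _)
  have e2 : D.a₂ = -(r + s + t) := by simpa [c] using Cubic.b_eq_three_roots hc hroots
  have e4 : D.a₄ = r * s + r * t + s * t := by
    simpa [c] using Cubic.c_eq_three_roots hc hroots
  have e6 : D.a₆ = -(r * s * t) := by simpa [c] using Cubic.d_eq_three_roots hc hroots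
  have hprod : (2 : K) ^ 4 * ((r - s) * (r - t) * (s - t)) ^ 2 = 0 := by
    rw [← hΔ]
    simp only [WeierstrassCurve.Δ, WeierstrassCurve.b₂, WeierstrassCurve.b₄, WeierstrassCurve.b₆,
      WeierstrassCurve.b₈, e2, e4, e6]
    ring
  have hdouble : ∃ u v : K, D.a₂ = -(2 * u + v) ∧ D.a₄ = u ^ 2 + 2 * u * v ∧ D.a₆ = -(u ^ 2 * v) := by
    have h0 : (r - s) * (r - t) * (s - t) = 0 := by
      rcases mul_eq_zero.mp hprod with h | h
      · exact absurd h (pow_ne_zero _ h2)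
      · exact pow_eq_zero_iff (two_ne_zero) |>.mp h
    rcases mul_eq_zero.mp h0 with h0 | h0
    · rcases mul_eq_zero.mp h0 with h0 | h0
      · obtain rfl := sub_eq_zero.mp h0
        exact ⟨r, t, by rw [e2]; ring, by rw [e4]; ring, by rw [e6]; ring⟩
      · obtain rfl := sub_eq_zero.mp h0
        exact ⟨r, s, by rw [e2]; ring, by rw [e4]; ring, by rw [e6]; ring⟩
    · obtain rfl := sub_eq_zero.mp h0
      exact ⟨s, r, by rw [e2]; ring, by rw [e4]; ring, by rw [e6]; ring⟩
  obtain ⟨u, v, d2, d4, d6⟩ := hdouble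
  obtain ⟨w, hw⟩ := IsAlgClosed.exists_pow_nat_eq (eval ![u, 0, 1] D.q) (n := 2) (by norm_num)
  have hrestr : (![u, 0, 1, w] : Fin 4 → K) ∘ Fin.castSucc = ![u, 0, 1] := by
    ext i; fin_cases i <;> rfl
  have hP : eval ![u, 0, 1, w] D.P = 0 := by
    rw [P, eval_rename, hrestr]
    simp [cubic, d2, d4, d6]
    ring
  have hQ : eval ![u, 0, 1, w] D.Q = 0 := by
    simp [Q, eval_rename, hrestr, hw]
  have hv : (![u, 0, 1, w] : Fin 4 → K) ≠ 0 := fun h => one_ne_zero (congrFun h 2)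
  have hg : grad D.P ![u, 0, 1, w] = 0 := by
    ext i
    fin_cases i <;> simp [grad, P, cubic, pderiv_X, d2, d4, d6] <;> ring
  exact (h _ hv hP hQ).ne_zero 0 (by simpa using hg)

/-- The `j`-invariant of `E`, namely `c₄³ / Δ` (with `Δ ≠ 0` whenever `V(P, Q)` is nonsingular). -/
def jInvariant : K := D.weierstrass.c₄ ^ 3 / D.weierstrass.Δ

theorem jInvariant_eq [D.weierstrass.IsElliptic] : D.jInvariant = D.weierstrass.j := by
  rw [jInvariant, WeierstrassCurve.j, div_eq_inv_mul, Units.val_inv_eq_inv_val,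
    WeierstrassCurve.coe_Δ']

/-- The origin `(0 : 1 : 0)` of `E`. -/
def origin : D.base :=
  ⟨Projectivization.mk K ![0, 1, 0] fun h => one_ne_zero (congrFun h 1), by
    intro G hG
    obtain rfl : G = D.cubic := hG
    obtain ⟨a, ha⟩ := Projectivization.exists_smul_eq_mk_rep K (![0, 1, 0] : Fin 3 → K)
      fun h => one_ne_zero (congrFun h 1)
    rw [← ha]
    simp [cubic]⟩

/-- The group element given by a point of `E` (in the group law with origin `(0 : 1 : 0)`). -/
def toPoint (x : D.base) : D.weierstrass.toAffine.Point :=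
  WeierstrassCurve.Projective.Point.toAffine D.weierstrass x.1.rep

theorem toPoint_origin : D.toPoint D.origin = 0 := by
  obtain ⟨a, ha⟩ := Projectivization.exists_smul_eq_mk_rep K (![0, 1, 0] : Fin 3 → K)
      fun h => one_ne_zero (congrFun h 1)
  refine WeierstrassCurve.Projective.Point.toAffine_of_Z_eq_zero ?_
  change (Projectivization.mk K ![0, 1, 0] _).rep 2 = 0
  rw [← ha]
  simp [Units.smul_def]

/-- The identity `ψ^* q₂ = c q₁` for a morphism `ψ : E₁ → E₂`.  In homogeneous coordinates
`ψ^* x = F₀ / H`, `ψ^* y = F₁ / H`, `ψ^* z = F₂ / H` of degree one for `ψ`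
(forms `Fᵢ` of degree `e + 1` and a form `H` of degree `e`), it says
`q₂ (ψ^* x, ψ^* y, ψ^* z) = c q₁` on `E₁`; denominators are cleared. -/
def PullbackEq (D₁ D₂ : CoverData K) (ψ : D₁.base → D₂.base) (c : K) : Prop :=
  ∃ (e : ℕ) (F : Fin 3 → MvPolynomial (Fin 3) K) (H : MvPolynomial (Fin 3) K),
    Represents (e + 1) F ψ ∧ H.IsHomogeneous e ∧
    (∃ x : D₁.base, evalVec F x.1.rep ≠ 0) ∧ (∃ x : D₁.base, eval x.1.rep H ≠ 0) ∧
    ∀ v : Fin 3 → K, eval v D₁.cubic = 0 →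
      eval (evalVec F v) D₂.q = c * eval v H ^ 2 * eval v D₁.q

end CoverData

end

noncomputable section

/-! ### Restriction of polynomials to a line through the vertex of the affine cone -/

namespace CoverCurve

open MvPolynomial

variable {K : Type*} [Field K]

/-! Nonsingularity of the cover at its points with `w = 0` says that `q` has only simple zeros on
the plane cubic `E`. This makes an isomorphism compatible with the quadratic forms linear, and
linearity gives both the lift to the covers and the torsion statement.

From `ψ` to the covers: suppose `q₂(F) = c H² q₁` on `E₁`, where `F` represents `ψ`. Near a given
point choose another representative `F'` with `F' j` nonvanishing there. Comparing `F` and `F'`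
gives `2 ord H + ord q₁ = 2 ord (F j) + ord q₂(F')`. Since `ψ` is unramified and the zeros of `q₂`
are simple, the last term is at most 1 (`ord_aeval_le_one`), so `ord H ≤ ord (F j)` by parity. Hence
every `F i / H` is regular on the punctured cone. The cone has depth two, so such a quotient is
regular on the whole cone (`mem_span_of_forall_exists`) and, by degree, is a linear form
(`CoverData.exists_isLinear`). Thus `ψ` is induced by an invertible matrix `M` with `q₂ ∘ M = c q₁`
on `E₁`, and `(u, w) ↦ (M u, s w)` with `s² = c` is an isomorphism of covers
(`IsLinear.nonempty_iso`).

From the covers to `ψ`: the projection of `C₁`, and that of `C₂` composed with `α : C₁ → C₂`, are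
both elliptic quotients of `C₁`, so by uniqueness they differ by some `ψ` (`exists_iso_base`). Then
`α` commutes with `w ↦ -w`. Writing its coordinates as `A + w B` and comparing the values at `w` and
`-w` shows that `q₂ ∘ ψ` is `q₁` times the square of a rational function, so `c = 1` works
(`pullbackEq_of_lift`). For the `j`-invariants, a translation makes `ψ` preserve origins; as `O` is
the triple intersection with the line `z = 0`, another order count shows that the result is linear
(`exists_isLinear_of_origin`), hence a Weierstrass change of variables.

Torsion: `ψ` and `ι` are both linear, so `ι⁻¹ ∘ ψ` carries the flex `O` to a point `R` that is the
only intersection of `E₁` with some line. Then `3R = 0`, which is stronger than `6R = 0`. -/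

theorem aeval_mul_of_isHomogeneous {σ B : Type*} [CommRing B] [Algebra K B]
    {A : MvPolynomial σ K} {n : ℕ} (hA : A.IsHomogeneous n) (r : B) (g : σ → B) :
    aeval (fun i => r * g i) A = r ^ n * aeval g A := by
  rw [A.as_sum, map_sum, map_sum, Finset.mul_sum]
  refine Finset.sum_congr rfl fun d hd => ?_
  have hdeg : ∑ i ∈ d.support, d i = n := by
    have := hA.degree_eq_sum_deg_support hd
    rw [← this]
  rw [aeval_monomial, aeval_monomial, Finsupp.prod, Finsupp.prod]
  simp only [mul_pow, Finset.prod_mul_distrib]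
  rw [Finset.prod_pow_eq_pow_sum, hdeg]
  ring

theorem eval_smul_of_isHomogeneous {σ : Type*} {A : MvPolynomial σ K} {n : ℕ}
    (hA : A.IsHomogeneous n) (r : K) (v : σ → K) : eval (r • v) A = r ^ n * eval v A := by
  exact aeval_mul_of_isHomogeneous hA r v

/-- Restriction of polynomials to the line spanned by `v`. -/
def evLine {m : ℕ} (v : Fin m → K) : MvPolynomial (Fin m) K →ₐ[K] Polynomial K :=
  aeval fun i => Polynomial.X * Polynomial.C (v i)

theorem evLine_of_isHomogeneous {m : ℕ} (v : Fin m → K) {A : MvPolynomial (Fin m) K} {n : ℕ}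
    (hA : A.IsHomogeneous n) : evLine v A = Polynomial.X ^ n * Polynomial.C (eval v A) := by
  rw [evLine, aeval_mul_of_isHomogeneous hA]
  congr 1
  have : aeval (fun i => Polynomial.C (v i)) A = aeval (algebraMap K (Polynomial K) ∘ v) A := rfl
  rw [this, aeval_algebraMap_apply]
  rfl

theorem eval_evLine {m : ℕ} (v : Fin m → K) (A : MvPolynomial (Fin m) K) (s : K) :
    (evLine v A).eval s = eval (s • v) A := by
  have : (Polynomial.aeval s).comp (evLine v) = aeval (s • v) := by
    ext i; simpa [evLine] using mul_comm _ _
  simpa [aeval_eq_eval, Polynomial.coe_aeval_eq_eval] using congrArg (fun f => f A) this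

/-- Modulo these two linear forms every variable is a multiple of `X k`, so the quotient map factors
through restriction to the line. -/
theorem mem_span_of_evLine_eq_zero {v : Fin 3 → K} {k a b : Fin 3} (hk : v k ≠ 0)
    (hkab : ∀ i, i = k ∨ i = a ∨ i = b) {A : MvPolynomial (Fin 3) K} (hA : evLine v A = 0) :
    A ∈ Ideal.span {C (v k) * X a - C (v a) * X k, C (v k) * X b - C (v b) * X k} := by
  set I : Ideal (MvPolynomial (Fin 3) K) :=
    Ideal.span {C (v k) * X a - C (v a) * X k, C (v k) * X b - C (v b) * X k}
  rw [← Ideal.Quotient.eq_zero_iff_mem]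
  let T := Ideal.Quotient.mkₐ K I (C (v k)⁻¹ * X k)
  have key : (Ideal.Quotient.mkₐ K I) = (Polynomial.aeval T).comp (evLine v) := by
    ext i
    have hrel : ∀ j, C (v k) * X j - C (v j) * X k ∈ I → Ideal.Quotient.mkₐ K I (X j) =
        ((Polynomial.aeval T).comp (evLine v)) (X j) := by
      intro j hj
      have h1 : ((Polynomial.aeval T).comp (evLine v)) (X j) =
          Ideal.Quotient.mkₐ K I (C (v k)⁻¹ * X k * C (v j)) := by
        have hC : ∀ c : K, Ideal.Quotient.mkₐ K I (C c) = algebraMap K _ c := fun c => rfl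
        simp only [evLine, T, map_mul, AlgHom.comp_apply, aeval_X, Polynomial.aeval_X,
          Polynomial.aeval_C, hC]
      rw [h1]
      apply Ideal.Quotient.eq.mpr
      have h2 : (X j - C (v k)⁻¹ * X k * C (v j) : MvPolynomial (Fin 3) K) =
          C (v k)⁻¹ * (C (v k) * X j - C (v j) * X k) := by
        have : (C (v k)⁻¹ * C (v k) : MvPolynomial (Fin 3) K) = 1 := by
          rw [← C_mul, inv_mul_cancel₀ hk, C_1]
        linear_combination (-X j) * this
      rw [h2]
      exact I.mul_mem_left _ hj
    rcases hkab i with rfl | rfl | rfl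
    · exact hrel _ (by simp)
    · exact hrel _ (Ideal.subset_span (by simp))
    · exact hrel _ (Ideal.subset_span (by simp))
  have := congrArg (fun f => f A) key
  simp only [AlgHom.comp_apply, hA, map_zero] at this
  exact this

theorem grad_combination {m : ℕ} {v : Fin m → K} {ℓ ℓ' A B : MvPolynomial (Fin m) K}
    (h : eval v ℓ = 0) (h' : eval v ℓ' = 0) :
    grad (A * ℓ + B * ℓ') v = eval v A • grad ℓ v + eval v B • grad ℓ' v := by
  ext i
  simp [grad, h, h']

/-- If two polynomials vanish on the line spanned by `v` and have independent gradients at `v`,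
they generate the ideal of that line near `v`. -/
theorem exists_mul_mem_span_pair {v : Fin 3 → K} (hv : v ≠ 0) {P Q : MvPolynomial (Fin 3) K}
    (hP : evLine v P = 0) (hQ : evLine v Q = 0)
    (hLI : LinearIndependent K ![grad P v, grad Q v]) :
    ∃ U : MvPolynomial (Fin 3) K, eval v U ≠ 0 ∧
      ∀ A, evLine v A = 0 → U * A ∈ Ideal.span {P, Q} := by
  obtain ⟨k, hk⟩ := Function.ne_iff.mp hv
  obtain ⟨a, b, hkab⟩ : ∃ a b : Fin 3, ∀ i, i = k ∨ i = a ∨ i = b := by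
    clear hk; revert k; decide
  replace hk : v k ≠ 0 := hk
  set ℓ : MvPolynomial (Fin 3) K := C (v k) * X a - C (v a) * X k
  set ℓ' : MvPolynomial (Fin 3) K := C (v k) * X b - C (v b) * X k
  have hℓ : eval v ℓ = 0 := by simp [ℓ]; ring
  have hℓ' : eval v ℓ' = 0 := by simp [ℓ']; ring
  obtain ⟨Pa, Pb, rfl⟩ := Ideal.mem_span_pair.mp (mem_span_of_evLine_eq_zero hk hkab hP)
  obtain ⟨Qa, Qb, rfl⟩ := Ideal.mem_span_pair.mp (mem_span_of_evLine_eq_zero hk hkab hQ)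
  -- Cramer's rule: this is the determinant expressing `P`, `Q` through the two linear forms that
  -- generate the ideal of the line. If it vanished at `v`, the gradients would be dependent.
  refine ⟨Pa * Qb - Pb * Qa, fun h0 => ?_, fun A hA => ?_⟩
  · rw [LinearIndependent.pair_iff] at hLI
    rw [grad_combination hℓ hℓ', grad_combination hℓ hℓ'] at hLI
    simp only [map_sub, map_mul] at h0
    have h1 := hLI (eval v Qa) (-eval v Pa) (by
      ext i
      simp only [Pi.add_apply, Pi.smul_apply, smul_eq_mul, Pi.zero_apply]
      linear_combination (-grad ℓ' v i) * h0)
    have h3 := hLI (eval v Qb) (-eval v Pb) (by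
      ext i
      simp only [Pi.add_apply, Pi.smul_apply, smul_eq_mul, Pi.zero_apply]
      linear_combination (grad ℓ v i) * h0)
    have h4 := hLI 1 0 (by
      rw [neg_eq_zero.mp h1.2, neg_eq_zero.mp h3.2]; simp)
    exact one_ne_zero h4.1
  · obtain ⟨Aa, Ab, rfl⟩ := Ideal.mem_span_pair.mp (mem_span_of_evLine_eq_zero hk hkab hA)
    refine Ideal.mem_span_pair.mpr ⟨Aa * Qb - Ab * Qa, Ab * Pa - Aa * Pb, by ring⟩

/-- A linear form vanishing at `v` whose coefficient vector is independent of a given one. -/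
theorem exists_linear_form {v g : Fin 3 → K} (hv : v ≠ 0) (hg : g ≠ 0) :
    ∃ ℓ : MvPolynomial (Fin 3) K, ℓ.IsHomogeneous 1 ∧ eval v ℓ = 0 ∧
      LinearIndependent K ![g, grad ℓ v] := by
  obtain ⟨k, hk⟩ := Function.ne_iff.mp hv
  obtain ⟨a, b, hka, hkb, hab⟩ : ∃ a b : Fin 3, k ≠ a ∧ k ≠ b ∧ a ≠ b := by
    clear hk; revert k; decide
  replace hk : v k ≠ 0 := hk
  by_contra! hcon
  have main : ∀ j, j ≠ k → ∃ s, ∀ i, grad (C (v k) * X j - C (v j) * X k) v i = s * g i := by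
    intro j hj
    have h1 := hcon (C (v k) * X j - C (v j) * X k)
      ((isHomogeneous_C_mul_X _ _).sub (isHomogeneous_C_mul_X _ _)) (by simp; ring)
    rw [LinearIndependent.pair_iff] at h1
    push Not at h1
    obtain ⟨s, t, hst, hne⟩ := h1
    have ht : t ≠ 0 := by
      rintro rfl
      have hs : s ≠ 0 := fun h => hne h rfl
      simp only [zero_smul, add_zero] at hst
      exact hg ((smul_eq_zero.mp hst).resolve_left hs)
    refine ⟨-s / t, fun i => ?_⟩
    have := congrFun hst i
    simp only [Pi.add_apply, Pi.smul_apply, smul_eq_mul, Pi.zero_apply] at this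
    field_simp
    linear_combination this
  obtain ⟨s, hs⟩ := main a hka.symm
  obtain ⟨t, ht⟩ := main b hkb.symm
  have e1 := hs a
  have e2 := ht a
  have e3 := ht b
  simp [grad, pderiv_X, hka, hkb, hab.symm] at e1 e2 e3
  rcases e2 with rfl | h
  · simp at e3; exact hk e3
  · rw [h] at e1; simp at e1; exact hk e1

end CoverCurve

open CoverCurve MvPolynomial

/-! ### The cubic form: irreducibility, depth of its cone, orders of vanishing -/

namespace CoverData

variable {K : Type*} [Field K] (D : CoverData K)

theorem eval_cubic (v : Fin 3 → K) : eval v D.cubic =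
    v 1 ^ 2 * v 2 - (v 0 ^ 3 + D.a₂ * v 0 ^ 2 * v 2 + D.a₄ * v 0 * v 2 ^ 2 + D.a₆ * v 2 ^ 3) := by
  simp [cubic]

theorem prime_cubic_of_eisenstein {R : Type*} [CommRing R] [IsDomain R] [UniqueFactorizationMonoid R]
    {π a b c : R} (hπ : Prime π) (ha : π ∣ a) (hb : π ∣ b) (hc : π ∣ c) (hc2 : ¬ π ^ 2 ∣ c) :
    Prime (Polynomial.X ^ 3 + (Polynomial.C a * Polynomial.X ^ 2 + Polynomial.C b * Polynomial.X
      + Polynomial.C c)) := by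
  set f : Polynomial R := Polynomial.X ^ 3 + (Polynomial.C a * Polynomial.X ^ 2
    + Polynomial.C b * Polynomial.X + Polynomial.C c) with hf
  have hlt : (Polynomial.C a * Polynomial.X ^ 2 + Polynomial.C b * Polynomial.X
      + Polynomial.C c).degree < ((3 : ℕ) : WithBot ℕ) :=
    lt_of_le_of_lt Polynomial.degree_quadratic_le (by decide)
  have hm : f.Monic := Polynomial.monic_X_pow_add hlt
  have hdeg : f.degree = 3 := by
    rw [hf, Polynomial.degree_add_eq_left_of_degree_lt] <;> rw [Polynomial.degree_X_pow]
    · rfl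
    · exact hlt
  refine (Polynomial.irreducible_of_eisenstein_criterion (P := Ideal.span {π})
    ((Ideal.span_singleton_prime hπ.ne_zero).mpr hπ) ?_ ?_ ?_ ?_ hm.isPrimitive).prime
  · rw [hm.leadingCoeff, Ideal.mem_span_singleton]
    exact hπ.not_dvd_one
  · intro n hn
    rw [hdeg] at hn
    have hn3 : n < 3 := by exact_mod_cast hn
    rw [Ideal.mem_span_singleton]
    interval_cases n
    · simpa [hf] using hc
    · simpa [hf, Polynomial.coeff_X, Polynomial.coeff_C] using hb
    · simpa [hf, Polynomial.coeff_X, Polynomial.coeff_C] using ha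
  · rw [hdeg]; decide
  · rw [Ideal.span_singleton_pow, Ideal.mem_span_singleton]
    simpa [hf] using hc2

theorem finSuccEquiv_neg_cubic : finSuccEquiv K 2 (-D.cubic) =
    Polynomial.X ^ 3 + (Polynomial.C (C D.a₂ * X 1) * Polynomial.X ^ 2
      + Polynomial.C (C D.a₄ * X 1 ^ 2) * Polynomial.X
      + Polynomial.C (X 1 * (C D.a₆ * X 1 ^ 2 - X 0 ^ 2))) := by
  have h1 : finSuccEquiv K 2 (X 1) = Polynomial.C (X 0) := finSuccEquiv_X_succ (j := 0)
  have h2 : finSuccEquiv K 2 (X 2) = Polynomial.C (X 1) := finSuccEquiv_X_succ (j := 1)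
  have h0 : finSuccEquiv K 2 (X 0) = Polynomial.X := finSuccEquiv_X_zero
  have hC : ∀ a, finSuccEquiv K 2 (C a) = Polynomial.C (C a) := fun a => by
    rw [finSuccEquiv_apply, eval₂Hom_C]; rfl
  simp only [cubic, map_neg, map_sub, map_add, map_mul, map_pow, h0, h1, h2, hC]
  ring

theorem not_X_sq_dvd (a : K) :
    ¬ (X 1 : MvPolynomial (Fin 2) K) ^ 2 ∣ X 1 * (C a * X 1 ^ 2 - X 0 ^ 2) := by
  have hX : Prime (X 1 : MvPolynomial (Fin 2) K) := X_prime
  rw [pow_two (X 1), mul_dvd_mul_iff_left hX.ne_zero]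
  intro h
  rw [dvd_sub_right (Dvd.dvd.mul_left (Dvd.intro _ rfl) _)] at h
  have := hX.dvd_of_dvd_pow h
  rw [X_dvd_X] at this
  simp at this
-- Eisenstein at `z`, viewing `-P` as a monic cubic in `x` over `K[y, z]`: the constant term `z (a₆
-- z² - y²)` is divisible by `z` only once. No smoothness is needed.
theorem prime_cubic : Prime D.cubic := by
  rw [← neg_neg D.cubic]
  refine Prime.neg ?_
  rw [← MulEquiv.prime_iff (finSuccEquiv K 2), finSuccEquiv_neg_cubic]
  exact prime_cubic_of_eisenstein X_prime (dvd_mul_left _ _)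
    (Dvd.dvd.mul_left (dvd_pow_self _ two_ne_zero) _) (dvd_mul_right _ _) (not_X_sq_dvd _)

theorem dvd_of_vanish [IsAlgClosed K] {T : MvPolynomial (Fin 3) K}
    (h : ∀ v, eval v D.cubic = 0 → eval v T = 0) : D.cubic ∣ T := by
  have hp : (Ideal.span {D.cubic}).IsPrime :=
    (Ideal.span_singleton_prime D.prime_cubic.ne_zero).mpr D.prime_cubic
  rw [← Ideal.mem_span_singleton,
    ← MvPolynomial.IsPrime.vanishingIdeal_zeroLocus (K := K) (Ideal.span {D.cubic})]
  rw [mem_vanishingIdeal_iff]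
  intro v hv
  exact h v (hv _ (Ideal.mem_span_singleton_self _))

theorem not_cubic_dvd_of_isHomogeneous {A : MvPolynomial (Fin 3) K} {n : ℕ}
    (hA : A.IsHomogeneous n) (hn : n < 3) (h0 : A ≠ 0) : ¬ D.cubic ∣ A := by
  rintro ⟨B, rfl⟩
  have h1 := hA.totalDegree h0
  rw [totalDegree_mul_of_isDomain (left_ne_zero_of_mul h0) (right_ne_zero_of_mul h0),
    D.isHomogeneous_cubic.totalDegree (left_ne_zero_of_mul h0)] at h1
  omega

theorem not_cubic_dvd_X (i : Fin 3) : ¬ D.cubic ∣ X i :=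
  D.not_cubic_dvd_of_isHomogeneous (isHomogeneous_X K i) (by norm_num) (X_ne_zero i)

/-- Modulo `z` the cubic becomes `-x³`, so `y` is a nonzerodivisor modulo `(z, P)`. This is the
depth-two property of the cone. -/
theorem exists_of_X_one_mul {U A B : MvPolynomial (Fin 3) K}
    (h : X 1 * U = X 2 * A + D.cubic * B) : ∃ U' B', U = X 2 * U' + D.cubic * B' := by
  set c : MvPolynomial (Fin 3) K :=
    X 1 ^ 2 - C D.a₂ * X 0 ^ 2 - C D.a₄ * X 0 * X 2 - C D.a₆ * X 2 ^ 2 with hc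
  have hcub : D.cubic = X 2 * c - X 0 ^ 3 := by rw [hc, cubic]; ring
  -- Setting `y = z = 0` in `h` leaves `x³ B(x, 0, 0) = 0`, so `B` lies in `(y, z)`.
  have hB : evLine ![1, 0, 0] B = 0 := by
    have h1 := congrArg (evLine (![1, 0, 0] : Fin 3 → K)) h
    rw [hcub] at h1
    simp [evLine] at h1
    simpa [evLine] using h1
  have hB' := mem_span_of_evLine_eq_zero (k := 0) (a := 1) (b := 2) (by simp) (by decide) hB
  obtain ⟨b₁, b₂, rfl⟩ := Ideal.mem_span_pair.mp hB'
  simp only [Matrix.cons_val_zero, Matrix.cons_val_one, Matrix.cons_val, C_1, C_0, zero_mul,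
    one_mul, sub_zero] at h ⊢
  have h2 : (X 2 : MvPolynomial (Fin 3) K) ∣ X 1 * (U + X 0 ^ 3 * b₁) :=
    ⟨A + c * (b₁ * X 1 + b₂ * X 2) - X 0 ^ 3 * b₂, by rw [hcub] at h; linear_combination h⟩
  obtain ⟨W, hW⟩ := ((X_prime).dvd_or_dvd h2).resolve_left (by rw [X_dvd_X]; simp)
  exact ⟨W - c * b₁, b₁, by rw [hcub]; linear_combination hW⟩

theorem exists_of_X_one_pow_mul {U A B : MvPolynomial (Fin 3) K} (n : ℕ)
    (h : X 1 ^ n * U = X 2 * A + D.cubic * B) : ∃ U' B', U = X 2 * U' + D.cubic * B' := by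
  induction n generalizing A B with
  | zero => exact ⟨A, B, by simpa using h⟩
  | succ n ih =>
    obtain ⟨A', B', h'⟩ := D.exists_of_X_one_mul (U := X 1 ^ n * U) (A := A) (B := B)
      (by rw [← h]; ring)
    exact ih h'

/-- The fraction `F / H` has denominators `z ^ n` and `y ^ m`; since `z, y` is a regular sequence
modulo the cubic, powers of `z` can be cancelled one at a time. -/
theorem mem_span_of_pow_mul_mem {F H : MvPolynomial (Fin 3) K} (hH : ¬ D.cubic ∣ H) {m n : ℕ}
    (hz : X 2 ^ n * F ∈ Ideal.span {H, D.cubic}) (hy : X 1 ^ m * F ∈ Ideal.span {H, D.cubic}) :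
    F ∈ Ideal.span {H, D.cubic} := by
  obtain ⟨U₂, B₂, h₂⟩ := Ideal.mem_span_pair.mp hy
  induction n with
  | zero => simpa using hz
  | succ n ih =>
    apply ih
    obtain ⟨U₁, B₁, h₁⟩ := Ideal.mem_span_pair.mp hz
    have h3 : D.cubic ∣ H * (X 1 ^ m * U₁ - X 2 ^ (n + 1) * U₂) :=
      ⟨X 2 ^ (n + 1) * B₂ - X 1 ^ m * B₁, by
        linear_combination X 1 ^ m * h₁ - X 2 ^ (n + 1) * h₂⟩
    obtain ⟨T, hT⟩ := (D.prime_cubic.dvd_or_dvd h3).resolve_left hH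
    obtain ⟨U', B', hU⟩ := D.exists_of_X_one_pow_mul (U := U₁) (A := X 2 ^ n * U₂) (B := T) m
      (by linear_combination hT)
    have h4 : D.cubic ∣ X 2 * (X 2 ^ n * F - H * U') :=
      ⟨B₁ + H * B', by rw [hU] at h₁; linear_combination -h₁⟩
    obtain ⟨T', hT'⟩ := (D.prime_cubic.dvd_or_dvd h4).resolve_left (D.not_cubic_dvd_X 2)
    exact Ideal.mem_span_pair.mpr ⟨U', T', by linear_combination -hT'⟩

/-- A quotient `F / H` that is regular at every point of the cone except the vertex is regular. -/
theorem mem_span_of_forall_exists [IsAlgClosed K] {F H : MvPolynomial (Fin 3) K}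
    (hH : ¬ D.cubic ∣ H)
    (h : ∀ v, v ≠ 0 → eval v D.cubic = 0 →
      ∃ V, eval v V ≠ 0 ∧ V * F ∈ Ideal.span {H, D.cubic}) :
    F ∈ Ideal.span {H, D.cubic} := by
  -- The ideal of denominators of `F / H`. By hypothesis its zeros lie in `{0}`, so by the
  -- Nullstellensatz it contains a power of each variable.
  let J : Ideal (MvPolynomial (Fin 3) K) :=
    Submodule.comap (LinearMap.mulRight (MvPolynomial (Fin 3) K) F) (Ideal.span {H, D.cubic})
  have hJ : ∀ V, V ∈ J ↔ V * F ∈ Ideal.span {H, D.cubic} := fun V => Iff.rfl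
  have key : ∀ i, ∃ n, X i ^ n * F ∈ Ideal.span {H, D.cubic} := by
    intro i
    suffices hi : X i ∈ J.radical from hi
    rw [← vanishingIdeal_zeroLocus_eq_radical (K := K), mem_vanishingIdeal_iff]
    intro v hv
    rcases eq_or_ne v 0 with rfl | hv0
    · simp
    · exfalso
      have hcub : eval v D.cubic = 0 := hv _ ((hJ _).mpr
        (Ideal.mul_mem_right _ _ (Ideal.subset_span (by simp))))
      obtain ⟨V, hV, hVF⟩ := h v hv0 hcub
      exact hV (hv _ ((hJ _).mpr hVF))
  obtain ⟨n, hn⟩ := key 2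
  obtain ⟨m, hm⟩ := key 1
  exact D.mem_span_of_pow_mul_mem hH hn hm

/-- The order of vanishing of forms along the plane cubic at the point given by `v`. -/
structure OrderAt (v : Fin 3 → K) where
  ord : MvPolynomial (Fin 3) K → ℕ∞
  map_mul : ∀ A B, ord (A * B) = ord A + ord B
  eq_top_iff : ∀ A, ord A = ⊤ ↔ D.cubic ∣ A
  congr : ∀ A B, D.cubic ∣ A - B → ord A = ord B
  eq_zero_iff : ∀ {A n}, A.IsHomogeneous n → (ord A = 0 ↔ eval v A ≠ 0)
  eq_zero_of_eval_ne_zero : ∀ {A}, eval v A ≠ 0 → ord A = 0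
  eq_one : ∀ {Q n}, Q.IsHomogeneous n → eval v Q = 0 →
    LinearIndependent K ![grad D.cubic v, grad Q v] → ord Q = 1
  exists_of_le : ∀ {A H m n}, A.IsHomogeneous m → H.IsHomogeneous n → ord H ≤ ord A →
    ∃ V, eval v V ≠ 0 ∧ V * A ∈ Ideal.span {H, D.cubic}

theorem not_cubic_dvd_of_linearIndependent {v : Fin 3 → K} (hv : eval v D.cubic = 0)
    {Q : MvPolynomial (Fin 3) K} (h : LinearIndependent K ![grad D.cubic v, grad Q v]) :
    ¬ D.cubic ∣ Q := by
  rintro ⟨T, rfl⟩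
  have h1 : grad (D.cubic * T) v = eval v T • grad D.cubic v := by
    ext i; simp [grad, hv, mul_comm]
  rw [h1, LinearIndependent.pair_iff] at h
  have := h (eval v T) (-1) (by simp)
  simp at this

/-- The order is taken in the homogeneous coordinate ring, localized at the prime of the line
through `v`; no affine chart has to be chosen. Smoothness at `v` makes the maximal ideal principal,
so this local ring is a discrete valuation ring, and any form vanishing at `v` with gradient
independent of that of the cubic is a uniformizer. -/
theorem nonempty_orderAt [IsAlgClosed K] {v : Fin 3 → K} (hv : v ≠ 0) (hcub : eval v D.cubic = 0)
    (hg : grad D.cubic v ≠ 0) : Nonempty (D.OrderAt v) := by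
  let I : Ideal (MvPolynomial (Fin 3) K) := Ideal.span {D.cubic}
  let S := MvPolynomial (Fin 3) K ⧸ I
  have hI : I.IsPrime := (Ideal.span_singleton_prime D.prime_cubic.ne_zero).mpr D.prime_cubic
  have hlinecub : evLine v D.cubic = 0 := by
    rw [evLine_of_isHomogeneous v D.isHomogeneous_cubic, hcub]; simp
  let f : S →+* Polynomial K := Ideal.Quotient.lift I (evLine v).toRingHom (by
    intro a ha
    obtain ⟨b, rfl⟩ := Ideal.mem_span_singleton.mp ha
    simp [hlinecub])
  have hf : ∀ A, f (Ideal.Quotient.mk I A) = evLine v A := fun A => rfl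
  let p : Ideal S := RingHom.ker f
  have hp : p.IsPrime := RingHom.ker_isPrime f
  let R := Localization.AtPrime p
  let φ : MvPolynomial (Fin 3) K →+* R := (algebraMap S R).comp (Ideal.Quotient.mk I)
  have hinj : Function.Injective (algebraMap S R) :=
    IsLocalization.injective R p.primeCompl_le_nonZeroDivisors
  have hφ0 : ∀ A, φ A = 0 ↔ D.cubic ∣ A := by
    intro A
    rw [← Ideal.mem_span_singleton, ← Ideal.Quotient.eq_zero_iff_mem]
    exact map_eq_zero_iff _ hinj
  have hunit : ∀ A, IsUnit (φ A) ↔ evLine v A ≠ 0 := by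
    intro A
    exact IsLocalization.AtPrime.isUnit_to_map_iff R p _
  have hmax : ∀ {Q : MvPolynomial (Fin 3) K} {n}, Q.IsHomogeneous n → eval v Q = 0 →
      LinearIndependent K ![grad D.cubic v, grad Q v] →
      IsLocalRing.maximalIdeal R = Ideal.span {φ Q} := by
    intro Q n hQ hQv hLI
    have hQl : evLine v Q = 0 := by rw [evLine_of_isHomogeneous v hQ, hQv]; simp
    -- `U` is a unit in the localization, so there the ideal of the line is generated by `Q` alone,
    -- the cubic being zero.
    obtain ⟨U, hU, hspan⟩ := exists_mul_mem_span_pair hv hlinecub hQl hLI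
    have hUl : evLine v U ≠ 0 := by
      intro h0
      have := eval_evLine v U 1
      rw [h0] at this
      simp at this
      exact hU this.symm
    apply le_antisymm
    · intro r hr
      obtain ⟨⟨a, s⟩, rfl⟩ := IsLocalization.mk'_surjective p.primeCompl r
      obtain ⟨A, rfl⟩ := Ideal.Quotient.mk_surjective a
      have hA : evLine v A = 0 := by
        by_contra hA
        rw [IsLocalRing.mem_maximalIdeal, mem_nonunits_iff] at hr
        apply hr
        dsimp only
        rw [IsLocalization.mk'_eq_mul_mk'_one]
        refine ((hunit A).mpr hA).mul ?_
        exact IsLocalization.AtPrime.isUnit_mk'_iff R p _ _ |>.mpr (p.primeCompl.one_mem)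
      obtain ⟨α, β, hαβ⟩ := Ideal.mem_span_pair.mp (hspan A hA)
      have h1 : φ U * φ A = φ β * φ Q := by
        rw [← _root_.map_mul, ← hαβ, map_add, _root_.map_mul, _root_.map_mul,
          (hφ0 D.cubic).mpr dvd_rfl]
        ring
      have h2 : φ A ∈ Ideal.span {φ Q} := by
        rw [← Ideal.unit_mul_mem_iff_mem _ ((hunit U).mpr hUl), h1]
        exact Ideal.mul_mem_left _ _ (Ideal.mem_span_singleton_self _)
      dsimp only
      rw [IsLocalization.mk'_eq_mul_mk'_one]
      exact Ideal.mul_mem_right _ _ h2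
    · rw [Ideal.span_singleton_le_iff_mem, IsLocalRing.mem_maximalIdeal, mem_nonunits_iff, hunit]
      simpa using hQl
  obtain ⟨ℓ, hℓ1, hℓ0, hℓLI⟩ := exists_linear_form hv hg
  have hR : IsPrincipalIdealRing R :=
    ((tfae_of_isNoetherianRing_of_isLocalRing_of_isDomain R).out 0 4).mpr
      (⟨⟨φ ℓ, hmax hℓ1 hℓ0 hℓLI⟩⟩ : (IsLocalRing.maximalIdeal R).IsPrincipal)
  have hDVR : IsDiscreteValuationRing R := by
    refine ⟨fun h => ?_⟩
    rw [hmax hℓ1 hℓ0 hℓLI, Ideal.span_singleton_eq_bot, hφ0] at h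
    exact D.not_cubic_dvd_of_linearIndependent hcub hℓLI h
  refine ⟨⟨fun A => IsDiscreteValuationRing.addVal R (φ A), fun A B => ?_, fun A => ?_,
    fun A B h => ?_, fun {A n} hA => ?_, fun {A} hA => ?_, fun {Q n} hQ hQv hLI => ?_,
    fun {A H m n} hA hH hle => ?_⟩⟩
  · rw [_root_.map_mul, IsDiscreteValuationRing.addVal_mul]
  · rw [IsDiscreteValuationRing.addVal_eq_top_iff, hφ0]
  · obtain ⟨T, hT⟩ := h
    have : φ A = φ B := by
      rw [sub_eq_iff_eq_add.mp hT, map_add, _root_.map_mul, (hφ0 D.cubic).mpr dvd_rfl]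
      ring
    rw [this]
  · rw [IsDiscreteValuationRing.addVal_eq_zero_iff, hunit, evLine_of_isHomogeneous v hA]
    simp
  · rw [IsDiscreteValuationRing.addVal_eq_zero_iff, hunit]
    intro h0
    have := eval_evLine v A 1
    rw [h0] at this
    simp at this
    exact hA this.symm
  · exact IsDiscreteValuationRing.addVal_uniformizer
      ((IsDiscreteValuationRing.irreducible_iff_uniformizer _).mpr (hmax hQ hQv hLI))
  · rw [IsDiscreteValuationRing.addVal_le_iff_dvd] at hle
    obtain ⟨r, hr⟩ := hle
    obtain ⟨⟨b, s⟩, rfl⟩ := IsLocalization.mk'_surjective p.primeCompl r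
    obtain ⟨B, rfl⟩ := Ideal.Quotient.mk_surjective b
    obtain ⟨s, hs⟩ := s
    obtain ⟨V, rfl⟩ := Ideal.Quotient.mk_surjective s
    have hV : evLine v V ≠ 0 := hs
    have h2 : φ (V * A) = φ (H * B) := by
      have h3 := IsLocalization.mk'_spec R (Ideal.Quotient.mk I B)
        (⟨Ideal.Quotient.mk I V, hs⟩ : p.primeCompl)
      rw [_root_.map_mul, _root_.map_mul, hr]
      calc φ V * (φ H * _) = φ H * (IsLocalization.mk' R (Ideal.Quotient.mk I B)
        (⟨Ideal.Quotient.mk I V, hs⟩ : p.primeCompl) * φ V) := by ring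
        _ = _ := congrArg _ h3
    have h1 : D.cubic ∣ V * A - H * B := by
      rw [← Ideal.mem_span_singleton, ← Ideal.Quotient.eq]
      exact hinj h2
    obtain ⟨T, hT⟩ := h1
    -- The denominator `V` is nonzero on the line but may vanish at `v` itself. Since `A`, `H` and
    -- the cubic are homogeneous, the variables may be rescaled by some `s ≠ 0` with `V(s v) ≠ 0`;
    -- the factor `Polynomial.X` ensures `s ≠ 0`.
    obtain ⟨s, hsroot⟩ : ∃ s, (Polynomial.X * evLine v V).eval s ≠ 0 := by
      by_contra! hcon
      exact mul_ne_zero Polynomial.X_ne_zero hV (Polynomial.funext (by simpa using hcon))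
    rw [Polynomial.eval_mul, Polynomial.eval_X, eval_evLine] at hsroot
    have hs0 := left_ne_zero_of_mul hsroot
    replace hsroot := right_ne_zero_of_mul hsroot
    have hscale : ∀ {G : MvPolynomial (Fin 3) K} {k}, G.IsHomogeneous k →
        aeval (fun i => C s * X i) G = C s ^ k * G := by
      intro G k hG
      rw [aeval_mul_of_isHomogeneous hG]
      simp
    refine ⟨aeval (fun i => C s * X i) V, ?_, ?_⟩
    · have : (aeval v).comp (aeval (fun i => C s * X i)) =
          (aeval (s • v) : MvPolynomial (Fin 3) K →ₐ[K] K) := by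
        ext i; simp
      have h3 := congrArg (fun f => f V) this
      simp only [AlgHom.comp_apply] at h3
      change aeval v (aeval (fun i => C s * X i) V) ≠ 0
      rw [h3]; exact hsroot
    · have h3 := congrArg (aeval (fun i => (C s * X i : MvPolynomial (Fin 3) K))) hT
      rw [map_sub, _root_.map_mul, _root_.map_mul, _root_.map_mul, hscale hA, hscale hH,
        hscale D.isHomogeneous_cubic] at h3
      have hinv : (C s⁻¹ ^ m * C s ^ m : MvPolynomial (Fin 3) K) = 1 := by
        rw [← mul_pow, ← C_mul, inv_mul_cancel₀ hs0, C_1, one_pow]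
      refine Ideal.mem_span_pair.mpr
        ⟨C s⁻¹ ^ m * C s ^ n * aeval (fun i => C s * X i) B,
        C s⁻¹ ^ m * C s ^ 3 * aeval (fun i => C s * X i) T, ?_⟩
      linear_combination (-C s⁻¹ ^ m) * h3 + aeval (fun i => C s * X i) V * A * hinv

end CoverData

/-! ### Composition of morphisms given by forms -/

namespace CoverCurve

open MvPolynomial Filter

variable {K : Type*} [Field K]

theorem evalVec_smul {n m d : ℕ} {F : Fin m → MvPolynomial (Fin n) K}
    (hF : ∀ i, (F i).IsHomogeneous d) (r : K) (v : Fin n → K) :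
    evalVec F (r • v) = r ^ d • evalVec F v := by
  ext i
  exact eval_smul_of_isHomogeneous (hF i) r v

theorem evalVec_comp {n m k : ℕ} (F : Fin m → MvPolynomial (Fin n) K)
    (G : Fin k → MvPolynomial (Fin m) K) (v : Fin n → K) :
    evalVec (fun i => aeval F (G i)) v = evalVec G (evalVec F v) := by
  ext i
  have : (aeval v).comp (aeval F) = (aeval (evalVec F v) : MvPolynomial (Fin m) K →ₐ[K] K) := by
    ext j; simp [evalVec, aeval_eq_eval]
  exact congrArg (fun f => f (G i)) this

theorem exists_rep_eq_smul {n : ℕ} {p : PSpace K n} {v : Fin n → K} (hv : v ≠ 0)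
    (h : p = Projectivization.mk K v hv) : ∃ a : K, a ≠ 0 ∧ p.rep = a • v := by
  obtain ⟨a, ha⟩ := Projectivization.exists_smul_eq_mk_rep K v hv
  exact ⟨a, a.ne_zero, by rw [h, ← ha]; rfl⟩

theorem mk_eq_of_smul {n : ℕ} {v w : Fin n → K} (hv : v ≠ 0) (hw : w ≠ 0) (a : K)
    (h : w = a • v) : Projectivization.mk K v hv = Projectivization.mk K w hw := by
  rw [Projectivization.mk_eq_mk_iff']
  have ha : a ≠ 0 := by rintro rfl; simp at h; exact hw h
  exact ⟨a⁻¹, by rw [h, smul_smul, inv_mul_cancel₀ ha, one_smul]⟩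

theorem Represents.apply_mk {n m d : ℕ} {X : Set (PSpace K n)} {Y : Set (PSpace K m)}
    {F : Fin m → MvPolynomial (Fin n) K} {φ : X → Y} (hF : Represents d F φ) (x : X)
    {v : Fin n → K} (hv : v ≠ 0) (hx : x.1 = Projectivization.mk K v hv)
    (h : evalVec F v ≠ 0) : (φ x).1 = Projectivization.mk K (evalVec F v) h := by
  obtain ⟨a, ha, hrep⟩ := exists_rep_eq_smul hv hx
  have h1 : evalVec F x.1.rep = a ^ d • evalVec F v := by rw [hrep, evalVec_smul hF.1]
  have h2 : evalVec F x.1.rep ≠ 0 := by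
    rw [h1]; exact smul_ne_zero (pow_ne_zero _ ha) h
  rw [hF.2 x h2]
  exact (mk_eq_of_smul h h2 _ h1).symm

theorem Represents.comp {n m k d d' : ℕ} {X : Set (PSpace K n)} {Y : Set (PSpace K m)}
    {Z : Set (PSpace K k)} {F : Fin m → MvPolynomial (Fin n) K}
    {G : Fin k → MvPolynomial (Fin m) K} {φ : X → Y} {χ : Y → Z}
    (hG : Represents d' G χ) (hF : Represents d F φ) :
    Represents (d * d') (fun i => aeval F (G i)) (χ ∘ φ) := by
  refine ⟨fun i => (hG.1 i).aeval F hF.1, fun x h => ?_⟩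
  have h' := h
  rw [evalVec_comp] at h'
  by_cases h0 : evalVec F x.1.rep = 0
  -- If `F` vanishes at the point, a nonzero value of `G` at `0` forces `d' = 0`, so `G` is constant
  -- and still gives the right image.
  · have h1 : evalVec G (0 : Fin m → K) = (0 : K) ^ d' • evalVec G (φ x).1.rep := by
      rw [← evalVec_smul hG.1, zero_smul]
    rw [h0, h1] at h'
    rw [Function.comp_apply, hG.2 (φ x) (right_ne_zero_of_smul h')]
    refine mk_eq_of_smul _ _ (0 ^ d') ?_
    rw [evalVec_comp, h0, h1]
  · rw [Function.comp_apply, hG.apply_mk (φ x) h0 (hF.2 x h0) h']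
    exact mk_eq_of_smul _ _ 1 (by rw [one_smul, evalVec_comp])

theorem IsMorphism.comp {n m k : ℕ} {X : Set (PSpace K n)} {Y : Set (PSpace K m)}
    {Z : Set (PSpace K k)} {φ : X → Y} {χ : Y → Z} (hχ : IsMorphism χ) (hφ : IsMorphism φ) :
    IsMorphism (χ ∘ φ) := by
  intro x
  obtain ⟨d, F, hF, hF0⟩ := hφ x
  obtain ⟨d', G, hG, hG0⟩ := hχ (φ x)
  refine ⟨_, _, hG.comp hF, ?_⟩
  rw [evalVec_comp]
  obtain ⟨a, ha, hrep⟩ := exists_rep_eq_smul hF0 (hF.2 x hF0)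
  rw [hrep, evalVec_smul hG.1] at hG0
  exact right_ne_zero_of_smul hG0

/-- The inverse isomorphism. -/
def Iso.inv {n m : ℕ} {X : Set (PSpace K n)} {Y : Set (PSpace K m)} (f : Iso X Y) : Iso Y X where
  toEquiv := f.toEquiv.symm
  isMorphism_toFun := f.isMorphism_invFun
  isMorphism_invFun := f.isMorphism_toFun

/-- The composition of isomorphisms. -/
def Iso.comp {n m k : ℕ} {X : Set (PSpace K n)} {Y : Set (PSpace K m)} {Z : Set (PSpace K k)}
    (g : Iso Y Z) (f : Iso X Y) : Iso X Z where
  toEquiv := f.toEquiv.trans g.toEquiv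
  isMorphism_toFun := g.isMorphism_toFun.comp f.isMorphism_toFun
  isMorphism_invFun := f.isMorphism_invFun.comp g.isMorphism_invFun

end CoverCurve

open CoverCurve MvPolynomial Filter

/-! ### Points of the plane cubic, simple zeros of `q`, finiteness of zeros -/

namespace CoverData

variable {K : Type*} [Field K] (D : CoverData K)

theorem snoc_three {K : Type*} (f : Fin 3 → K) (w : K) :
    (Fin.snoc (α := fun _ => K) f w : Fin 4 → K) 3 = w :=
  Fin.snoc_last (α := fun _ => K) (n := 3) _ _

theorem grad_rename {G : MvPolynomial (Fin 3) K} (v : Fin 4 → K) :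
    grad (rename Fin.castSucc G) v = Fin.snoc (α := fun _ => K) (grad G (v ∘ Fin.castSucc)) 0 := by
  ext i
  refine Fin.lastCases ?_ (fun i => ?_) i
  · rw [Fin.snoc_last, grad, pderiv_eq_zero_of_notMem_vars, map_zero]
    intro h
    have := vars_rename Fin.castSucc G h
    simp at this
    obtain ⟨a, -, ha⟩ := this
    exact absurd ha (Fin.castSucc_lt_last a).ne
  · rw [Fin.snoc_castSucc, grad, pderiv_rename (Fin.castSucc_injective 3), eval_rename]
    rfl

variable {D}

/-- Above a zero of `q` the cover has the point `w = 0`, where both gradients have zero last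
component. The Jacobian criterion there says that `q` has a simple zero on the cubic. -/
theorem IsNonsingular.linearIndependent (h : D.IsNonsingular) {v : Fin 3 → K} (hv : v ≠ 0)
    (hc : eval v D.cubic = 0) (hq : eval v D.q = 0) :
    LinearIndependent K ![grad D.cubic v, grad D.q v] := by
  let u : Fin 4 → K := Fin.snoc (α := fun _ => K) v 0
  have hu : u ∘ Fin.castSucc = v := by ext i; simp [u]
  have hu3 : u 3 = 0 := snoc_three _ _
  have h1 := h u (by rintro h0; apply hv; rw [← hu, h0]; rfl)
    (by rw [P, eval_rename, hu, hc]) (by simp [Q, eval_rename, hu, hu3, hq])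
  rw [LinearIndependent.pair_iff] at h1 ⊢
  intro s t hst
  obtain ⟨hs, ht⟩ := h1 s (-t) (by
    have hQ : grad D.Q u = - grad (rename Fin.castSucc D.q) u := by
      ext i; simp [grad, Q, hu3]
    rw [hQ, P, grad_rename, grad_rename, hu]
    ext i
    refine Fin.lastCases ?_ (fun i => ?_) i
    · simp [snoc_three]
    · have := congrFun hst i
      simpa using this)
  exact ⟨hs, by simpa using ht⟩

theorem IsNonsingular.isSmoothCubic [IsAlgClosed K] (h : D.IsNonsingular) :
    IsSmoothCubic D.cubic := by
  refine ⟨D.isHomogeneous_cubic, fun v hv hc hg => ?_⟩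
  obtain ⟨w, hw⟩ := IsAlgClosed.exists_pow_nat_eq (eval v D.q) (n := 2) (by norm_num)
  let u : Fin 4 → K := Fin.snoc (α := fun _ => K) v w
  have hu : u ∘ Fin.castSucc = v := by ext i; simp [u]
  have hu3 : u 3 = w := snoc_three _ _
  have h1 := h u (by rintro h0; apply hv; rw [← hu, h0]; rfl)
    (by rw [P, eval_rename, hu, hc]) (by simp [Q, eval_rename, hu, hu3, hw])
  refine h1.ne_zero 0 ?_
  simp only [Matrix.cons_val_zero]
  rw [P, grad_rename, hu, hg]
  ext i
  refine Fin.lastCases ?_ (fun i => ?_) i <;> simp [snoc_three]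

variable (D)

/-- The point of the plane cubic with given homogeneous coordinates. -/
def pt (v : Fin 3 → K) (hv : v ≠ 0) (h : eval v D.cubic = 0) : D.base :=
  ⟨Projectivization.mk K v hv, by
    rintro G rfl
    obtain ⟨a, ha, hr⟩ := exists_rep_eq_smul hv rfl
    rw [hr, eval_smul_of_isHomogeneous D.isHomogeneous_cubic, h, mul_zero]⟩

theorem eval_rep (x : D.base) : eval x.1.rep D.cubic = 0 := x.2 _ rfl

theorem pt_eq_pt_iff {v w : Fin 3 → K} {hv : v ≠ 0} {hw : w ≠ 0} {h : eval v D.cubic = 0}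
    {h' : eval w D.cubic = 0} : D.pt v hv h = D.pt w hw h' ↔ ∃ a : K, a • w = v :=
  Subtype.ext_iff.trans (Projectivization.mk_eq_mk_iff' K v w hv hw)

theorem pt_rep (x : D.base) : D.pt x.1.rep x.1.rep_nonzero (D.eval_rep x) = x :=
  Subtype.ext x.1.mk_rep

theorem eval_origin : eval ![0, 1, 0] D.cubic = 0 := by simp [eval_cubic]

theorem ne_zero_origin : (![0, 1, 0] : Fin 3 → K) ≠ 0 := fun h => one_ne_zero (congrFun h 1)

theorem origin_eq : D.origin = D.pt ![0, 1, 0] ne_zero_origin D.eval_origin := rfl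

theorem pt_eq_origin_iff {v : Fin 3 → K} (hv : v ≠ 0) (h : eval v D.cubic = 0) :
    D.pt v hv h = D.origin ↔ v 2 = 0 := by
  rw [origin_eq, pt_eq_pt_iff]
  constructor
  · rintro ⟨a, rfl⟩; simp
  · intro h2
    rw [eval_cubic, h2] at h
    have h0 : v 0 = 0 := by simpa using h
    exact ⟨v 1, by ext i; fin_cases i <;> simp [h0, h2]⟩

theorem dvd_of_isHomogeneous_of_vanish [IsAlgClosed K] {T : MvPolynomial (Fin 3) K} {n : ℕ}
    (hT : T.IsHomogeneous n) (h : ∀ v, v ≠ 0 → eval v D.cubic = 0 → eval v T = 0) :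
    D.cubic ∣ T := by
  refine D.dvd_of_vanish fun v hv => ?_
  rcases eq_or_ne v 0 with rfl | hv0
  · have := eval_smul_of_isHomogeneous hT 0 ![0, 1, 0]
    rw [zero_smul] at this
    rw [this, h _ ne_zero_origin D.eval_origin, mul_zero]
  · exact h v hv0 hv

/-- Any two representations of a map by forms agree. -/
theorem dvd_of_represents [IsAlgClosed K] {m : ℕ} {Y : Set (PSpace K m)} {φ : D.base → Y}
    {d d' : ℕ} {F F' : Fin m → MvPolynomial (Fin 3) K} (hF : Represents d F φ)
    (hF' : Represents d' F' φ) (i j : Fin m) : D.cubic ∣ F i * F' j - F j * F' i := by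
  refine D.dvd_of_isHomogeneous_of_vanish
    (((hF.1 i).mul (hF'.1 j)).sub ((hF.1 j).mul (hF'.1 i))) fun v hv hc => ?_
  simp only [map_sub, map_mul]
  by_cases h : evalVec F v = 0
  · have h1 := congrFun h i
    have h2 := congrFun h j
    simp only [evalVec, Pi.zero_apply] at h1 h2
    rw [h1, h2]; ring
  by_cases h' : evalVec F' v = 0
  · have h1 := congrFun h' i
    have h2 := congrFun h' j
    simp only [evalVec, Pi.zero_apply] at h1 h2
    rw [h1, h2]; ring
  have h1 := hF.apply_mk (D.pt v hv hc) hv rfl h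
  rw [hF'.apply_mk (D.pt v hv hc) hv rfl h', Projectivization.mk_eq_mk_iff'] at h1
  obtain ⟨a, ha⟩ := h1
  have h2 := congrFun ha i
  have h3 := congrFun ha j
  simp only [evalVec, Pi.smul_apply, smul_eq_mul] at h2 h3
  rw [← h2, ← h3]; ring

/-- On the chart `z = 1`, powers of `y` reduce through `y² = f(x, 1)`, so the coordinate ring is
spanned by `1` and `y` over `K[x]`. -/
theorem exists_affine_form (A : MvPolynomial (Fin 3) K) : ∃ a b : Polynomial K,
    ∀ x y : K, eval ![x, y, 1] D.cubic = 0 → eval ![x, y, 1] A = a.eval x + b.eval x * y := by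
  induction A using MvPolynomial.induction_on with
  | C c => exact ⟨Polynomial.C c, 0, by simp⟩
  | add A B hA hB =>
    obtain ⟨a, b, h⟩ := hA
    obtain ⟨a', b', h'⟩ := hB
    refine ⟨a + a', b + b', fun x y hxy => ?_⟩
    simp only [map_add, h x y hxy, h' x y hxy, Polynomial.eval_add]
    ring
  | mul_X A i hA =>
    obtain ⟨a, b, h⟩ := hA
    fin_cases i
    · refine ⟨a * Polynomial.X, b * Polynomial.X, fun x y hxy => ?_⟩
      simp [h x y hxy]; ring
    · refine ⟨b * (Polynomial.X ^ 3 + Polynomial.C D.a₂ * Polynomial.X ^ 2 +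
        Polynomial.C D.a₄ * Polynomial.X + Polynomial.C D.a₆), a, fun x y hxy => ?_⟩
      simp only [map_mul, h x y hxy]
      simp [eval_cubic] at hxy ⊢
      linear_combination (b.eval x) * hxy
    · exact ⟨a, b, fun x y hxy => by simp [h x y hxy]⟩

theorem exists_y [IsAlgClosed K] (x : K) : ∃ y, eval ![x, y, 1] D.cubic = 0 := by
  obtain ⟨y, hy⟩ := IsAlgClosed.exists_pow_nat_eq
    (x ^ 3 + D.a₂ * x ^ 2 + D.a₄ * x + D.a₆) (n := 2) (by norm_num)
  exact ⟨y, by simp [eval_cubic, hy]⟩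

theorem ne_zero_affine (x y : K) : (![x, y, 1] : Fin 3 → K) ≠ 0 :=
  fun h => one_ne_zero (congrFun h 2)

theorem eq_smul_affine {v : Fin 3 → K} (h : v 2 ≠ 0) :
    v = v 2 • ![v 0 / v 2, v 1 / v 2, 1] := by
  ext i; fin_cases i <;> simp [mul_div_cancel₀ _ h]

theorem eval_affine_of_ne_zero {v : Fin 3 → K} (hc : eval v D.cubic = 0) (h : v 2 ≠ 0) :
    eval ![v 0 / v 2, v 1 / v 2, 1] D.cubic = 0 := by
  rw [eq_smul_affine h, eval_smul_of_isHomogeneous D.isHomogeneous_cubic] at hc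
  exact (mul_eq_zero.mp hc).resolve_left (pow_ne_zero _ h)

instance [IsAlgClosed K] : Infinite D.base := by
  choose y hy using D.exists_y
  refine Infinite.of_injective (fun x => D.pt ![x, y x, 1] (ne_zero_affine _ _) (hy x)) ?_
  intro x x' h
  obtain ⟨a, ha⟩ := D.pt_eq_pt_iff.mp h
  have h2 := congrFun ha 2
  have h0 := congrFun ha 0
  simp at h2 h0
  rw [h2, one_mul] at h0
  exact h0.symm

/-- A form that does not vanish identically on the plane cubic has finitely many zeros on it. -/
theorem finite_zeros [IsAlgClosed K] {T : MvPolynomial (Fin 3) K} {n : ℕ} (hT : T.IsHomogeneous n)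
    (hdvd : ¬ D.cubic ∣ T) : {x : D.base | eval x.1.rep T = 0}.Finite := by
  obtain ⟨a, b, hab⟩ := D.exists_affine_form T
  set f : Polynomial K := Polynomial.X ^ 3 + (Polynomial.C D.a₂ * Polynomial.X ^ 2 +
        Polynomial.C D.a₄ * Polynomial.X + Polynomial.C D.a₆) with hf
  have hfdeg : f.natDegree = 3 := by
    refine Polynomial.natDegree_eq_of_degree_eq_some ?_
    rw [hf, Polynomial.degree_add_eq_left_of_degree_lt] <;> rw [Polynomial.degree_X_pow]
    exact lt_of_le_of_lt Polynomial.degree_quadratic_le (by decide)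
  have hxy : ∀ x y, eval ![x, y, 1] D.cubic = 0 → y ^ 2 = f.eval x := by
    intro x y h
    simp [eval_cubic, hf] at h ⊢
    linear_combination h
  -- This is the norm of `a + b y`. Since `f` has odd degree, it vanishes only for `a = b = 0`, and
  -- then `z T` vanishes on the whole cubic.
  have hN : a ^ 2 - f * b ^ 2 ≠ 0 := by
    intro hN
    have hN' : a ^ 2 = f * b ^ 2 := sub_eq_zero.mp hN
    have hf0 : f ≠ 0 := by rintro h; rw [h] at hfdeg; simp at hfdeg
    have hb : b = 0 := by
      by_contra hb
      have := congrArg Polynomial.natDegree hN'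
      rw [Polynomial.natDegree_pow, Polynomial.natDegree_mul hf0 (pow_ne_zero _ hb),
        Polynomial.natDegree_pow, hfdeg] at this
      omega
    have ha : a = 0 := by simpa [hb] using hN'
    have h1 : D.cubic ∣ X 2 * T := by
      refine D.dvd_of_isHomogeneous_of_vanish ((isHomogeneous_X K 2).mul hT) fun v hv hc => ?_
      by_cases h2 : v 2 = 0
      · simp [h2]
      · have h3 := hab _ _ (D.eval_affine_of_ne_zero hc h2)
        rw [eq_smul_affine h2, eval_smul_of_isHomogeneous ((isHomogeneous_X K 2).mul hT), map_mul,
          h3, ha, hb]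
        simp
    exact hdvd ((D.prime_cubic.dvd_or_dvd h1).resolve_left (D.not_cubic_dvd_X 2))
  let g : D.base → K × K := fun x => (x.1.rep 0 / x.1.rep 2, x.1.rep 1 / x.1.rep 2)
  have hfin : (⋃ x ∈ {x | (a ^ 2 - f * b ^ 2).IsRoot x},
      (Prod.mk x) '' {y | (Polynomial.X ^ 2 - Polynomial.C (f.eval x)).IsRoot y}).Finite := by
    refine Set.Finite.biUnion (Polynomial.finite_setOfPred_isRoot hN) fun x _ => Set.Finite.image _ ?_
    exact Polynomial.finite_setOfPred_isRoot (Polynomial.X_pow_sub_C_ne_zero (by norm_num) _)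
  have h1 : {x : D.base | eval x.1.rep T = 0} ⊆
      {D.origin} ∪ {x : D.base | eval x.1.rep T = 0 ∧ x.1.rep 2 ≠ 0} := by
    intro x hx
    by_cases h2 : x.1.rep 2 = 0
    · left
      rw [Set.mem_singleton_iff, ← D.pt_rep x, pt_eq_origin_iff]; exact h2
    · right; exact ⟨hx, h2⟩
  refine Set.Finite.subset (Set.Finite.union (Set.finite_singleton _) ?_) h1
  refine Set.Finite.of_finite_image (f := g) (hfin.subset ?_) ?_
  · rintro _ ⟨x, ⟨hx, h2⟩, rfl⟩
    have h3 := D.eval_affine_of_ne_zero (D.eval_rep x) h2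
    have h4 := hab _ _ h3
    rw [eq_smul_affine h2, eval_smul_of_isHomogeneous hT, mul_eq_zero] at hx
    rw [hx.resolve_left (pow_ne_zero _ h2)] at h4
    have h5 := hxy _ _ h3
    simp only [Set.mem_iUnion, Set.mem_image, Set.mem_ofPred_eq, g]
    refine ⟨_, ?_, _, ?_, rfl⟩
    · simp only [Polynomial.IsRoot, Polynomial.eval_sub, Polynomial.eval_pow, Polynomial.eval_mul]
      rw [← h5]
      linear_combination (-(Polynomial.eval (x.1.rep 0 / x.1.rep 2) a -
        Polynomial.eval (x.1.rep 0 / x.1.rep 2) b * (x.1.rep 1 / x.1.rep 2))) * h4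
    · simp [h5]
  · rintro x ⟨-, hx⟩ x' ⟨-, hx'⟩ h
    simp only [g, Prod.mk.injEq] at h
    rw [← D.pt_rep x, ← D.pt_rep x', pt_eq_pt_iff]
    refine ⟨x.1.rep 2 / x'.1.rep 2, ?_⟩
    obtain ⟨e0, e1⟩ := h
    rw [div_eq_div_iff hx hx'] at e0 e1
    ext i
    fin_cases i <;> simp <;> field_simp
    · linear_combination -e0
    · linear_combination -e1

theorem dvd_of_eventually [IsAlgClosed K] {T : MvPolynomial (Fin 3) K} {n : ℕ}
    (hT : T.IsHomogeneous n) (h : ∀ᶠ x : D.base in cofinite, eval x.1.rep T = 0) :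
    D.cubic ∣ T := by
  by_contra hdvd
  have h1 := D.finite_zeros hT hdvd
  rw [eventually_cofinite] at h
  have := Set.Finite.union h1 h
  refine Set.infinite_univ (this.subset fun x _ => ?_)
  exact em _

theorem eventually_ne_zero [IsAlgClosed K] {T : MvPolynomial (Fin 3) K} {n : ℕ}
    (hT : T.IsHomogeneous n) (hdvd : ¬ D.cubic ∣ T) :
    ∀ᶠ x : D.base in cofinite, eval x.1.rep T ≠ 0 := by
  rw [eventually_cofinite]
  simpa using D.finite_zeros hT hdvd

end CoverData

/-! ### Isomorphisms of plane cubics: unramifiedness and a criterion for linearity -/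

namespace CoverData

variable {K : Type*} [Field K]

theorem homogeneousComponent_mul {σ : Type*} {H : MvPolynomial σ K} {e : ℕ}
    (hH : H.IsHomogeneous e) (k : ℕ) (A : MvPolynomial σ K) :
    homogeneousComponent (e + k) (H * A) = H * homogeneousComponent k A := by
  induction A using MvPolynomial.induction_on' with
  | monomial u a =>
    have h1 : (monomial u a).IsHomogeneous u.degree := isHomogeneous_monomial a rfl
    rw [homogeneousComponent_of_mem h1, homogeneousComponent_of_mem (hH.mul h1)]
    by_cases hk : k = u.degree <;> simp [hk]
  | add p q hp hq => rw [mul_add, map_add, map_add, hp, hq, mul_add]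

/-- The linear form with given coefficients. -/
def linForm (a : Fin 3 → K) : MvPolynomial (Fin 3) K := ∑ j, C (a j) * X j

theorem isHomogeneous_linForm (a : Fin 3 → K) : (linForm a).IsHomogeneous 1 :=
  IsHomogeneous.sum _ _ _ fun _ _ => isHomogeneous_C_mul_X _ _

theorem eval_linForm (a v : Fin 3 → K) : eval v (linForm a) = a ⬝ᵥ v := by
  simp [linForm, dotProduct]

theorem exists_eq_linForm {L : MvPolynomial (Fin 3) K} (hL : L.IsHomogeneous 1) :
    ∃ a, L = linForm a := by
  rw [← mem_homogeneousSubmodule, homogeneousSubmodule_one_eq_span_X,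
    Submodule.mem_span_range_iff_exists_fun] at hL
  obtain ⟨a, ha⟩ := hL
  exact ⟨a, by rw [← ha]; simp [linForm, smul_eq_C_mul]⟩

theorem linForm_ne_zero {a : Fin 3 → K} (ha : a ≠ 0) : linForm a ≠ 0 := by
  intro h
  apply ha
  ext j
  have := eval_linForm a (Pi.single j 1)
  rw [h] at this
  simpa using this.symm

/-- The linear forms given by the rows of a matrix. -/
def matForms (M : Matrix (Fin 3) (Fin 3) K) : Fin 3 → MvPolynomial (Fin 3) K := fun i => linForm (M i)

theorem evalVec_matForms (M : Matrix (Fin 3) (Fin 3) K) (v : Fin 3 → K) :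
    evalVec (matForms M) v = M.mulVec v := by
  ext i; exact eval_linForm _ _

variable (D D₁ D₂ : CoverData K)

/-- The cubic generates a homogeneous ideal, so the cofactor of `H` may be replaced by its component
of degree 1. -/
theorem exists_linForm_of_mem_span {F H : MvPolynomial (Fin 3) K} {e : ℕ}
    (hF : F.IsHomogeneous (e + 1)) (hH : H.IsHomogeneous e) (h : F ∈ Ideal.span {H, D.cubic}) :
    ∃ a, D.cubic ∣ F - H * linForm a := by
  obtain ⟨A, B, hAB⟩ := Ideal.mem_span_pair.mp h
  obtain ⟨a, ha⟩ := exists_eq_linForm (homogeneousComponent_isHomogeneous 1 A)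
  refine ⟨a, ?_⟩
  rw [← ha, ← homogeneousComponent_mul hH, ← homogeneousComponent_eq_self hF, ← map_sub,
    ← Ideal.mem_span_singleton]
  let _ : GradedAlgebra (homogeneousSubmodule (Fin 3) K) := MvPolynomial.gradedAlgebra
  refine homogeneousComponent_mem_of_mem ?_ ?_ _
  · refine Ideal.homogeneous_span _ _ ?_
    rintro x rfl
    exact ⟨3, D.isHomogeneous_cubic⟩
  · rw [← hAB, Ideal.mem_span_singleton]
    exact ⟨B, by ring⟩

theorem exists_represents {D₁ D₂ : CoverData K} (ψ : Iso D₁.base D₂.base) {v : Fin 3 → K}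
    (hv : v ≠ 0) (hc : eval v D₁.cubic = 0) :
    ∃ d F, Represents d F (ψ : D₁.base → D₂.base) ∧ evalVec F v ≠ 0 := by
  obtain ⟨d, F, hF, hF0⟩ := ψ.isMorphism_toFun (D₁.pt v hv hc)
  refine ⟨d, F, hF, ?_⟩
  obtain ⟨a, ha, hr⟩ := exists_rep_eq_smul hv (show (D₁.pt v hv hc).1 = _ from rfl)
  rw [hr, evalVec_smul hF.1] at hF0
  exact right_ne_zero_of_smul hF0

variable {D D₁ D₂}

theorem eq_pt_of_represents {ψ : D₁.base → D₂.base} {d : ℕ} {F : Fin 3 → MvPolynomial (Fin 3) K}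
    (hF : Represents d F ψ) {v : Fin 3 → K} (hv : v ≠ 0) (hc : eval v D₁.cubic = 0)
    (h : evalVec F v ≠ 0) : ∃ hc' : eval (evalVec F v) D₂.cubic = 0,
      ψ (D₁.pt v hv hc) = D₂.pt (evalVec F v) h hc' := by
  have h1 := hF.apply_mk (D₁.pt v hv hc) hv rfl h
  obtain ⟨a, ha, hr⟩ := exists_rep_eq_smul h h1
  have h2 := D₂.eval_rep (ψ (D₁.pt v hv hc))
  rw [hr, eval_smul_of_isHomogeneous D₂.isHomogeneous_cubic] at h2
  exact ⟨(mul_eq_zero.mp h2).resolve_left (pow_ne_zero _ ha), Subtype.ext h1⟩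

theorem dvd_aeval_cubic [IsAlgClosed K] {ψ : D₁.base → D₂.base} {d : ℕ}
    {F : Fin 3 → MvPolynomial (Fin 3) K} (hF : Represents d F ψ) :
    D₁.cubic ∣ aeval F D₂.cubic := by
  refine D₁.dvd_of_isHomogeneous_of_vanish (D₂.isHomogeneous_cubic.aeval F hF.1) fun v hv hc => ?_
  have h1 : eval v (aeval F D₂.cubic) = eval (evalVec F v) D₂.cubic :=
    congrFun (evalVec_comp F (fun _ : Fin 1 => D₂.cubic) v) 0
  rw [h1]
  by_cases h : evalVec F v = 0
  · rw [h, eval_cubic]; simp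
  · exact (eq_pt_of_represents hF hv hc h).1

theorem eval_aeval {F : Fin 3 → MvPolynomial (Fin 3) K} (G : MvPolynomial (Fin 3) K)
    (v : Fin 3 → K) : eval v (aeval F G) = eval (evalVec F v) G :=
  congrFun (evalVec_comp F (fun _ : Fin 1 => G) v) 0

/-- Two representatives are proportional along the cubic with ratio `F j / F' j`, so their pullbacks
of a degree `n` form differ by the `n`-th power of that ratio. Orders can thus be transferred to a
representative without common zero at a chosen point. -/
theorem dvd_aeval_of_represents [IsAlgClosed K] {Y : Set (PSpace K 3)} {φ : D.base → Y}
    {d d' : ℕ} {F F' : Fin 3 → MvPolynomial (Fin 3) K} (hF : Represents d F φ)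
    (hF' : Represents d' F' φ) {G : MvPolynomial (Fin 3) K} {n : ℕ} (hG : G.IsHomogeneous n)
    (j : Fin 3) : D.cubic ∣ F' j ^ n * aeval F G - F j ^ n * aeval F' G := by
  refine D.dvd_of_vanish fun v hc => ?_
  simp only [map_sub, map_mul, map_pow, eval_aeval]
  rw [← eval_smul_of_isHomogeneous hG, ← eval_smul_of_isHomogeneous hG, sub_eq_zero]
  congr 2
  ext i
  obtain ⟨T, hT⟩ := D.dvd_of_represents hF hF' i j
  have := congrArg (eval v) hT
  simp only [map_sub, map_mul, hc, zero_mul] at this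
  simp only [evalVec, Pi.smul_apply, smul_eq_mul]
  linear_combination this

theorem OrderAt.ord_pow {v : Fin 3 → K} (o : D.OrderAt v) (A : MvPolynomial (Fin 3) K) (n : ℕ) :
    o.ord (A ^ n) = n * o.ord A := by
  induction n with
  | zero => simpa using o.eq_zero_of_eval_ne_zero (A := 1) (by simp)
  | succ n ih => rw [pow_succ, o.map_mul, ih]; push_cast; ring

/-- An isomorphism of plane cubics is unramified. -/
theorem ord_aeval_le_one [IsAlgClosed K] (hs : IsSmoothCubic D₁.cubic) (ψ : Iso D₁.base D₂.base)
    {v : Fin 3 → K} (hv : v ≠ 0) (hc : eval v D₁.cubic = 0) (o : D₁.OrderAt v) {d n : ℕ}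
    {F : Fin 3 → MvPolynomial (Fin 3) K} (hF : Represents d F (ψ : D₁.base → D₂.base))
    (hFv : evalVec F v ≠ 0) {Q : MvPolynomial (Fin 3) K} (hQ : Q.IsHomogeneous n)
    (hQv : eval (evalVec F v) Q = 0)
    (hLI : LinearIndependent K ![grad D₂.cubic (evalVec F v), grad Q (evalVec F v)]) :
    o.ord (aeval F Q) ≤ 1 := by
  obtain ⟨hc', hψ⟩ := eq_pt_of_represents hF hv hc hFv
  obtain ⟨ℓ, hℓ, hℓv, hℓLI⟩ := exists_linear_form hv (hs.2 v hv hc)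
  obtain ⟨d', G, hG, hGv⟩ := exists_represents ψ.inv hFv hc'
  have hGF : Represents (d * d') (fun i => aeval F (G i)) (id : D₁.base → D₁.base) := by
    have h := hG.comp hF
    have h1 : (ψ.inv : D₂.base → D₁.base) ∘ (ψ : D₁.base → D₂.base) = id := by
      ext1 x; exact ψ.toEquiv.symm_apply_apply x
    rwa [h1] at h
  have hX : Represents 1 (X : Fin 3 → MvPolynomial (Fin 3) K) (id : D₁.base → D₁.base) := by
    refine ⟨fun i => isHomogeneous_X K i, fun x h => ?_⟩
    have h1 : evalVec X x.1.rep = x.1.rep := by ext i; simp [evalVec]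
    simp only [h1]
    exact x.1.mk_rep.symm
  have hGFv : evalVec (fun i => aeval F (G i)) v ≠ 0 := by rw [evalVec_comp]; exact hGv
  obtain ⟨hc'', hid⟩ := eq_pt_of_represents hGF hv hc hGFv
  obtain ⟨a, ha⟩ := D₁.pt_eq_pt_iff.mp hid
  obtain ⟨j, hj⟩ := Function.ne_iff.mp hGFv
  have hvj : v j ≠ 0 := by
    intro h0
    obtain ⟨T, hT⟩ := D₁.dvd_of_represents hGF hX j j
    have ha0 : a ≠ 0 := by rintro rfl; simp at ha; exact hv ha.symm
    have := congrFun ha j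
    rw [h0, Pi.smul_apply, smul_eq_mul] at this
    exact hj ((mul_eq_zero.mp this).resolve_left ha0)
  -- The composite with the inverse represents the identity, so pulling back the uniformizer `ℓ`
  -- through it still gives order 1.
  have hord1 : o.ord (aeval (fun i => aeval F (G i)) ℓ) = 1 := by
    have h1 := o.congr _ _ (D₁.dvd_aeval_of_represents hGF hX hℓ j)
    rw [o.map_mul, o.map_mul, o.ord_pow, o.ord_pow,
      o.eq_zero_of_eval_ne_zero (A := X j) (by simpa using hvj),
      o.eq_zero_of_eval_ne_zero (A := aeval F (G j)) hj] at h1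
    simpa [o.eq_one hℓ hℓv hℓLI] using h1
  set v' := evalVec F v with hv'
  have hline : ∀ {A : MvPolynomial (Fin 3) K} {k}, A.IsHomogeneous k → eval v' A = 0 →
      evLine v' A = 0 := by
    intro A k hA h0
    rw [evLine_of_isHomogeneous v' hA, h0]; simp
  obtain ⟨U, hU, hspan⟩ := exists_mul_mem_span_pair hFv (hline D₂.isHomogeneous_cubic hc')
    (hline hQ hQv) hLI
  have hA0 : eval v' (aeval G ℓ) = 0 := by
    have ha0 : a ≠ 0 := by rintro rfl; simp at ha; exact hv ha.symm
    rw [eval_aeval, hv', ← evalVec_comp]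
    rw [← ha, eval_smul_of_isHomogeneous hℓ] at hℓv
    exact (mul_eq_zero.mp hℓv).resolve_left (pow_ne_zero _ ha0)
  -- Near the image point `aeval G ℓ` is a multiple of `Q` modulo the cubic. Pulling back shows that
  -- the order of `aeval F Q` is at most that of `ℓ`, namely 1.
  obtain ⟨α, β, hαβ⟩ := Ideal.mem_span_pair.mp (hspan _ (hline (hℓ.aeval G hG.1) hA0))
  have hcomp : aeval F (aeval G ℓ) = aeval (fun i => aeval F (G i)) ℓ := by
    have : (aeval F).comp (aeval G) =
        (aeval (fun i => aeval F (G i)) : MvPolynomial (Fin 3) K →ₐ[K] _) := by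
      ext i; simp
    exact congrArg (fun f => f ℓ) this
  have h2 : D₁.cubic ∣ aeval F U * aeval F (aeval G ℓ) - aeval F β * aeval F Q := by
    rw [← _root_.map_mul, ← _root_.map_mul, ← map_sub, ← hαβ, add_sub_cancel_right, _root_.map_mul]
    exact Dvd.dvd.mul_left (dvd_aeval_cubic hF) _
  have h3 := o.congr _ _ h2
  rw [o.map_mul, o.map_mul, hcomp, hord1,
    o.eq_zero_of_eval_ne_zero (A := aeval F U) (by rw [eval_aeval]; exact hU), zero_add] at h3
  rw [h3]
  exact le_add_self

/-- A map between plane cubics is induced by an invertible linear map. -/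
structure IsLinear (ψ : D₁.base → D₂.base) (M : Matrix (Fin 3) (Fin 3) K) : Prop where
  det_ne_zero : M.det ≠ 0
  apply_eq : ∀ v (hv : v ≠ 0) (hc : eval v D₁.cubic = 0) (h : M.mulVec v ≠ 0),
    (ψ (D₁.pt v hv hc)).1 = Projectivization.mk K (M.mulVec v) h

theorem mulVec_ne_zero {M : Matrix (Fin 3) (Fin 3) K} (hM : M.det ≠ 0) {v : Fin 3 → K}
    (hv : v ≠ 0) : M.mulVec v ≠ 0 := fun h => hv (Matrix.eq_zero_of_mulVec_eq_zero hM h)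

/-- The order condition makes each `F i / H` a regular section of `O(1)`, and by the depth of the
cone these sections are restrictions of linear forms. -/
theorem exists_isLinear [IsAlgClosed K] (hs : IsSmoothCubic D₁.cubic) (ψ : Iso D₁.base D₂.base)
    {e : ℕ} {F : Fin 3 → MvPolynomial (Fin 3) K} {H : MvPolynomial (Fin 3) K}
    (hF : Represents (e + 1) F (ψ : D₁.base → D₂.base)) (hH : H.IsHomogeneous e)
    (hH0 : ¬ D₁.cubic ∣ H) (hF0 : ∃ j, ¬ D₁.cubic ∣ F j)
    (hord : ∀ v, v ≠ 0 → eval v D₁.cubic = 0 → ∀ (o : D₁.OrderAt v) (i), o.ord H ≤ o.ord (F i)) :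
    ∃ M : Matrix (Fin 3) (Fin 3) K, IsLinear (ψ : D₁.base → D₂.base) M ∧
      ∀ i, D₁.cubic ∣ F i - H * matForms M i := by
  have h1 : ∀ i, ∃ a, D₁.cubic ∣ F i - H * linForm a := by
    intro i
    refine D₁.exists_linForm_of_mem_span (hF.1 i) hH ?_
    refine D₁.mem_span_of_forall_exists hH0 fun v hv hc => ?_
    obtain ⟨o⟩ := D₁.nonempty_orderAt hv hc (hs.2 v hv hc)
    exact o.exists_of_le (hF.1 i) hH (hord v hv hc o i)
  obtain ⟨M, hM⟩ : ∃ M : Matrix (Fin 3) (Fin 3) K, ∀ i, D₁.cubic ∣ F i - H * linForm (M i) := by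
    choose M hM using h1
    exact ⟨Matrix.of M, hM⟩
  refine ⟨M, ⟨?_, ?_⟩, hM⟩
  -- A linear relation among the rows of `M` would put the image of `ψ`, hence all of the target
  -- cubic, on a line.
  · intro hdet
    obtain ⟨l, hl, hlM⟩ := Matrix.exists_vecMul_eq_zero_iff.mpr hdet
    have hlF : D₁.cubic ∣ aeval F (linForm l) := by
      refine D₁.dvd_of_vanish fun v hc => ?_
      rw [eval_aeval, eval_linForm]
      have h2 : evalVec F v = eval v H • Matrix.mulVec M v := by
        ext i
        obtain ⟨T, hT⟩ := hM i
        have := congrArg (eval v) hT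
        simp only [map_sub, map_mul, hc, zero_mul, eval_linForm] at this
        exact sub_eq_zero.mp this
      rw [h2, dotProduct_smul, Matrix.dotProduct_mulVec, hlM, zero_dotProduct, smul_zero]
    refine D₂.not_cubic_dvd_of_isHomogeneous (isHomogeneous_linForm l) (by norm_num)
      (linForm_ne_zero hl) (D₂.dvd_of_isHomogeneous_of_vanish (isHomogeneous_linForm l) ?_)
    intro w hw hcw
    obtain ⟨x, hx⟩ := ψ.toEquiv.surjective (D₂.pt w hw hcw)
    obtain ⟨d, F', hF', hF'v⟩ := exists_represents ψ x.1.rep_nonzero (D₁.eval_rep x)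
    obtain ⟨hc', hψ⟩ := eq_pt_of_represents hF' x.1.rep_nonzero (D₁.eval_rep x) hF'v
    rw [D₁.pt_rep x] at hψ
    obtain ⟨j, hj⟩ := hF0
    have h3 := D₁.dvd_aeval_of_represents hF hF' (isHomogeneous_linForm l) j
    rw [dvd_sub_right (Dvd.dvd.mul_left hlF _), pow_one] at h3
    obtain ⟨T, hT⟩ := (D₁.prime_cubic.dvd_or_dvd h3).resolve_left hj
    have h4 := congrArg (eval x.1.rep) hT
    rw [_root_.map_mul, D₁.eval_rep, zero_mul, eval_aeval] at h4
    obtain ⟨a, ha⟩ := D₂.pt_eq_pt_iff.mp (hx.symm.trans hψ)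
    rw [← ha, eval_smul_of_isHomogeneous (isHomogeneous_linForm l), h4, mul_zero]
  · intro v hv hc h
    obtain ⟨d, F', hF', hF'v⟩ := exists_represents ψ hv hc
    rw [hF'.apply_mk _ hv rfl hF'v]
    obtain ⟨j, hj⟩ := Function.ne_iff.mp hF'v
    change eval v (F' j) ≠ 0 at hj
    refine mk_eq_of_smul _ _ (Matrix.mulVec M v j / eval v (F' j)) ?_
    ext i
    obtain ⟨T, hT⟩ := D₁.dvd_of_represents hF hF' i j
    obtain ⟨A, hA⟩ := hM i
    obtain ⟨B, hB⟩ := hM j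
    have h2 : D₁.cubic ∣ H * (linForm (M i) * F' j - linForm (M j) * F' i) :=
      ⟨T - A * F' j + B * F' i, by linear_combination hT - F' j * hA + F' i * hB⟩
    obtain ⟨T', hT'⟩ := (D₁.prime_cubic.dvd_or_dvd h2).resolve_left hH0
    have h3 := congrArg (eval v) hT'
    simp only [map_sub, map_mul, hc, zero_mul, eval_linForm] at h3
    simp only [evalVec, Pi.smul_apply, smul_eq_mul]
    rw [div_mul_eq_mul_div, eq_div_iff hj]
    exact sub_eq_zero.mp h3

end CoverData

/-! ### Linearity from the quadratic forms, and linearity from the origins -/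

namespace CoverData

variable {K : Type*} [Field K] {D D₁ D₂ : CoverData K}

/-- Parity: for finite `b` the equation gives `2 a ≤ 2 b + 1`, and the odd unit is lost on halving.
This is where simplicity of the zeros of `q₂` enters. -/
theorem ENat.le_of_two_mul_add_eq {a b s t : ℕ∞} (h : 2 * a + s = 2 * b + t) (ht : t ≤ 1) :
    a ≤ b := by
  induction b using ENat.recTopCoe with
  | top => exact le_top
  | coe b =>
    lift t to ℕ using ne_top_of_le_ne_top (by simp) ht
    have ha : a ≠ ⊤ := by
      rintro rfl
      simp at h
      exact absurd h.symm (by exact_mod_cast ENat.natCast_ne_top (2 * b + t))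
    lift a to ℕ using ha
    have hs : s ≠ ⊤ := by
      rintro rfl
      simp at h
      exact absurd h.symm (by exact_mod_cast ENat.natCast_ne_top (2 * b + t))
    lift s to ℕ using hs
    norm_cast at *
    omega

theorem not_dvd_of_eval_ne_zero {A : MvPolynomial (Fin 3) K} {v : Fin 3 → K}
    (hc : eval v D.cubic = 0) (h : eval v A ≠ 0) : ¬ D.cubic ∣ A := by
  rintro ⟨T, rfl⟩
  exact h (by rw [map_mul, hc, zero_mul])

/-- An isomorphism of plane cubics compatible with the quadratic forms is linear. -/
theorem PullbackEq.exists_isLinear [IsAlgClosed K] (h₁ : D₁.IsNonsingular) (h₂ : D₂.IsNonsingular)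
    (ψ : Iso D₁.base D₂.base) {c : K} (hc0 : c ≠ 0) (h : D₁.PullbackEq D₂ ψ c) :
    ∃ M : Matrix (Fin 3) (Fin 3) K, IsLinear (ψ : D₁.base → D₂.base) M ∧
      ∀ v, eval v D₁.cubic = 0 → eval (M.mulVec v) D₂.q = c * eval v D₁.q := by
  obtain ⟨e, F, H, hF, hH, ⟨x, hx⟩, ⟨y, hy⟩, hq⟩ := h
  have hs := h₁.isSmoothCubic
  have hH0 : ¬ D₁.cubic ∣ H := not_dvd_of_eval_ne_zero (D₁.eval_rep y) hy
  obtain ⟨M, hM, hFM⟩ := CoverData.exists_isLinear hs ψ hF hH hH0 (by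
    obtain ⟨j, hj⟩ := Function.ne_iff.mp hx
    exact ⟨j, not_dvd_of_eval_ne_zero (D₁.eval_rep x) hj⟩) (by
    intro v hv hc o i
    obtain ⟨d, F', hF', hF'v⟩ := exists_represents ψ hv hc
    obtain ⟨hc', -⟩ := eq_pt_of_represents hF' hv hc hF'v
    obtain ⟨j, hj⟩ := Function.ne_iff.mp hF'v
    have hj' : o.ord (F' j) = 0 := o.eq_zero_of_eval_ne_zero hj
    -- Combined with `h2` this becomes `2 ord H + ord q₁ = 2 ord (F j) + ord q₂(F')`, because `F' j`
    -- and `c` are units at the point.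
    have h1 := o.congr _ _ (D₁.dvd_aeval_of_represents hF hF' D₂.isHomogeneous_q j)
    have h2 : D₁.cubic ∣ aeval F D₂.q - C c * H ^ 2 * D₁.q := by
      refine D₁.dvd_of_vanish fun w hw => ?_
      simp only [map_sub, _root_.map_mul, map_pow, eval_aeval, hq w hw, eval_C, sub_self]
    have h3 := o.congr _ _ h2
    rw [o.map_mul, o.map_mul, o.ord_pow, o.ord_pow, h3, o.map_mul, o.map_mul, o.ord_pow,
      o.eq_zero_of_eval_ne_zero (A := C c) (by simpa using hc0), hj'] at h1
    have h4 : o.ord (aeval F' D₂.q) ≤ 1 := by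
      by_cases h0 : eval (evalVec F' v) D₂.q = 0
      · exact ord_aeval_le_one hs ψ hv hc o hF' hF'v D₂.isHomogeneous_q h0
          (h₂.linearIndependent hF'v hc' h0)
      · rw [o.eq_zero_of_eval_ne_zero (by rwa [eval_aeval])]
        exact zero_le
    have h5 : o.ord H ≤ o.ord (F j) := by
      refine ENat.le_of_two_mul_add_eq (s := o.ord D₁.q) (t := o.ord (aeval F' D₂.q)) ?_ h4
      simpa using h1
    have h6 := o.congr _ _ (D₁.dvd_of_represents hF hF' i j)
    rw [o.map_mul, o.map_mul, hj', add_zero] at h6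
    rw [h6]
    exact h5.trans le_self_add)
  refine ⟨M, hM, ?_⟩
  have h1 : D₁.cubic ∣ H ^ 2 * (aeval (matForms M) D₂.q - C c * D₁.q) := by
    refine D₁.dvd_of_vanish fun v hc => ?_
    have h2 : evalVec F v = eval v H • M.mulVec v := by
      ext i
      obtain ⟨T, hT⟩ := hFM i
      have := congrArg (eval v) hT
      simp only [map_sub, map_mul, hc, zero_mul] at this
      rw [← evalVec_matForms]
      exact sub_eq_zero.mp this
    have h3 := hq v hc
    rw [h2, eval_smul_of_isHomogeneous D₂.isHomogeneous_q] at h3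
    simp only [map_sub, map_mul, map_pow, eval_aeval, evalVec_matForms, eval_C]
    linear_combination h3
  intro v hc
  obtain ⟨T, hT⟩ := (D₁.prime_cubic.dvd_or_dvd h1).resolve_left
    fun h => hH0 (D₁.prime_cubic.dvd_of_dvd_pow h)
  have h4 := congrArg (eval v) hT
  simp only [map_sub, map_mul, hc, zero_mul, eval_aeval, evalVec_matForms, eval_C] at h4
  exact sub_eq_zero.mp h4

/-- At the origin the second factor is a unit, so along the cubic `z` vanishes there to three times
the order of `x`. -/
theorem X_two_mul_eq (D : CoverData K) :
    X 2 * (X 1 ^ 2 - C D.a₂ * X 0 ^ 2 - C D.a₄ * X 0 * X 2 - C D.a₆ * X 2 ^ 2) =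
      X 0 ^ 3 + D.cubic := by
  rw [cubic]; ring

theorem dvd_X_two_mul_sub (D : CoverData K) : D.cubic ∣
    X 2 * (X 1 ^ 2 - C D.a₂ * X 0 ^ 2 - C D.a₄ * X 0 * X 2 - C D.a₆ * X 2 ^ 2) - X 0 ^ 3 :=
  ⟨1, by rw [X_two_mul_eq]; ring⟩

theorem exists_eq_of_apply_two_eq_zero {v : Fin 3 → K} (hv : v ≠ 0) (hc : eval v D.cubic = 0)
    (h : v 2 = 0) : v 0 = 0 ∧ v 1 ≠ 0 := by
  rw [eval_cubic, h] at hc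
  have h0 : v 0 = 0 := by simpa using hc
  refine ⟨h0, fun h1 => hv ?_⟩
  ext i; fin_cases i <;> assumption

/-- An isomorphism of plane cubics preserving the origins is linear. -/
theorem exists_isLinear_of_origin [IsAlgClosed K] (hs : IsSmoothCubic D₁.cubic)
    (ι : Iso D₁.base D₂.base) (hι : ι D₁.origin = D₂.origin) :
    ∃ M : Matrix (Fin 3) (Fin 3) K, IsLinear (ι : D₁.base → D₂.base) M := by
  obtain ⟨e, F, hF, hFO⟩ := exists_represents ι ne_zero_origin D₁.eval_origin
  obtain ⟨j, hj⟩ := Function.ne_iff.mp hFO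
  have hFj : ¬ D₁.cubic ∣ F j := not_dvd_of_eval_ne_zero D₁.eval_origin hj
  -- The candidate linear forms are `z F i / F 2`: the pullback of the target's `z` is normalized to
  -- be the source's `z`, as both cut out three times the origin.
  have hXF : Represents (e + 1) (fun i => X 2 * F i) (ι : D₁.base → D₂.base) := by
    refine ⟨fun i => by rw [add_comm]; exact (isHomogeneous_X K 2).mul (hF.1 i), fun x h => ?_⟩
    have h1 : evalVec (fun i => X 2 * F i) x.1.rep = x.1.rep 2 • evalVec F x.1.rep := by
      ext i; simp [evalVec]
    have h2 := h
    rw [h1] at h2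
    rw [hF.2 x (right_ne_zero_of_smul h2)]
    exact mk_eq_of_smul _ _ _ h1
  have himg : ∀ {v : Fin 3 → K} (hv : v ≠ 0) (hc : eval v D₁.cubic = 0) {d : ℕ}
      {G : Fin 3 → MvPolynomial (Fin 3) K}, Represents d G (ι : D₁.base → D₂.base) →
      evalVec G v ≠ 0 → (eval v (G 2) = 0 ↔ v 2 = 0) := by
    intro v hv hc d G hG hGv
    obtain ⟨hc', h1⟩ := eq_pt_of_represents hG hv hc hGv
    rw [← D₁.pt_eq_origin_iff hv hc, ← ι.toEquiv.injective.eq_iff, hι, h1, pt_eq_origin_iff]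
    rfl
  have hF2 : ¬ D₁.cubic ∣ F 2 := by
    intro hdvd
    have h1 := (D₁.eventually_ne_zero (hF.1 j) hFj).and
      (D₁.eventually_ne_zero (isHomogeneous_X K 2) (D₁.not_cubic_dvd_X 2))
    obtain ⟨x, hx, hx2⟩ := h1.exists
    rw [eval_X] at hx2
    refine hx2 ((himg x.1.rep_nonzero (D₁.eval_rep x) hF fun h => hx (congrFun h j)).mp ?_)
    obtain ⟨T, hT⟩ := hdvd
    rw [hT, _root_.map_mul, D₁.eval_rep, zero_mul]
  obtain ⟨M, hM, -⟩ := CoverData.exists_isLinear hs ι hXF (hF.1 2) hF2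
    ⟨j, fun h => hFj ((D₁.prime_cubic.dvd_or_dvd h).resolve_left (D₁.not_cubic_dvd_X 2))⟩ (by
    intro v hv hc o i
    obtain ⟨d, F', hF', hF'v⟩ := exists_represents ι hv hc
    obtain ⟨hc', -⟩ := eq_pt_of_represents hF' hv hc hF'v
    have key := fun i j => o.congr _ _ (D₁.dvd_of_represents hF hF' i j)
    simp only [o.map_mul] at key ⊢
    by_cases h2 : v 2 = 0
    · have hF'2 := (himg hv hc hF' hF'v).mpr h2
      obtain ⟨hF'0, hF'1⟩ := exists_eq_of_apply_two_eq_zero hF'v hc' hF'2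
      obtain ⟨hv0, hv1⟩ := exists_eq_of_apply_two_eq_zero hv hc h2
      have k1 := key 2 1
      have k2 := key i 1
      rw [o.eq_zero_of_eval_ne_zero (A := F' 1) hF'1, add_zero] at k1 k2
      have hX2 : 3 ≤ o.ord (X 2) := by
        have h3 := o.congr _ _ D₁.dvd_X_two_mul_sub
        rw [o.map_mul, o.ord_pow, o.eq_zero_of_eval_ne_zero (A := _ - _ - _ - _)
          (by simpa [hv0, h2] using hv1), add_zero] at h3
        rw [h3]
        have h4 : o.ord (X 0) ≠ 0 := by
          rw [Ne, o.eq_zero_iff (isHomogeneous_X K 0)]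
          simpa using hv0
        calc (3 : ℕ∞) = (3 : ℕ) * 1 := by norm_num
          _ ≤ _ := by gcongr; exact Order.one_le_iff_ne_zero.mpr h4
      -- The relation between `z` and `x³` at the target origin, pulled back through `F'`; the
      -- target coordinate `x` is a uniformizer there, so its pullback has order at most 1.
      have hF'2 : o.ord (F' 2) ≤ 3 := by
        have h3 : D₁.cubic ∣ F' 2 * (F' 1 ^ 2 - C D₂.a₂ * F' 0 ^ 2 - C D₂.a₄ * F' 0 * F' 2
            - C D₂.a₆ * F' 2 ^ 2) - F' 0 ^ 3 := by
          have h4 := congrArg (aeval F') D₂.X_two_mul_eq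
          simp only [map_sub, _root_.map_mul, map_add, map_pow, aeval_X] at h4
          have hC : ∀ a : K, aeval F' (C a) = C a := fun a => by simp
          rw [hC, hC, hC] at h4
          rw [h4, add_sub_cancel_left]
          exact dvd_aeval_cubic hF'
        have h5 := o.congr _ _ h3
        simp only [evalVec] at hF'0 hF'1 hF'2
        rw [o.map_mul, o.ord_pow, o.eq_zero_of_eval_ne_zero (A := _ - _ - _ - _)
          (by simpa [hF'0, hF'2] using hF'1), add_zero] at h5
        have h6 := ord_aeval_le_one hs ι hv hc o hF' hF'v (isHomogeneous_X K 0)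
          (by simpa [evalVec] using hF'0) (by
            rw [LinearIndependent.pair_iff]
            intro s t hst
            have e0 := congrFun hst 0
            have e2 := congrFun hst 2
            simp [grad, cubic, pderiv_X, evalVec, hF'0, hF'2] at e0 e2
            exact ⟨e2.resolve_right hF'1, e0⟩)
        rw [aeval_X] at h6
        rw [h5]
        calc _ ≤ ((3 : ℕ) : ℕ∞) * 1 := by gcongr
          _ = 3 := by norm_num
      rw [k1, k2, add_comm]
      calc _ ≤ o.ord (X 2) + o.ord (F 1) := by gcongr; exact hF'2.trans hX2
        _ ≤ _ := by gcongr; exact le_self_add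
    · have hF'2 := (not_congr (himg hv hc hF' hF'v)).mpr h2
      have k := key i 2
      rw [o.eq_zero_of_eval_ne_zero (A := F' 2) hF'2, add_zero] at k
      rw [k]
      exact le_self_add.trans le_add_self)
  exact ⟨M, hM⟩

end CoverData

/-! ### Linear isomorphisms of Weierstrass cubics and the `j`-invariant -/

namespace CoverData

variable {K : Type*} [Field K] {D D₁ D₂ : CoverData K}

theorem IsLinear.eval_mulVec {ψ : D₁.base → D₂.base} {M : Matrix (Fin 3) (Fin 3) K}
    (hM : IsLinear ψ M) {v : Fin 3 → K} (hv : v ≠ 0) (hc : eval v D₁.cubic = 0) :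
    ∃ hc' : eval (M.mulVec v) D₂.cubic = 0,
      ψ (D₁.pt v hv hc) = D₂.pt (M.mulVec v) (mulVec_ne_zero hM.det_ne_zero hv) hc' := by
  have h1 := hM.apply_eq v hv hc (mulVec_ne_zero hM.det_ne_zero hv)
  obtain ⟨a, ha, hr⟩ := exists_rep_eq_smul _ h1
  have h2 := D₂.eval_rep (ψ (D₁.pt v hv hc))
  rw [hr, eval_smul_of_isHomogeneous D₂.isHomogeneous_cubic] at h2
  exact ⟨(mul_eq_zero.mp h2).resolve_left (pow_ne_zero _ ha), Subtype.ext h1⟩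

/-- The pulled-back cubic vanishes on the source, hence is a multiple of the source cubic; both
being cubic forms, the cofactor is constant. -/
theorem IsLinear.exists_eval_eq [IsAlgClosed K] {ψ : D₁.base → D₂.base}
    {M : Matrix (Fin 3) (Fin 3) K} (hM : IsLinear ψ M) :
    ∃ κ : K, ∀ v, eval (M.mulVec v) D₂.cubic = κ * eval v D₁.cubic := by
  have hom := D₂.isHomogeneous_cubic.aeval (matForms M) (fun i => isHomogeneous_linForm _)
  obtain ⟨T, hT⟩ := D₁.dvd_of_isHomogeneous_of_vanish hom fun v hv hc => by
    rw [eval_aeval, evalVec_matForms]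
    exact (hM.eval_mulVec hv hc).1
  have key : ∀ v, eval (M.mulVec v) D₂.cubic = eval v D₁.cubic * eval v T := by
    intro v
    rw [← _root_.map_mul, ← hT, eval_aeval, evalVec_matForms]
  rcases eq_or_ne T 0 with rfl | hT0
  · exact ⟨0, fun v => by simpa using key v⟩
  · have h1 := D₁.prime_cubic.ne_zero
    have h2 := hom.totalDegree (by rw [hT]; exact mul_ne_zero h1 hT0)
    rw [hT, totalDegree_mul_of_isDomain h1 hT0, D₁.isHomogeneous_cubic.totalDegree h1] at h2
    rw [totalDegree_eq_zero_iff_eq_C.mp (show T.totalDegree = 0 by omega)] at key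
    exact ⟨_, fun v => by rw [key, eval_C, mul_comm]⟩

theorem cubic_coeff_eq_zero [Infinite K] {a b c d : K}
    (h : ∀ x : K, a * x ^ 3 + b * x ^ 2 + c * x + d = 0) : a = 0 ∧ b = 0 ∧ c = 0 ∧ d = 0 := by
  have h1 : (Polynomial.C a * Polynomial.X ^ 3 + Polynomial.C b * Polynomial.X ^ 2 +
      Polynomial.C c * Polynomial.X + Polynomial.C d : Polynomial K) = 0 :=
    Polynomial.funext fun x => by simpa using h x
  have e := fun n => congrArg (fun p => Polynomial.coeff p n) h1
  have e3 := e 3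
  have e2 := e 2
  have e1 := e 1
  have e0 := e 0
  simp [Polynomial.coeff_X, Polynomial.coeff_C] at e3 e2 e1 e0
  exact ⟨e3, e2, e1, e0⟩

/-- A linear isomorphism of Weierstrass cubics preserving the origins preserves the
`j`-invariant. -/
theorem IsLinear.jInvariant_eq [IsAlgClosed K] (h2 : (2 : K) ≠ 0) {ψ : D₁.base → D₂.base}
    {M : Matrix (Fin 3) (Fin 3) K} (hM : IsLinear ψ M) (hψ : ψ D₁.origin = D₂.origin) :
    D₁.jInvariant = D₂.jInvariant := by
  obtain ⟨κ, hκ⟩ := hM.exists_eval_eq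
  obtain ⟨hc', h1⟩ := hM.eval_mulVec ne_zero_origin D₁.eval_origin
  rw [← origin_eq, hψ] at h1
  have h21 := (D₂.pt_eq_origin_iff _ _).mp h1.symm
  have h01 := (exists_eq_of_apply_two_eq_zero (mulVec_ne_zero hM.det_ne_zero ne_zero_origin)
    hc' h21).1
  have hdet := hM.det_ne_zero
  rw [Matrix.det_fin_three] at hdet
  have hmul : ∀ x y z : K, M.mulVec ![x, y, z] = ![M 0 0 * x + M 0 1 * y + M 0 2 * z,
      M 1 0 * x + M 1 1 * y + M 1 2 * z, M 2 0 * x + M 2 1 * y + M 2 2 * z] := by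
    intro x y z
    ext i
    fin_cases i <;> simp [Matrix.mulVec, dotProduct, Fin.sum_univ_three]
  rw [hmul] at h21 h01
  simp at h21 h01
  have hid := fun x y z => hκ ![x, y, z]
  simp only [hmul, eval_cubic, h21, h01] at hid
  simp only [h21, h01] at hdet
  simp at hid
  generalize M 0 0 = α at *
  generalize M 0 2 = β at *
  generalize M 1 0 = γ at *
  generalize M 1 1 = μ at *
  generalize M 1 2 = δ at *
  generalize M 2 0 = n at *
  generalize M 2 2 = m at *
  have hμ : μ ≠ 0 := by rintro rfl; simp at hdet
  -- Comparing `y = 1` with `y = -1` isolates the terms odd in `y`; comparing with `y = 0` below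
  -- isolates the coefficient of `y²`. Together they leave only `x ↦ α x + β z`, `y ↦ μ y`, `z ↦ m
  -- z`.
  have hodd : ∀ x z : K, (n * x + m * z) * (γ * x + δ * z) = 0 := by
    intro x z
    have e1 := hid x 1 z
    have e2 := hid x (-1) z
    have h4 : (2 : K) * 2 * μ * ((n * x + m * z) * (γ * x + δ * z)) = 0 := by
      linear_combination e1 - e2
    exact (mul_eq_zero.mp h4).resolve_left (by simp [h2, hμ])
  have heven : ∀ x z : K, μ ^ 2 * (n * x + m * z) = κ * z := by
    intro x z
    have e1 := hid x 1 z
    have e0 := hid x 0 z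
    linear_combination e1 - e0 - 2 * μ * hodd x z
  have hn : n = 0 := by
    have := heven 1 0
    simpa [hμ] using this
  subst hn
  have hm : μ ^ 2 * m = κ := by simpa using heven 0 1
  have hα : α ≠ 0 := by rintro rfl; simp at hdet
  have hm0 : m ≠ 0 := by rintro rfl; simp at hdet
  have hδ : δ = 0 := by
    have := hodd 0 1
    simpa [hm0] using this
  have hγ : γ = 0 := by
    have := hodd 1 1
    simpa [hm0, hδ] using this
  subst hδ hγ
  obtain ⟨e3, e2, e1, e0⟩ := cubic_coeff_eq_zero (a := α ^ 3 - κ)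
    (b := 3 * α ^ 2 * β + D₂.a₂ * α ^ 2 * m - κ * D₁.a₂)
    (c := 3 * α * β ^ 2 + 2 * D₂.a₂ * α * β * m + D₂.a₄ * α * m ^ 2 - κ * D₁.a₄)
    (d := β ^ 3 + D₂.a₂ * β ^ 2 * m + D₂.a₄ * β * m ^ 2 + D₂.a₆ * m ^ 3 - κ * D₁.a₆)
    (fun x => by linear_combination -hid x 0 1)
  have hκα := (sub_eq_zero.mp e3).symm
  have a2 : D₁.a₂ = (3 * β + D₂.a₂ * m) / α := by
    rw [eq_div_iff hα]
    refine mul_left_cancel₀ (pow_ne_zero 2 hα) ?_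
    linear_combination -e2 - D₁.a₂ * hκα
  have a4 : D₁.a₄ = (3 * β ^ 2 + 2 * D₂.a₂ * β * m + D₂.a₄ * m ^ 2) / α ^ 2 := by
    rw [eq_div_iff (pow_ne_zero 2 hα)]
    refine mul_left_cancel₀ hα ?_
    linear_combination -e1 - D₁.a₄ * hκα
  have a6 : D₁.a₆ = (β ^ 3 + D₂.a₂ * β ^ 2 * m + D₂.a₄ * β * m ^ 2 + D₂.a₆ * m ^ 3) / α ^ 3 := by
    rw [eq_div_iff (pow_ne_zero 3 hα)]
    linear_combination -e0 - D₁.a₆ * hκα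
  -- The weights 2 and 6 of the factor `m / α` cancel in `c₄ ^ 3 / Δ`.
  have hc4 : D₁.weierstrass.c₄ = (m / α) ^ 2 * D₂.weierstrass.c₄ := by
    simp only [WeierstrassCurve.c₄, WeierstrassCurve.b₂, WeierstrassCurve.b₄, a2, a4]
    field_simp
    ring
  have hΔ : D₁.weierstrass.Δ = (m / α) ^ 6 * D₂.weierstrass.Δ := by
    simp only [WeierstrassCurve.Δ, WeierstrassCurve.b₂, WeierstrassCurve.b₄, WeierstrassCurve.b₆,
      WeierstrassCurve.b₈, a2, a4, a6]
    field_simp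
    ring
  rw [jInvariant, jInvariant, hc4, hΔ, mul_pow, ← pow_mul]
  exact mul_div_mul_left _ _ (pow_ne_zero _ (div_ne_zero hm0 hα))

end CoverData

/-! ### The group law: translations as isomorphisms, and flexes as 3-torsion -/

namespace CoverData

variable {K : Type*} [Field K] {D : CoverData K}

theorem nonsingular_of_eval (hs : IsSmoothCubic D.cubic) {v : Fin 3 → K} (hv : v ≠ 0)
    (hc : eval v D.cubic = 0) : WeierstrassCurve.Projective.Nonsingular D.weierstrass v := by
  have hg := hs.2 v hv hc
  rw [cubic_eq] at hc hg
  refine ⟨hc, ?_⟩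
  by_contra! hcon
  refine hg ?_
  ext i
  fin_cases i
  · exact hcon.1
  · exact hcon.2.1
  · exact hcon.2.2

theorem toPoint_pt (v : Fin 3 → K) (hv : v ≠ 0) (hc : eval v D.cubic = 0) :
    D.toPoint (D.pt v hv hc) = WeierstrassCurve.Projective.Point.toAffine D.weierstrass v := by
  obtain ⟨a, ha, hr⟩ := exists_rep_eq_smul hv (show (D.pt v hv hc).1 = _ from rfl)
  rw [toPoint, hr]
  exact WeierstrassCurve.Projective.Point.toAffine_smul _ (isUnit_iff_ne_zero.mpr ha)

theorem toPoint_of_ne_origin (hs : IsSmoothCubic D.cubic) {x : D.base} (hx : x ≠ D.origin) :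
    ∃ (a b : K) (hc : eval ![a, b, 1] D.cubic = 0) (h : D.weierstrass.toAffine.Nonsingular a b),
      x = D.pt ![a, b, 1] (ne_zero_affine a b) hc ∧ D.toPoint x = .some a b h := by
  have hz : x.1.rep 2 ≠ 0 := by
    intro hz
    apply hx
    rw [← D.pt_rep x, pt_eq_origin_iff]
    exact hz
  have hc := D.eval_affine_of_ne_zero (D.eval_rep x) hz
  have hns := nonsingular_of_eval hs (ne_zero_affine _ _) hc
  have hxe : x = D.pt _ (ne_zero_affine _ _) hc := by
    conv_lhs => rw [← D.pt_rep x]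
    rw [pt_eq_pt_iff]
    exact ⟨_, (eq_smul_affine hz).symm⟩
  refine ⟨_, _, hc, (WeierstrassCurve.Projective.nonsingular_some ..).mp hns, hxe, ?_⟩
  refine (congrArg D.toPoint hxe).trans ?_
  rw [toPoint_pt]
  exact WeierstrassCurve.Projective.Point.toAffine_some hns

theorem toPoint_bijective (hs : IsSmoothCubic D.cubic) : Function.Bijective D.toPoint := by
  constructor
  · intro x y hxy
    by_cases hx : x = D.origin
    · by_cases hy : y = D.origin
      · rw [hx, hy]
      · obtain ⟨a, b, hc, h, -, h1⟩ := toPoint_of_ne_origin hs hy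
        rw [hx, toPoint_origin, h1] at hxy
        exact absurd hxy.symm (WeierstrassCurve.Affine.Point.some_ne_zero h)
    · obtain ⟨a, b, hc, h, hxe, h1⟩ := toPoint_of_ne_origin hs hx
      by_cases hy : y = D.origin
      · rw [hy, toPoint_origin, h1] at hxy
        exact absurd hxy (WeierstrassCurve.Affine.Point.some_ne_zero h)
      · obtain ⟨a', b', hc', h', hye, h1'⟩ := toPoint_of_ne_origin hs hy
        rw [h1, h1', WeierstrassCurve.Affine.Point.some.injEq] at hxy
        obtain ⟨rfl, rfl⟩ := hxy
        rw [hxe, hye]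
  · rintro (_ | ⟨a, b, h⟩)
    · exact ⟨D.origin, D.toPoint_origin⟩
    · have hns := (WeierstrassCurve.Projective.nonsingular_some a b).mpr h
      have hc : eval ![a, b, 1] D.cubic = 0 := by rw [cubic_eq]; exact hns.1
      refine ⟨D.pt ![a, b, 1] (ne_zero_affine a b) hc, ?_⟩
      rw [toPoint_pt]
      exact WeierstrassCurve.Projective.Point.toAffine_some hns

/-- The points of the plane cubic and of the affine Weierstrass equation. -/
def pointEquiv (hs : IsSmoothCubic D.cubic) : D.base ≃ D.weierstrass.toAffine.Point :=
  Equiv.ofBijective D.toPoint (toPoint_bijective hs)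

/-- A ternary quadratic form with given coefficients. -/
def quadForm (c : Fin 6 → K) : MvPolynomial (Fin 3) K :=
  C (c 0) * (X 0 * X 0) + C (c 1) * (X 1 * X 1) + C (c 2) * (X 2 * X 2) + C (c 3) * (X 0 * X 1)
    + C (c 4) * (X 0 * X 2) + C (c 5) * (X 1 * X 2)

theorem isHomogeneous_quadForm (c : Fin 6 → K) : (quadForm c).IsHomogeneous 2 := by
  have h : ∀ (a : K) (i j : Fin 3), (C a * (X i * X j)).IsHomogeneous 2 := fun a i j =>
    ((isHomogeneous_X K i).mul (isHomogeneous_X K j)).C_mul a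
  exact (((((h _ _ _).add (h _ _ _)).add (h _ _ _)).add (h _ _ _)).add (h _ _ _)).add (h _ _ _)

variable (D) in
/-- The addition formula for a fixed second point. -/
def addForms (r : Fin 3 → K) : Fin 3 → MvPolynomial (Fin 3) K :=
  ![quadForm ![D.a₂ * r 0 * r 2 + D.a₄ * r 2 ^ 2, r 0 * r 2, -D.a₄ * r 0 ^ 2 - 3 * D.a₆ * r 0 * r 2,
      -2 * r 1 * r 2, -r 1 ^ 2 - D.a₂ * r 0 ^ 2 + 3 * D.a₆ * r 2 ^ 2, 2 * r 0 * r 1],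
    quadForm ![3 * r 0 * r 1 + D.a₂ * r 1 * r 2, r 1 * r 2, D.a₄ * r 0 * r 1 + 3 * D.a₆ * r 1 * r 2,
      -3 * r 0 ^ 2 - 2 * D.a₂ * r 0 * r 2 - D.a₄ * r 2 ^ 2,
      2 * D.a₂ * r 0 * r 1 + 2 * D.a₄ * r 1 * r 2,
      -r 1 ^ 2 - D.a₂ * r 0 ^ 2 - 2 * D.a₄ * r 0 * r 2 - 3 * D.a₆ * r 2 ^ 2],
    quadForm ![-3 * r 0 * r 2 - D.a₂ * r 2 ^ 2, r 2 ^ 2, -r 1 ^ 2 + D.a₂ * r 0 ^ 2 + D.a₄ * r 0 * r 2,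
      0, 3 * r 0 ^ 2 - D.a₄ * r 2 ^ 2, 0]]

theorem evalVec_addForms (r v : Fin 3 → K) :
    evalVec (D.addForms r) v = WeierstrassCurve.Projective.addXYZ D.weierstrass v r := by
  ext i
  fin_cases i
  · simp [evalVec, addForms, quadForm, WeierstrassCurve.Projective.addXYZ,
      WeierstrassCurve.Projective.addX]
    ring
  · simp [evalVec, addForms, quadForm, WeierstrassCurve.Projective.addXYZ,
      WeierstrassCurve.Projective.addY, WeierstrassCurve.Projective.negAddY,
      WeierstrassCurve.Projective.negY]
    ring
  · simp [evalVec, addForms, quadForm, WeierstrassCurve.Projective.addXYZ,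
      WeierstrassCurve.Projective.addZ]
    ring

theorem ne_zero_of_nonsingular {v : Fin 3 → K}
    (h : WeierstrassCurve.Projective.Nonsingular D.weierstrass v) : v ≠ 0 := by
  rintro rfl
  simp [WeierstrassCurve.Projective.nonsingular_iff] at h

section Translation

variable [DecidableEq K]

/-- Translation by a point, as a permutation. -/
def translateEquiv (hs : IsSmoothCubic D.cubic) (R : D.weierstrass.toAffine.Point) :
    D.base ≃ D.base :=
  ((pointEquiv hs).trans (Equiv.addRight R)).trans (pointEquiv hs).symm

theorem toPoint_translateEquiv (hs : IsSmoothCubic D.cubic) (R : D.weierstrass.toAffine.Point)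
    (x : D.base) : D.toPoint (translateEquiv hs R x) = D.toPoint x + R :=
  (pointEquiv hs).apply_symm_apply _

open scoped WeierstrassCurve.Projective in
-- The addition formula has bidegree (2, 2) in the two points, and for points of the cubic all its
-- coordinates vanish only on the diagonal. It therefore represents translation by `r` away from `x
-- = r`.
theorem represents_translateEquiv (hs : IsSmoothCubic D.cubic) (r : D.base) :
    Represents 2 (D.addForms r.1.rep) (translateEquiv hs (D.toPoint r)) ∧
      ∀ x : D.base, x ≠ r → evalVec (D.addForms r.1.rep) x.1.rep ≠ 0 := by
  have hns : ∀ x : D.base, WeierstrassCurve.Projective.Nonsingular D.weierstrass x.1.rep :=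
    fun x => nonsingular_of_eval hs x.1.rep_nonzero (D.eval_rep x)
  refine ⟨⟨fun i => ?_, fun x h => ?_⟩, fun x hx => ?_⟩
  · fin_cases i <;> exact isHomogeneous_quadForm _
  · have h' := h
    rw [evalVec_addForms] at h'
    have hne : ¬ x.1.rep ≈ r.1.rep := by
      rintro ⟨u, hu⟩
      apply h'
      rw [← hu]
      have := WeierstrassCurve.Projective.addXYZ_smul (W' := D.weierstrass) r.1.rep r.1.rep u.1 1
      rw [one_smul, WeierstrassCurve.Projective.addXYZ_self] at this
      refine this.trans ?_
      ext i; fin_cases i <;> simp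
    have h1 := WeierstrassCurve.Projective.nonsingular_add (hns x) (hns r)
    have h2 := WeierstrassCurve.Projective.Point.toAffine_add (hns x) (hns r)
    rw [WeierstrassCurve.Projective.add_of_not_equiv hne] at h1 h2
    have hc : eval (evalVec (D.addForms r.1.rep) x.1.rep) D.cubic = 0 := by
      rw [evalVec_addForms, cubic_eq]; exact h1.1
    refine congrArg Subtype.val ((toPoint_bijective hs).1 (a₂ := D.pt _ h hc) ?_)
    rw [toPoint_translateEquiv, toPoint_pt, evalVec_addForms]
    exact h2.symm
  · have hne : ¬ x.1.rep ≈ r.1.rep := by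
      rintro ⟨u, hu⟩
      apply hx
      rw [← D.pt_rep x, ← D.pt_rep r, pt_eq_pt_iff]
      exact ⟨u.1, hu⟩
    have h1 := WeierstrassCurve.Projective.nonsingular_add (hns x) (hns r)
    rw [WeierstrassCurve.Projective.add_of_not_equiv hne] at h1
    rw [evalVec_addForms]
    exact ne_zero_of_nonsingular h1

/-- Only finitely many points are the origin or have `y = 0`. The auxiliary `s` factors translation
by `r` so as to avoid the degenerate case of the addition formula. -/
theorem exists_add_self_ne_zero [IsAlgClosed K] (h2 : (2 : K) ≠ 0) (hs : IsSmoothCubic D.cubic)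
    (r : D.base) : ∃ s : D.base, s ≠ r ∧ D.toPoint s + D.toPoint s ≠ 0 := by
  have h1 := ((D.eventually_ne_zero (isHomogeneous_X K 1) (D.not_cubic_dvd_X 1)).and
    (eventually_cofinite_ne D.origin)).and (eventually_cofinite_ne r)
  obtain ⟨s, ⟨hs1, hsO⟩, hsr⟩ := h1.exists
  refine ⟨s, hsr, fun h => ?_⟩
  obtain ⟨a, b, hc, hns, hse, hsp⟩ := toPoint_of_ne_origin hs hsO
  have h3 : D.toPoint s = - D.toPoint s := eq_neg_of_add_eq_zero_left h
  rw [hsp, WeierstrassCurve.Affine.Point.neg_some, WeierstrassCurve.Affine.Point.some.injEq] at h3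
  have h4 := h3.2
  simp [WeierstrassCurve.Affine.negY] at h4
  have hb : b = 0 := by
    have : 2 * b = 0 := by linear_combination h4
    exact (mul_eq_zero.mp this).resolve_left h2
  obtain ⟨t, ht, hr⟩ := exists_rep_eq_smul _ (congrArg Subtype.val hse)
  rw [eval_X, hr] at hs1
  simp [hb] at hs1

theorem isMorphism_translateEquiv [IsAlgClosed K] (h2 : (2 : K) ≠ 0) (hs : IsSmoothCubic D.cubic)
    (R : D.weierstrass.toAffine.Point) : IsMorphism (translateEquiv hs R) := by
  intro x
  obtain ⟨r, rfl⟩ := (toPoint_bijective hs).2 R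
  by_cases hx : x = r
  · subst hx
    -- Translation by `x` is translation by `s` followed by `t = x - s`. The second formula
    -- degenerates only if `x + s = x - s`, which `2s ≠ 0` excludes.
    obtain ⟨s, hsx, hs2⟩ := exists_add_self_ne_zero h2 hs x
    obtain ⟨t, ht⟩ := (toPoint_bijective hs).2 (D.toPoint x - D.toPoint s)
    obtain ⟨hF, hF0⟩ := represents_translateEquiv hs s
    obtain ⟨hG, hG0⟩ := represents_translateEquiv hs t
    have hcomp : translateEquiv hs (D.toPoint t) ∘ translateEquiv hs (D.toPoint s) =
        translateEquiv hs (D.toPoint x) := by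
      ext1 y
      apply (toPoint_bijective hs).1
      rw [Function.comp_apply, toPoint_translateEquiv, toPoint_translateEquiv,
        toPoint_translateEquiv, ht]
      abel
    rw [← hcomp]
    refine ⟨_, _, hG.comp hF, ?_⟩
    have h0 := hF0 x hsx.symm
    rw [evalVec_comp]
    obtain ⟨a, ha, hr⟩ := exists_rep_eq_smul h0 (hF.2 x h0)
    have h1 := hG0 (translateEquiv hs (D.toPoint s) x) (by
      rintro h
      have h3 := congrArg D.toPoint h
      rw [toPoint_translateEquiv, ht, sub_eq_add_neg, add_right_inj] at h3
      exact hs2 (add_eq_zero_iff_eq_neg.mpr h3))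
    rw [hr, evalVec_smul hG.1] at h1
    exact right_ne_zero_of_smul h1
  · exact ⟨_, _, (represents_translateEquiv hs r).1, (represents_translateEquiv hs r).2 x hx⟩

/-- Translation by a point, as an isomorphism. -/
def translate [IsAlgClosed K] (h2 : (2 : K) ≠ 0) (hs : IsSmoothCubic D.cubic)
    (R : D.weierstrass.toAffine.Point) : Iso D.base D.base where
  toEquiv := translateEquiv hs R
  isMorphism_toFun := isMorphism_translateEquiv h2 hs R
  isMorphism_invFun := by
    have : (translateEquiv hs R).invFun = translateEquiv hs (-R) := by
      ext1 x
      change (translateEquiv hs R).symm x = _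
      rw [Equiv.symm_apply_eq]
      apply (toPoint_bijective hs).1
      rw [toPoint_translateEquiv, toPoint_translateEquiv, neg_add_cancel_right]
    rw [this]
    exact isMorphism_translateEquiv h2 hs (-R)

theorem toPoint_translate [IsAlgClosed K] (h2 : (2 : K) ≠ 0) (hs : IsSmoothCubic D.cubic)
    (R : D.weierstrass.toAffine.Point) (x : D.base) :
    D.toPoint (translate h2 hs R x) = D.toPoint x + R :=
  toPoint_translateEquiv hs R x

/-- A point that is the only intersection of the cubic with some line is 3-torsion. -/
theorem three_nsmul_toPoint [IsAlgClosed K] (h2 : (2 : K) ≠ 0) (hs : IsSmoothCubic D.cubic)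
    (r : D.base) (l : Fin 3 → K)
    (hl : ∀ v (hv : v ≠ 0) (hc : eval v D.cubic = 0), l ⬝ᵥ v = 0 ↔ D.pt v hv hc = r) :
    3 • D.toPoint r = 0 := by
  by_cases hr : r = D.origin
  · rw [hr, toPoint_origin, smul_zero]
  obtain ⟨a, b, hc, hns, hre, hrp⟩ := toPoint_of_ne_origin hs hr
  have hl1 : l 1 ≠ 0 := by
    have h := (not_congr (hl _ ne_zero_origin D.eval_origin)).mpr (fun h => hr h.symm)
    simpa [dotProduct, Fin.sum_univ_three] using h
  have hline : ∀ x y, l ⬝ᵥ ![x, y, 1] = 0 ↔ y = -l 0 / l 1 * x + -l 2 / l 1 := by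
    intro x y
    simp only [dotProduct, Fin.sum_univ_three, Matrix.cons_val_zero, Matrix.cons_val_one,
      Matrix.cons_val]
    field_simp
    constructor <;> intro h <;> linear_combination h
  generalize -l 0 / l 1 = m at hline
  generalize -l 2 / l 1 = k at hline
  have hb : b = m * a + k := (hline a b).mp ((hl _ _ hc).mpr hre.symm)
  -- The abscissas of the intersections with `y = m x + k` are the roots of `f(x, 1) - (m x + k)²`.
  -- All of them equal `a`, so the line is tangent with triple contact and `r + r = -r`.
  let g : Cubic K := ⟨1, D.a₂ - m ^ 2, D.a₄ - 2 * m * k, D.a₆ - k ^ 2⟩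
  have hg : g.a ≠ 0 := one_ne_zero
  obtain ⟨x₁, x₂, x₃, hroots⟩ := (Cubic.splits_iff_roots_eq_three (φ := RingHom.id K) hg).mp
    (IsAlgClosed.splits _)
  have hroot : ∀ x ∈ (Cubic.map (RingHom.id K) g).roots, x = a := by
    intro x hx
    rw [Cubic.mem_roots_iff (Cubic.ne_zero_of_a_ne_zero (P := Cubic.map (RingHom.id K) g) hg)] at hx
    simp [g, Cubic.map] at hx
    have hcx : eval ![x, m * x + k, 1] D.cubic = 0 := by
      simp [eval_cubic]
      linear_combination -hx
    have h3 := (hl _ (ne_zero_affine _ _) hcx).mp ((hline _ _).mpr rfl)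
    rw [hre, pt_eq_pt_iff] at h3
    obtain ⟨t, ht⟩ := h3
    have ht0 := congrFun ht 0
    have ht2 := congrFun ht 2
    simp at ht0 ht2
    rw [← ht0, ht2, one_mul]
  have e2 := Cubic.b_eq_three_roots hg hroots
  have e4 := Cubic.c_eq_three_roots hg hroots
  rw [hroots] at hroot
  obtain rfl := hroot x₁ (by simp)
  obtain rfl := hroot x₂ (by simp)
  obtain rfl := hroot x₃ (by simp)
  simp [g] at e2 e4
  have hder : 3 * x₃ ^ 2 + 2 * D.a₂ * x₃ + D.a₄ = 2 * m * b := by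
    rw [hb]; linear_combination 2 * x₃ * e2 + e4
  -- If `b = 0`, then `hder` makes the derivative of `f` vanish as well, and the point is singular.
  have hb0 : b ≠ 0 := by
    intro h0
    rw [WeierstrassCurve.Affine.nonsingular_iff] at hns
    rw [h0, mul_zero] at hder
    simp [h0, hder] at hns
  have hneg : b ≠ D.weierstrass.toAffine.negY x₃ b := by
    simp [WeierstrassCurve.Affine.negY]
    intro h
    have h3 : 2 * b = 0 := by linear_combination h
    exact hb0 ((mul_eq_zero.mp h3).resolve_left h2)
  have hslope : D.weierstrass.toAffine.slope x₃ x₃ b b = m := by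
    rw [WeierstrassCurve.Affine.slope_of_Y_ne rfl hneg]
    simp [WeierstrassCurve.Affine.negY]
    rw [hder, show b + b = 2 * b by ring, mul_right_comm, mul_div_assoc]
    field_simp
  have hsum : D.toPoint r + D.toPoint r = - D.toPoint r := by
    rw [hrp, WeierstrassCurve.Affine.Point.add_self_of_Y_ne hneg,
      WeierstrassCurve.Affine.Point.neg_some, WeierstrassCurve.Affine.Point.some.injEq]
    rw [hslope]
    simp [WeierstrassCurve.Affine.addX, WeierstrassCurve.Affine.addY,
      WeierstrassCurve.Affine.negAddY, WeierstrassCurve.Affine.negY]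
    have hX : m ^ 2 - D.a₂ - x₃ - x₃ = x₃ := by linear_combination -e2
    refine ⟨hX, ?_⟩
    rw [hX]; simp
  rw [show (3 : ℕ) = 2 + 1 from rfl, add_smul, two_smul, one_smul, hsum, neg_add_cancel]

end Translation

end CoverData

namespace CoverCurve

variable {K : Type*} [Field K]

theorem Iso.comp_apply {n m k : ℕ} {X : Set (PSpace K n)} {Y : Set (PSpace K m)}
    {Z : Set (PSpace K k)} (g : Iso Y Z) (f : Iso X Y) (x : X) : (g.comp f) x = g (f x) := rfl

theorem Iso.apply_inv_apply {n m : ℕ} {X : Set (PSpace K n)} {Y : Set (PSpace K m)}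
    (f : Iso X Y) (y : Y) : f (f.inv y) = y := f.toEquiv.apply_symm_apply y

end CoverCurve

/-! ### Consequences: equality of `j`-invariants and the torsion of the translation part -/

namespace CoverData

variable {K : Type*} [Field K] [IsAlgClosed K] {D₁ D₂ : CoverData K}

/-- Isomorphic plane cubics are isomorphic by an isomorphism preserving the origins. -/
theorem exists_iso_origin [DecidableEq K] (h2 : (2 : K) ≠ 0) (hs : IsSmoothCubic D₂.cubic)
    (ψ : Iso D₁.base D₂.base) : ∃ ι : Iso D₁.base D₂.base, ι D₁.origin = D₂.origin := by
  refine ⟨(translate h2 hs (-D₂.toPoint (ψ D₁.origin))).comp ψ, ?_⟩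
  apply (toPoint_bijective hs).1
  rw [toPoint_origin, Iso.comp_apply, toPoint_translate, add_neg_cancel]

theorem jInvariant_eq_of_iso [DecidableEq K] (h2 : (2 : K) ≠ 0) (hs₁ : IsSmoothCubic D₁.cubic)
    (hs₂ : IsSmoothCubic D₂.cubic) (ψ : Iso D₁.base D₂.base) : D₁.jInvariant = D₂.jInvariant := by
  obtain ⟨ι, hι⟩ := exists_iso_origin h2 hs₂ ψ
  obtain ⟨M, hM⟩ := exists_isLinear_of_origin hs₁ ι hι
  exact hM.jInvariant_eq h2 hι

/-- A linear isomorphism differs from one preserving the origins by a `3`-torsion translation. -/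
theorem exists_translate_comp [DecidableEq K] (h2 : (2 : K) ≠ 0) (hs : IsSmoothCubic D₁.cubic)
    {ψ ι : Iso D₁.base D₂.base} {M : Matrix (Fin 3) (Fin 3) K}
    (hM : IsLinear (ψ : D₁.base → D₂.base) M) (hι : ι D₁.origin = D₂.origin) :
    ∃ (R : D₁.weierstrass.toAffine.Point) (ρ : Iso D₁.base D₁.base),
      3 • R = 0 ∧ ρ D₁.origin = D₁.origin ∧
        ∀ x, D₁.toPoint (ι.symm (ψ x)) = D₁.toPoint (ρ x) + R := by
  obtain ⟨N, hN⟩ := exists_isLinear_of_origin hs ι hι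
  let r : D₁.base := ι.inv (ψ D₁.origin)
  refine ⟨D₁.toPoint r, (translate h2 hs (-D₁.toPoint r)).comp (ι.inv.comp ψ), ?_, ?_, fun x => ?_⟩
  · have hdet : IsUnit M.det := isUnit_iff_ne_zero.mpr hM.det_ne_zero
    -- The line is the preimage of `z = 0` under the linear map `M⁻¹ N` inducing `ψ⁻¹ ∘ ι`. Since `z
    -- = 0` meets the cubic only at the origin, this line meets it only at `r`.
    refine three_nsmul_toPoint h2 hs r ((M⁻¹ * N) 2) fun v hv hc => ?_
    obtain ⟨hc', hι'⟩ := hN.eval_mulVec hv hc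
    have hr : D₁.pt v hv hc = r ↔ ι (D₁.pt v hv hc) = ψ D₁.origin :=
      (Equiv.eq_symm_apply ι.toEquiv)
    obtain ⟨hcO, hψO⟩ := hM.eval_mulVec ne_zero_origin D₁.eval_origin
    have hl : (M⁻¹ * N) 2 ⬝ᵥ v = (M⁻¹.mulVec (N.mulVec v)) 2 := by rw [Matrix.mulVec_mulVec]; rfl
    rw [hr, hl]
    constructor
    · intro h0
      set s := ψ.inv (ι (D₁.pt v hv hc))
      have hs1 : ψ s = ι (D₁.pt v hv hc) := ψ.apply_inv_apply _
      obtain ⟨hcs, hψs⟩ := hM.eval_mulVec s.1.rep_nonzero (D₁.eval_rep s)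
      rw [pt_rep, hs1, hι', pt_eq_pt_iff] at hψs
      obtain ⟨a, ha⟩ := hψs
      have ha0 : a ≠ 0 := by
        rintro rfl
        exact mulVec_ne_zero hN.det_ne_zero hv (by rw [← ha, zero_smul])
      have h3 : s.1.rep 2 = 0 := by
        rw [← ha, Matrix.mulVec_smul, Matrix.mulVec_mulVec, Matrix.nonsing_inv_mul _ hdet,
          Matrix.one_mulVec, Pi.smul_apply, smul_eq_mul] at h0
        exact (mul_eq_zero.mp h0).resolve_left ha0
      have hsO : s = D₁.origin := by rw [← D₁.pt_rep s, pt_eq_origin_iff]; exact h3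
      rw [← hs1, hsO]
    · rw [hι', origin_eq, hψO, pt_eq_pt_iff]
      rintro ⟨a, ha⟩
      rw [← ha, Matrix.mulVec_smul, Matrix.mulVec_mulVec, Matrix.nonsing_inv_mul _ hdet]
      simp
  · apply (toPoint_bijective hs).1
    rw [toPoint_origin, Iso.comp_apply, toPoint_translate, Iso.comp_apply, add_neg_cancel]
  · rw [Iso.comp_apply, toPoint_translate, neg_add_cancel_right]
    rfl

end CoverData

/-! ### Points of the space curve and lifting of linear isomorphisms -/

namespace CoverData

section Points

section

variable {K : Type*}

/-- The vector `(x, y, z, w)` with given `(x, y, z)` and `w`. -/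
def snoc₃ (u : Fin 3 → K) (w : K) : Fin 4 → K := Fin.snoc (α := fun _ => K) u w

theorem snoc₃_last (u : Fin 3 → K) (w : K) : snoc₃ u w (Fin.last 3) = w :=
  Fin.snoc_last (α := fun _ => K) _ _

theorem snoc₃_three (u : Fin 3 → K) (w : K) : snoc₃ u w 3 = w := snoc_three _ _

theorem snoc₃_castSucc (u : Fin 3 → K) (w : K) (i : Fin 3) : snoc₃ u w i.castSucc = u i :=
  Fin.snoc_castSucc (α := fun _ => K) _ _ _

theorem snoc₃_comp (u : Fin 3 → K) (w : K) : snoc₃ u w ∘ Fin.castSucc = u :=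
  funext (snoc₃_castSucc u w)

theorem snoc₃_eta (v : Fin 4 → K) : snoc₃ (v ∘ Fin.castSucc) (v 3) = v := by
  ext i
  refine Fin.lastCases ?_ (fun i => ?_) i
  · rw [snoc₃_last]; rfl
  · rw [snoc₃_castSucc]; rfl

theorem snoc₃_inj {u u' : Fin 3 → K} {w w' : K} : snoc₃ u w = snoc₃ u' w' ↔ u = u' ∧ w = w' := by
  refine ⟨fun h => ⟨?_, ?_⟩, fun ⟨h, h'⟩ => by rw [h, h']⟩
  · rw [← snoc₃_comp u w, h, snoc₃_comp]
  · rw [← snoc₃_three u w, h, snoc₃_three]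

end

variable {K : Type*} [Field K]

theorem smul_snoc₃ (a : K) (u : Fin 3 → K) (w : K) : a • snoc₃ u w = snoc₃ (a • u) (a * w) := by
  rw [← snoc₃_eta (a • snoc₃ u w), Pi.smul_apply, snoc₃_three, smul_eq_mul]
  congr 1
  ext i
  simp [snoc₃_castSucc]

theorem snoc₃_ne_zero {u : Fin 3 → K} (hu : u ≠ 0) (w : K) : snoc₃ u w ≠ 0 := by
  intro h
  apply hu
  rw [← snoc₃_comp u w, h]; rfl

theorem snoc₃_zero : snoc₃ (0 : Fin 3 → K) 0 = 0 := snoc₃_eta 0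

variable (D : CoverData K)

theorem eval_P (u : Fin 3 → K) (w : K) : eval (snoc₃ u w) D.P = eval u D.cubic := by
  rw [P, eval_rename, snoc₃_comp]

theorem eval_Q (u : Fin 3 → K) (w : K) : eval (snoc₃ u w) D.Q = w ^ 2 - eval u D.q := by
  rw [Q, map_sub, eval_rename, snoc₃_comp, map_pow, eval_X, snoc₃_three]

theorem eval_q_smul (a : K) (u : Fin 3 → K) : eval (a • u) D.q = a ^ 2 * eval u D.q :=
  eval_smul_of_isHomogeneous D.isHomogeneous_q a u

theorem eval_cubic_smul (a : K) (u : Fin 3 → K) : eval (a • u) D.cubic = a ^ 3 * eval u D.cubic :=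
  eval_smul_of_isHomogeneous D.isHomogeneous_cubic a u

/-- The point of the space curve with given homogeneous coordinates. -/
def cpt (u : Fin 3 → K) (w : K) (hu : u ≠ 0) (hc : eval u D.cubic = 0) (hw : w ^ 2 = eval u D.q) :
    D.curve :=
  ⟨Projectivization.mk K (snoc₃ u w) (snoc₃_ne_zero hu w), by
    obtain ⟨a, ha, hr⟩ := exists_rep_eq_smul (snoc₃_ne_zero hu w) rfl
    rintro G (rfl | rfl) <;> rw [hr, smul_snoc₃]
    · rw [eval_P, eval_cubic_smul, hc, mul_zero]
    · rw [eval_Q, eval_q_smul, ← hw]; ring⟩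

/-- The first three coordinates of a point of the space curve. -/
abbrev cu {D : CoverData K} (x : D.curve) : Fin 3 → K := x.1.rep ∘ Fin.castSucc

/-- The last coordinate of a point of the space curve. -/
abbrev cw {D : CoverData K} (x : D.curve) : K := x.1.rep 3

variable {D}

theorem snoc₃_cu (x : D.curve) : snoc₃ (cu x) (cw x) = x.1.rep := snoc₃_eta _

theorem cu_eq {x : D.curve} {u : Fin 3 → K} {w : K} (h : x.1.rep = snoc₃ u w) : cu x = u := by
  rw [cu, h, snoc₃_comp]

theorem cw_eq {x : D.curve} {u : Fin 3 → K} {w : K} (h : x.1.rep = snoc₃ u w) : cw x = w := by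
  rw [cw, h, snoc₃_three]

theorem eval_cu (x : D.curve) : eval (cu x) D.cubic = 0 := by
  rw [← eval_P D (cu x) (cw x), snoc₃_cu]
  exact x.2 _ (Or.inl rfl)

theorem cw_sq (x : D.curve) : cw x ^ 2 = eval (cu x) D.q := by
  rw [← sub_eq_zero, ← eval_Q, snoc₃_cu]
  exact x.2 _ (Or.inr rfl)

theorem cu_ne_zero (x : D.curve) : cu x ≠ 0 := by
  intro h
  have h1 := cw_sq x
  have h2 := D.eval_q_smul 0 (cu x)
  rw [zero_smul, zero_pow two_ne_zero, zero_mul, ← h, ← h1] at h2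
  apply x.1.rep_nonzero
  rw [← snoc₃_cu, h, pow_eq_zero_iff two_ne_zero |>.mp h2, snoc₃_zero]

theorem cpt_cu (x : D.curve) : D.cpt (cu x) (cw x) (cu_ne_zero x) (eval_cu x) (cw_sq x) = x := by
  refine Subtype.ext ((mk_eq_of_smul _ x.1.rep_nonzero 1 ?_).trans x.1.mk_rep)
  rw [one_smul, snoc₃_cu]

theorem cpt_eq_cpt_iff {u u' : Fin 3 → K} {w w' : K} {hu : u ≠ 0} {hu' : u' ≠ 0}
    {hc : eval u D.cubic = 0} {hc' : eval u' D.cubic = 0} {hw : w ^ 2 = eval u D.q}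
    {hw' : w' ^ 2 = eval u' D.q} :
    D.cpt u w hu hc hw = D.cpt u' w' hu' hc' hw' ↔ ∃ a : K, a • u' = u ∧ a * w' = w := by
  refine Subtype.ext_iff.trans ((Projectivization.mk_eq_mk_iff' K _ _ _ _).trans ?_)
  simp only [smul_snoc₃, snoc₃_inj]

theorem exists_rep_cpt {u : Fin 3 → K} {w : K} {hu : u ≠ 0} {hc : eval u D.cubic = 0}
    {hw : w ^ 2 = eval u D.q} : ∃ a : K, a ≠ 0 ∧ (D.cpt u w hu hc hw).1.rep = snoc₃ (a • u) (a * w) := by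
  obtain ⟨a, ha, hr⟩ := exists_rep_eq_smul (snoc₃_ne_zero hu w)
    (show (D.cpt u w hu hc hw).1 = _ from rfl)
  exact ⟨a, ha, by rw [hr, smul_snoc₃]⟩

end Points

section Linear

variable {K : Type*} [Field K] {D₁ D₂ : CoverData K}

/-- The linear forms `(M (x, y, z), s w)` in `K[x, y, z, w]`. -/
def coverForms (M : Matrix (Fin 3) (Fin 3) K) (s : K) : Fin 4 → MvPolynomial (Fin 4) K :=
  Fin.snoc (α := fun _ => MvPolynomial (Fin 4) K)
    (fun i => rename Fin.castSucc (matForms M i)) (C s * X 3)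

theorem isHomogeneous_coverForms (M : Matrix (Fin 3) (Fin 3) K) (s : K) (i : Fin 4) :
    (coverForms M s i).IsHomogeneous 1 := by
  refine Fin.lastCases ?_ (fun i => ?_) i
  · rw [coverForms, Fin.snoc_last]
    exact isHomogeneous_C_mul_X _ _
  · rw [coverForms, Fin.snoc_castSucc]
    exact (isHomogeneous_linForm _).rename_isHomogeneous

theorem evalVec_coverForms (M : Matrix (Fin 3) (Fin 3) K) (s : K) (u : Fin 3 → K) (w : K) :
    evalVec (coverForms M s) (snoc₃ u w) = snoc₃ (M.mulVec u) (s * w) := by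
  ext i
  refine Fin.lastCases ?_ (fun i => ?_) i
  · rw [evalVec, coverForms, Fin.snoc_last, snoc₃_last]
    simp [snoc₃_three]
  · rw [evalVec, coverForms, Fin.snoc_castSucc, snoc₃_castSucc, eval_rename, snoc₃_comp,
      ← evalVec_matForms]
    rfl

variable {M : Matrix (Fin 3) (Fin 3) K} (hM : M.det ≠ 0) (s : K)
  (hc : ∀ u, eval u D₁.cubic = 0 → eval (M.mulVec u) D₂.cubic = 0)
  (hq : ∀ u, eval u D₁.cubic = 0 → eval (M.mulVec u) D₂.q = s ^ 2 * eval u D₁.q)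

/-- The map of space curves given by the linear forms `coverForms M s`. -/
def coverMap (x : D₁.curve) : D₂.curve :=
  D₂.cpt (M.mulVec (cu x)) (s * cw x) (mulVec_ne_zero hM (cu_ne_zero x)) (hc _ (eval_cu x))
    (by rw [hq _ (eval_cu x), ← cw_sq]; ring)

theorem isMorphism_coverMap : IsMorphism (coverMap hM s hc hq) := by
  intro x
  have h1 : ∀ x : D₁.curve, evalVec (coverForms M s) x.1.rep =
      snoc₃ (M.mulVec (cu x)) (s * cw x) := fun x => by
    rw [← snoc₃_cu, evalVec_coverForms]
  refine ⟨1, coverForms M s, ⟨isHomogeneous_coverForms M s, fun y h => ?_⟩, ?_⟩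
  · exact mk_eq_of_smul _ _ 1 (by rw [one_smul, h1])
  · rw [h1]
    exact snoc₃_ne_zero (mulVec_ne_zero hM (cu_ne_zero x)) _

theorem coverMap_coverMap {M' : Matrix (Fin 3) (Fin 3) K} (hM' : M'.det ≠ 0) (s' : K)
    (hc' : ∀ u, eval u D₂.cubic = 0 → eval (M'.mulVec u) D₁.cubic = 0)
    (hq' : ∀ u, eval u D₂.cubic = 0 → eval (M'.mulVec u) D₁.q = s' ^ 2 * eval u D₂.q)
    (hMM : M' * M = 1) (hss : s' * s = 1) (x : D₁.curve) :
    coverMap hM' s' hc' hq' (coverMap hM s hc hq x) = x := by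
  obtain ⟨a, ha, hr⟩ := exists_rep_cpt (D := D₂) (hu := mulVec_ne_zero hM (cu_ne_zero x))
    (hc := hc _ (eval_cu x)) (w := s * cw x) (hw := by rw [hq _ (eval_cu x), ← cw_sq]; ring)
  have h1 : (coverMap hM s hc hq x).1.rep = snoc₃ (a • M.mulVec (cu x)) (a * (s * cw x)) := hr
  conv_rhs => rw [← cpt_cu x]
  rw [coverMap, cpt_eq_cpt_iff]
  refine ⟨a, ?_, ?_⟩
  · rw [cu_eq h1, Matrix.mulVec_smul, Matrix.mulVec_mulVec, hMM, Matrix.one_mulVec]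
  · rw [cw_eq h1]
    linear_combination -(a * cw x) * hss

end Linear

variable {K : Type*} [Field K] {D₁ D₂ : CoverData K}

theorem IsLinear.eval_inv_mulVec {ψ : Iso D₁.base D₂.base} {M : Matrix (Fin 3) (Fin 3) K}
    (hM : IsLinear (ψ : D₁.base → D₂.base) M) {u : Fin 3 → K} (hc : eval u D₂.cubic = 0) :
    eval (M⁻¹.mulVec u) D₁.cubic = 0 := by
  rcases eq_or_ne u 0 with rfl | hu
  · rw [Matrix.mulVec_zero, ← zero_smul K (0 : Fin 3 → K), eval_cubic_smul]; simp
  set x := ψ.inv (D₂.pt u hu hc)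
  have h1 : ψ x = D₂.pt u hu hc := ψ.apply_inv_apply _
  obtain ⟨hc', h2⟩ := hM.eval_mulVec x.1.rep_nonzero (D₁.eval_rep x)
  rw [pt_rep, h1, pt_eq_pt_iff] at h2
  obtain ⟨a, ha⟩ := h2
  rw [← ha, Matrix.mulVec_smul, Matrix.mulVec_mulVec,
    Matrix.nonsing_inv_mul _ (isUnit_iff_ne_zero.mpr hM.det_ne_zero), Matrix.one_mulVec,
    eval_cubic_smul, eval_rep, mul_zero]

/-- A linear isomorphism of the bases compatible with the quadratic forms lifts to the covers. -/
theorem IsLinear.nonempty_iso [IsAlgClosed K] {ψ : Iso D₁.base D₂.base} {M : Matrix (Fin 3) (Fin 3) K}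
    (hM : IsLinear (ψ : D₁.base → D₂.base) M) {c : K} (hc0 : c ≠ 0)
    (hq : ∀ v, eval v D₁.cubic = 0 → eval (M.mulVec v) D₂.q = c * eval v D₁.q) :
    Nonempty (Iso D₁.curve D₂.curve) := by
  -- The scalar by which `w` is multiplied in the lift.
  obtain ⟨s, rfl⟩ := IsAlgClosed.exists_pow_nat_eq c (n := 2) (by norm_num)
  have hs : s ≠ 0 := by rintro rfl; simp at hc0
  have hdet : IsUnit M.det := isUnit_iff_ne_zero.mpr hM.det_ne_zero
  have hc1 : ∀ u, eval u D₁.cubic = 0 → eval (M.mulVec u) D₂.cubic = 0 := by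
    obtain ⟨κ, hκ⟩ := hM.exists_eval_eq
    intro u hu
    rw [hκ, hu, mul_zero]
  have hM' : M⁻¹.det ≠ 0 := by
    rw [Matrix.det_nonsing_inv]; exact (hdet.ringInverse).ne_zero
  have hc2 : ∀ u, eval u D₂.cubic = 0 → eval (M⁻¹.mulVec u) D₁.cubic = 0 :=
    fun u hu => hM.eval_inv_mulVec hu
  have hq2 : ∀ u, eval u D₂.cubic = 0 →
      eval (M⁻¹.mulVec u) D₁.q = s⁻¹ ^ 2 * eval u D₂.q := by
    intro u hu
    have h1 := hq _ (hc2 u hu)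
    rw [Matrix.mulVec_mulVec, Matrix.mul_nonsing_inv _ hdet, Matrix.one_mulVec] at h1
    rw [h1, ← mul_assoc, ← mul_pow, inv_mul_cancel₀ hs, one_pow, one_mul]
  exact ⟨{
    toFun := coverMap hM.det_ne_zero s hc1 hq
    invFun := coverMap hM' s⁻¹ hc2 hq2
    left_inv := coverMap_coverMap _ _ _ _ _ _ _ _ (Matrix.nonsing_inv_mul _ hdet)
      (inv_mul_cancel₀ hs)
    right_inv := coverMap_coverMap _ _ _ _ _ _ _ _ (Matrix.mul_nonsing_inv _ hdet)
      (mul_inv_cancel₀ hs)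
    isMorphism_toFun := isMorphism_coverMap _ _ _ _
    isMorphism_invFun := isMorphism_coverMap _ _ _ _ }⟩

end CoverData

namespace CoverData

variable {K : Type*} [Field K] {D : CoverData K}

/-! ### The projection to the plane cubic and the involution -/

/-- The projection of the space curve to the plane cubic. -/
def proj (x : D.curve) : D.base := D.pt (cu x) (cu_ne_zero x) (eval_cu x)

/-- The involution `w ↦ -w` of the space curve. -/
def conj (x : D.curve) : D.curve :=
  D.cpt (cu x) (-cw x) (cu_ne_zero x) (eval_cu x) (by rw [neg_sq, cw_sq])

theorem proj_rep (x : D.curve) : ∃ a : K, a ≠ 0 ∧ (proj x).1.rep = a • cu x :=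
  exists_rep_eq_smul (cu_ne_zero x) rfl

theorem conj_rep (x : D.curve) : ∃ a : K, a ≠ 0 ∧ cu (conj x) = a • cu x ∧
    cw (conj x) = a * -cw x := by
  obtain ⟨a, ha, hr⟩ := exists_rep_cpt (D := D) (hu := cu_ne_zero x) (hc := eval_cu x)
    (w := -cw x) (hw := by rw [neg_sq, cw_sq])
  exact ⟨a, ha, cu_eq hr, cw_eq hr⟩

theorem isMorphism_proj : IsMorphism (proj : D.curve → D.base) := by
  have h1 : ∀ x : D.curve, evalVec (fun i : Fin 3 => (X i.castSucc : MvPolynomial (Fin 4) K))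
      x.1.rep = cu x := fun x => by ext i; simp [evalVec]
  refine fun x => ⟨1, fun i => X i.castSucc, ⟨fun i => isHomogeneous_X K _, fun y h => ?_⟩, ?_⟩
  · exact mk_eq_of_smul _ _ 1 (by rw [one_smul, h1])
  · rw [h1]; exact cu_ne_zero x

theorem proj_eq_proj_iff {x y : D.curve} : proj x = proj y ↔ x = y ∨ x = conj y := by
  rw [proj, proj, pt_eq_pt_iff]
  conv_rhs => rw [← cpt_cu x]
  conv_rhs => lhs; rhs; rw [← cpt_cu y]
  rw [conj, cpt_eq_cpt_iff, cpt_eq_cpt_iff]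
  constructor
  · rintro ⟨a, ha⟩
    have h1 := cw_sq x
    rw [← ha, eval_q_smul, ← cw_sq y, ← mul_pow] at h1
    rcases sq_eq_sq_iff_eq_or_eq_neg.mp h1 with h | h
    · exact Or.inl ⟨a, ha, h.symm⟩
    · exact Or.inr ⟨a, ha, by rw [h]; ring⟩
  · rintro (⟨a, ha, -⟩ | ⟨a, ha, -⟩) <;> exact ⟨a, ha⟩

theorem proj_conj (x : D.curve) : proj (conj x) = proj x :=
  proj_eq_proj_iff.mpr (Or.inr rfl)

theorem conj_conj (x : D.curve) : conj (conj x) = x := by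
  obtain ⟨a, ha, h1, h2⟩ := conj_rep x
  conv_rhs => rw [← cpt_cu x]
  rw [conj, cpt_eq_cpt_iff]
  exact ⟨a, h1.symm, by rw [h2]; ring⟩

theorem conj_injective : Function.Injective (conj : D.curve → D.curve) :=
  Function.LeftInverse.injective conj_conj

theorem conj_ne_self (h2 : (2 : K) ≠ 0) {x : D.curve} (hw : cw x ≠ 0) : conj x ≠ x := by
  intro h
  conv_rhs at h => rw [← cpt_cu x]
  rw [conj, cpt_eq_cpt_iff] at h
  obtain ⟨a, ha, haw⟩ := h
  obtain ⟨i, hi⟩ := Function.ne_iff.mp (cu_ne_zero x)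
  have h1 := congrFun ha i
  rw [Pi.smul_apply, smul_eq_mul] at h1
  have ha1 : a = 1 := mul_right_cancel₀ hi (by rw [h1, one_mul])
  rw [ha1, one_mul] at haw
  have h3 : 2 * cw x = 0 := by linear_combination haw
  exact hw ((mul_eq_zero.mp h3).resolve_left h2)

theorem proj_surjective [IsAlgClosed K] : Function.Surjective (proj : D.curve → D.base) := by
  intro y
  obtain ⟨w, hw⟩ := IsAlgClosed.exists_pow_nat_eq (eval y.1.rep D.q) (n := 2) (by norm_num)
  refine ⟨D.cpt y.1.rep w y.1.rep_nonzero (D.eval_rep y) hw, ?_⟩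
  obtain ⟨a, ha, hr⟩ := exists_rep_cpt (D := D) (hu := y.1.rep_nonzero) (hc := D.eval_rep y)
    (hw := hw)
  conv_rhs => rw [← D.pt_rep y]
  rw [proj, pt_eq_pt_iff]
  exact ⟨a, (cu_eq hr).symm⟩

theorem tendsto_proj : Tendsto (proj : D.curve → D.base) cofinite cofinite := by
  refine Tendsto.cofinite_of_finite_preimage_singleton fun y => ?_
  rcases Set.eq_empty_or_nonempty ((proj : D.curve → D.base) ⁻¹' {y}) with h | ⟨x, rfl⟩
  · rw [h]; exact Set.finite_empty
  · refine (Set.toFinite {x, conj x}).subset fun z hz => ?_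
    exact proj_eq_proj_iff.mp hz

theorem eventually_of_proj [IsAlgClosed K] {p : D.base → Prop}
    (h : ∀ᶠ x : D.curve in cofinite, p (proj x)) : ∀ᶠ y in cofinite, p y := by
  rw [eventually_cofinite] at h ⊢
  refine (h.image proj).subset fun y hy => ?_
  obtain ⟨x, rfl⟩ := proj_surjective y
  exact ⟨x, hy, rfl⟩

instance [IsAlgClosed K] : Infinite D.curve := Infinite.of_surjective _ proj_surjective

theorem eventually_conj {p : D.curve → Prop} (h : ∀ᶠ x : D.curve in cofinite, p x) :
    ∀ᶠ x : D.curve in cofinite, p (conj x) :=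
  conj_injective.tendsto_cofinite.eventually h

theorem eventually_cu_ne_zero [IsAlgClosed K] {T : MvPolynomial (Fin 3) K} {n : ℕ}
    (hT : T.IsHomogeneous n) (hdvd : ¬ D.cubic ∣ T) :
    ∀ᶠ x : D.curve in cofinite, eval (cu x) T ≠ 0 := by
  refine (tendsto_proj.eventually (D.eventually_ne_zero hT hdvd)).mono fun x hx => ?_
  obtain ⟨a, ha, hr⟩ := proj_rep x
  rw [hr, eval_smul_of_isHomogeneous hT] at hx
  exact right_ne_zero_of_mul hx

theorem eventually_z_ne_zero [IsAlgClosed K] : ∀ᶠ x : D.curve in cofinite, cu x 2 ≠ 0 :=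
  (eventually_cu_ne_zero (isHomogeneous_X K 2) (D.not_cubic_dvd_X 2)).mono fun x hx => by
    rwa [eval_X] at hx

/-! ### Forms on the space curve -/

/-- Even powers of `w` are absorbed into `q`. The factor `z = u 2` raises the degrees by one, so
that the coefficient of `w` has degree `d` rather than `d - 1`, which fails for `d = 0`. -/
theorem exists_decomposition {G : MvPolynomial (Fin 4) K} {d : ℕ} (hG : G.IsHomogeneous d) :
    ∃ A B : MvPolynomial (Fin 3) K, A.IsHomogeneous (d + 1) ∧ B.IsHomogeneous d ∧
      ∀ u w, w ^ 2 = eval u D.q → u 2 * eval (snoc₃ u w) G = eval u A + w * eval u B := by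
  rw [← mem_homogeneousSubmodule, ← homogeneousSubmodule_one_pow] at hG
  induction hG using Submodule.pow_induction_on_left' with
  | algebraMap r =>
    refine ⟨C r * X 2, 0, isHomogeneous_C_mul_X _ _, isHomogeneous_zero _ _ _, fun u w _ => ?_⟩
    simp [algebraMap_eq, mul_comm]
  | add G G' i hG hG' h h' =>
    obtain ⟨A, B, hA, hB, hAB⟩ := h
    obtain ⟨A', B', hA', hB', hAB'⟩ := h'
    refine ⟨A + A', B + B', hA.add hA', hB.add hB', fun u w hw => ?_⟩
    simp only [map_add]
    linear_combination hAB u w hw + hAB' u w hw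
  | mem_mul L hL i G hG h =>
    obtain ⟨A, B, hA, hB, hAB⟩ := h
    rw [homogeneousSubmodule_one_eq_span_X] at hL
    induction hL using Submodule.span_induction with
    | mem L hL =>
      obtain ⟨j, rfl⟩ := hL
      refine Fin.lastCases ?_ (fun j => ?_) j
      · refine ⟨D.q * B, A, ?_, hA, fun u w hw => ?_⟩
        · rw [Nat.succ_eq_add_one, add_assoc, add_comm]; exact D.isHomogeneous_q.mul hB
        · simp only [map_mul, eval_X, snoc₃_last, ← hw]
          linear_combination w * hAB u w hw
      · refine ⟨X j * A, X j * B, ?_, ?_, fun u w hw => ?_⟩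
        · rw [Nat.succ_eq_add_one, add_comm]; exact (isHomogeneous_X K j).mul hA
        · rw [Nat.succ_eq_add_one, add_comm]; exact (isHomogeneous_X K j).mul hB
        · simp only [map_mul, eval_X, snoc₃_castSucc]
          linear_combination u j * hAB u w hw
    | zero =>
      exact ⟨0, 0, isHomogeneous_zero _ _ _, isHomogeneous_zero _ _ _, fun u w _ => by simp⟩
    | add L L' _ _ h h' =>
      obtain ⟨A, B, hA, hB, hAB⟩ := h
      obtain ⟨A', B', hA', hB', hAB'⟩ := h'
      refine ⟨A + A', B + B', hA.add hA', hB.add hB', fun u w hw => ?_⟩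
      simp only [map_add, add_mul]
      linear_combination hAB u w hw + hAB' u w hw
    | smul a L _ h =>
      obtain ⟨A, B, hA, hB, hAB⟩ := h
      refine ⟨C a * A, C a * B, hA.C_mul a, hB.C_mul a, fun u w hw => ?_⟩
      simp only [smul_mul_assoc, smul_eval, map_mul, eval_C]
      have h1 := hAB u w hw
      rw [_root_.map_mul] at h1
      linear_combination a * h1

/-- Otherwise `1 / q` would be regular on the punctured cone, hence on the cone, placing `1` in an
ideal of polynomials that all vanish at `0`. -/
theorem exists_eval_q_eq_zero [IsAlgClosed K] :
    ∃ v : Fin 3 → K, v ≠ 0 ∧ eval v D.cubic = 0 ∧ eval v D.q = 0 := by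
  by_contra! hcon
  have hq : ¬ D.cubic ∣ D.q := not_dvd_of_eval_ne_zero D.eval_origin
    (hcon _ ne_zero_origin D.eval_origin)
  have h1 : (1 : MvPolynomial (Fin 3) K) ∈ Ideal.span {D.q, D.cubic} :=
    D.mem_span_of_forall_exists hq fun v hv hc =>
      ⟨D.q, hcon v hv hc, by rw [mul_one]; exact Ideal.subset_span (by simp)⟩
  obtain ⟨A, B, hAB⟩ := Ideal.mem_span_pair.mp h1
  have h2 := congrArg (eval (0 : Fin 3 → K)) hAB
  have h3 := D.eval_q_smul 0 0
  have h4 := D.eval_cubic_smul 0 0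
  simp only [smul_zero, ne_eq, OfNat.ofNat_ne_zero, not_false_eq_true, zero_pow, zero_mul] at h3 h4
  simp only [map_add, _root_.map_mul, h3, h4, mul_zero, add_zero, map_one] at h2
  exact zero_ne_one h2

theorem IsNonsingular.not_cubic_dvd_q [IsAlgClosed K] (h : D.IsNonsingular) : ¬ D.cubic ∣ D.q := by
  obtain ⟨v, hv, hc, hq⟩ := D.exists_eval_q_eq_zero
  exact D.not_cubic_dvd_of_linearIndependent hc (h.linearIndependent hv hc hq)

/-- `q` is not a square in the function field of the plane cubic. -/
theorem IsNonsingular.dvd_of_dvd_sq_sub [IsAlgClosed K] (h : D.IsNonsingular)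
    {A B : MvPolynomial (Fin 3) K} (hd : D.cubic ∣ A ^ 2 - D.q * B ^ 2) :
    D.cubic ∣ A ∧ D.cubic ∣ B := by
  obtain ⟨v, hv, hc, hq⟩ := D.exists_eval_q_eq_zero
  obtain ⟨o⟩ := D.nonempty_orderAt hv hc (h.isSmoothCubic.2 v hv hc)
  -- At a simple zero of `q` this reads `2 ord A = 1 + 2 ord B`, which is impossible for finite
  -- orders.
  have h1 := o.congr _ _ hd
  rw [o.map_mul, o.ord_pow, o.ord_pow,
    o.eq_one D.isHomogeneous_q hq (h.linearIndependent hv hc hq)] at h1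
  rw [← o.eq_top_iff, ← o.eq_top_iff]
  generalize o.ord A = a at h1
  generalize o.ord B = b at h1
  induction a using ENat.recTopCoe with
  | top =>
    induction b using ENat.recTopCoe with
    | top => exact ⟨rfl, rfl⟩
    | coe b => exact absurd h1.symm (by norm_cast)
  | coe a =>
    induction b using ENat.recTopCoe with
    | top => exact absurd h1 (by norm_cast)
    | coe b => norm_cast at h1; omega

/-- A form that does not vanish at some point with `z ≠ 0` has finitely many zeros on the curve. -/
theorem IsNonsingular.eventually_ne_zero [IsAlgClosed K] (h : D.IsNonsingular)
    {G : MvPolynomial (Fin 4) K} {d : ℕ} (hG : G.IsHomogeneous d) {x : D.curve} (hz : cu x 2 ≠ 0)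
    (hx : eval x.1.rep G ≠ 0) : ∀ᶠ y : D.curve in cofinite, eval y.1.rep G ≠ 0 := by
  obtain ⟨A, B, hA, hB, hAB⟩ := D.exists_decomposition hG
  -- The norm of `z G` down to the plane cubic, whose zeros are already known to be finite in number
  -- once it is nonzero.
  have hN : (A ^ 2 - D.q * B ^ 2).IsHomogeneous (2 * d + 2) := by
    refine .sub ?_ ?_
    · convert! hA.pow 2 using 1
      ring
    · convert! D.isHomogeneous_q.mul (hB.pow 2) using 1
      ring
  have hdvd : ¬ D.cubic ∣ A ^ 2 - D.q * B ^ 2 := by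
    intro hd
    obtain ⟨⟨A', rfl⟩, ⟨B', rfl⟩⟩ := h.dvd_of_dvd_sq_sub hd
    have h1 := hAB _ _ (cw_sq x)
    rw [_root_.map_mul, _root_.map_mul, eval_cu, zero_mul, zero_mul, mul_zero, add_zero,
      snoc₃_cu] at h1
    exact (mul_ne_zero hz hx) h1
  refine (eventually_cu_ne_zero hN hdvd).mono fun y hy h0 => hy ?_
  have h1 := hAB _ _ (cw_sq y)
  rw [snoc₃_cu, h0, mul_zero] at h1
  simp only [map_sub, _root_.map_mul, map_pow, ← cw_sq]
  linear_combination -(eval (cu y) A - cw y * eval (cu y) B) * h1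

end CoverData

namespace CoverData

variable {K : Type*} [Field K] {D D₁ D₂ : CoverData K}

/-! ### The projection has degree two -/

theorem eval_div_proj {G H : MvPolynomial (Fin 3) K} {d : ℕ} (hG : G.IsHomogeneous d)
    (hH : H.IsHomogeneous d) (x : D.curve) :
    eval (proj x).1.rep G / eval (proj x).1.rep H = eval (cu x) G / eval (cu x) H := by
  obtain ⟨a, ha, hr⟩ := proj_rep x
  rw [hr, eval_smul_of_isHomogeneous hG, eval_smul_of_isHomogeneous hH,
    mul_div_mul_left _ _ (pow_ne_zero _ ha)]

theorem Iso.eventually {α : Iso D₁.curve D₂.curve} {p : D₂.curve → Prop}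
    (h : ∀ᶠ x : D₂.curve in cofinite, p x) : ∀ᶠ x : D₁.curve in cofinite, p (α x) :=
  α.toEquiv.injective.tendsto_cofinite.eventually h

variable [IsAlgClosed K]

theorem isRational_div {G H : MvPolynomial (Fin 3) K} {d : ℕ} (hG : G.IsHomogeneous d)
    (hH : H.IsHomogeneous d) (hdvd : ¬ D.cubic ∣ H) :
    IsRational fun y : D.base => eval y.1.rep G / eval y.1.rep H :=
  ⟨d, G, H, hG, hH, (D.eventually_ne_zero hH hdvd).mono fun _ hy => ⟨hy, rfl⟩⟩

/-- Every rational function on the space curve is `a + b w / z` with `a` and `b` rational functions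
on the plane cubic. -/
theorem IsNonsingular.exists_eq_add_mul (h : D.IsNonsingular) {r : D.curve → K}
    (hr : IsRational r) : ∃ a b : D.base → K, IsRational a ∧ IsRational b ∧
      ∀ᶠ x : D.curve in cofinite, r x = a (proj x) + b (proj x) * (cw x / cu x 2) := by
  obtain ⟨d, G, H, hG, hH, hGH⟩ := hr
  obtain ⟨A, B, hA, hB, hAB⟩ := D.exists_decomposition hG
  obtain ⟨A', B', hA', hB', hAB'⟩ := D.exists_decomposition hH
  have hN : (A' ^ 2 - D.q * B' ^ 2).IsHomogeneous (2 * d + 2) := by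
    refine .sub ?_ ?_
    · convert! hA'.pow 2 using 1
      ring
    · convert! D.isHomogeneous_q.mul (hB'.pow 2) using 1
      ring
  have hG₀ : (A * A' - D.q * (B * B')).IsHomogeneous (2 * d + 2) := by
    refine .sub ?_ ?_
    · convert! hA.mul hA' using 1
      ring
    · convert! D.isHomogeneous_q.mul (hB.mul hB') using 1
      ring
  have hG₁ : (X 2 * (B * A' - A * B')).IsHomogeneous (2 * d + 2) := by
    rw [show 2 * d + 2 = 1 + (d + (d + 1)) by ring]
    refine (isHomogeneous_X K 2).mul ((hB.mul hA').sub ?_)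
    convert! hA.mul hB' using 1
    ring
  have hdvd : ¬ D.cubic ∣ A' ^ 2 - D.q * B' ^ 2 := by
    intro hd
    obtain ⟨⟨A₀, hA₀⟩, ⟨B₀, hB₀⟩⟩ := h.dvd_of_dvd_sq_sub hd
    obtain ⟨x, hx, hz⟩ := (hGH.and eventually_z_ne_zero).exists
    have h1 := hAB' _ _ (cw_sq x)
    rw [hA₀, hB₀, _root_.map_mul, _root_.map_mul, eval_cu, zero_mul, zero_mul, mul_zero, add_zero,
      snoc₃_cu] at h1
    exact (mul_ne_zero hz hx.1) h1
  refine ⟨_, _, isRational_div hG₀ hN hdvd, isRational_div hG₁ hN hdvd, ?_⟩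
  -- Rationalize the denominator: `(A + wB) / (A' + wB')` is multiplied above and below by `A' -
  -- wB'`.
  filter_upwards [hGH, eventually_z_ne_zero, eventually_cu_ne_zero hN hdvd] with x hx hz hNx
  rw [eval_div_proj hG₀ hN, eval_div_proj hG₁ hN, hx.2]
  have h1 := hAB _ _ (cw_sq x)
  have h2 := hAB' _ _ (cw_sq x)
  rw [snoc₃_cu] at h1 h2
  simp only [map_sub, _root_.map_mul, map_pow, eval_X, ← cw_sq] at hNx ⊢
  rw [div_eq_iff hx.1]
  field_simp
  have h3 : cu x 2 * (eval x.1.rep G * (eval (cu x) A' ^ 2 - cw x ^ 2 * eval (cu x) B' ^ 2)) =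
      cu x 2 * (eval x.1.rep H * (eval (cu x) A * eval (cu x) A' -
        cw x ^ 2 * (eval (cu x) B * eval (cu x) B') +
        (eval (cu x) B * eval (cu x) A' - eval (cu x) A * eval (cu x) B') * cw x)) := by
    linear_combination (eval (cu x) A' ^ 2 - cw x ^ 2 * eval (cu x) B' ^ 2) * h1 -
      (eval (cu x) A * eval (cu x) A' - cw x ^ 2 * (eval (cu x) B * eval (cu x) B') +
        (eval (cu x) B * eval (cu x) A' - eval (cu x) A * eval (cu x) B') * cw x) * h2
  have h4 := mul_left_cancel₀ hz h3
  linear_combination h4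

theorem eventually_cw_ne_zero (h : D.IsNonsingular) : ∀ᶠ x : D.curve in cofinite, cw x ≠ 0 :=
  (eventually_cu_ne_zero D.isHomogeneous_q h.not_cubic_dvd_q).mono fun x hx h0 =>
    hx (by rw [← cw_sq, h0]; ring)

/-- The basis is `1, w / z`. Independence follows by adding a relation to its conjugate under `w ↦
-w` and dividing by 2. -/
theorem hasDegree_proj (h2 : (2 : K) ≠ 0) (h : D.IsNonsingular) :
    HasDegree (proj : D.curve → D.base) 2 := by
  refine ⟨![fun _ => 1, fun x => cw x / cu x 2], fun i => ?_, fun r hr => ?_, fun a ha h0 => ?_⟩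
  · fin_cases i
    · exact ⟨0, 1, 1, isHomogeneous_one _ _, isHomogeneous_one _ _, Eventually.of_forall
        fun x => by simp⟩
    · exact ⟨1, X 3, X (Fin.castSucc 2), isHomogeneous_X _ _, isHomogeneous_X _ _,
        eventually_z_ne_zero.mono fun x hx => by
          rw [eval_X, eval_X]; exact ⟨hx, rfl⟩⟩
  · obtain ⟨a, b, ha, hb, hab⟩ := h.exists_eq_add_mul hr
    refine ⟨![a, b], fun i => by fin_cases i <;> assumption, hab.mono fun x hx => ?_⟩
    simpa [Fin.sum_univ_two] using hx
  · have key : ∀ᶠ x : D.curve in cofinite, a 0 (proj x) = 0 ∧ a 1 (proj x) = 0 := by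
      filter_upwards [h0, eventually_conj h0, eventually_cw_ne_zero h, eventually_z_ne_zero]
        with x hx hx' hw hz
      simp only [Fin.sum_univ_two, Matrix.cons_val_zero, Matrix.cons_val_one, mul_one,
        proj_conj] at hx hx'
      obtain ⟨t, ht, e1, e2⟩ := conj_rep x
      rw [e1, e2, Pi.smul_apply, smul_eq_mul, mul_div_mul_left _ _ ht, neg_div] at hx'
      have h3 : 2 * a 0 (proj x) = 0 := by linear_combination hx + hx'
      have h4 := (mul_eq_zero.mp h3).resolve_left h2
      rw [h4, zero_add] at hx
      exact ⟨h4, (mul_eq_zero.mp hx).resolve_right (div_ne_zero hw hz)⟩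
    intro i
    fin_cases i
    · exact eventually_of_proj (key.mono fun x hx => hx.1)
    · exact eventually_of_proj (key.mono fun x hx => hx.2)

theorem isEllipticQuotient_proj (h2 : (2 : K) ≠ 0) (h : D.IsNonsingular) :
    IsEllipticQuotient D.curve D.cubic proj :=
  ⟨h.isSmoothCubic, isMorphism_proj, hasDegree_proj h2 h⟩

/-! ### Isomorphisms of space curves -/

/-- A morphism to another curve is given by one tuple of forms outside finitely many points. -/
theorem IsNonsingular.exists_represents (h : D.IsNonsingular) {m : ℕ} {Y : Set (PSpace K m)}
    {φ : D.curve → Y} (hφ : IsMorphism φ) : ∃ d F, Represents d F φ ∧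
      ∀ᶠ x : D.curve in cofinite, evalVec F x.1.rep ≠ 0 := by
  obtain ⟨x, hx⟩ := (eventually_z_ne_zero (D := D)).exists
  obtain ⟨d, F, hF, hF0⟩ := hφ x
  obtain ⟨i, hi⟩ := Function.ne_iff.mp hF0
  exact ⟨d, F, hF, (h.eventually_ne_zero (hF.1 i) hx hi).mono fun y hy => Function.ne_iff.mpr ⟨i, hy⟩⟩

theorem IsRational.comp_iso (h : D₁.IsNonsingular) (α : Iso D₁.curve D₂.curve) {r : D₂.curve → K}
    (hr : IsRational r) : IsRational fun x => r (α x) := by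
  obtain ⟨d, G, H, hG, hH, hGH⟩ := hr
  obtain ⟨e, F, hF, hF0⟩ := h.exists_represents α.isMorphism_toFun
  refine ⟨e * d, aeval F G, aeval F H, hG.aeval F hF.1, hH.aeval F hF.1, ?_⟩
  have hev : ∀ (G : MvPolynomial (Fin 4) K) v, eval v (aeval F G) = eval (evalVec F v) G :=
    fun G v => congrFun (evalVec_comp F (fun _ : Fin 1 => G) v) 0
  filter_upwards [hF0, Iso.eventually (α := α) hGH] with x hx ⟨h1, h2⟩
  obtain ⟨a, ha, hr⟩ := exists_rep_eq_smul hx (hF.2 x hx)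
  change (α x).1.rep = _ at hr
  rw [hr, eval_smul_of_isHomogeneous hH] at h1 h2
  rw [eval_smul_of_isHomogeneous hG, mul_div_mul_left _ _ (pow_ne_zero _ ha)] at h2
  rw [hev, hev]
  exact ⟨right_ne_zero_of_mul h1, h2⟩

theorem HasDegree.comp_iso (h₁ : D₁.IsNonsingular) (h₂ : D₂.IsNonsingular)
    (α : Iso D₁.curve D₂.curve) {m d : ℕ} {Y : Set (PSpace K m)} {φ : D₂.curve → Y}
    (hφ : HasDegree φ d) : HasDegree (fun x => φ (α x)) d := by
  obtain ⟨g, hg, hspan, hind⟩ := hφ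
  refine ⟨fun i x => g i (α x), fun i => IsRational.comp_iso h₁ α (hg i), fun r hr => ?_,
    fun a ha h0 => ?_⟩
  · obtain ⟨a, ha, hra⟩ := hspan _ (IsRational.comp_iso h₂ α.inv hr)
    refine ⟨a, ha, (Iso.eventually (α := α) hra).mono fun x hx => ?_⟩
    rwa [show α.inv (α x) = x from α.toEquiv.symm_apply_apply x] at hx
  · refine hind a ha ((Iso.eventually (α := α.inv) h0).mono fun x hx => ?_)
    simpa only [α.apply_inv_apply] using hx

/-- Isomorphic space curves, one of which has a unique elliptic quotient, have isomorphic bases. -/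
theorem exists_iso_base (h2 : (2 : K) ≠ 0) (h₁ : D₁.IsUDCEC) (h₂ : D₂.IsNonsingular)
    (α : Iso D₁.curve D₂.curve) :
    ∃ ψ : Iso D₁.base D₂.base, ∀ x, ψ (proj x) = proj (α x) := by
  obtain ⟨G, φ, hφ, huniq⟩ := h₁.2
  obtain ⟨θ₁, hθ₁⟩ := huniq _ _ (isEllipticQuotient_proj h2 h₁.1)
  obtain ⟨θ₂, hθ₂⟩ := huniq D₂.cubic (fun x => proj (α x))
    ⟨h₂.isSmoothCubic, isMorphism_proj.comp α.isMorphism_toFun,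
      HasDegree.comp_iso h₁.1 h₂ α (hasDegree_proj h2 h₂)⟩
  refine ⟨Iso.comp (Y := zeroLocus {G}) θ₂ (Iso.inv θ₁), fun x => ?_⟩
  exact (congrArg θ₂ ((congrArg θ₁.inv (hθ₁ x)).symm.trans
    (θ₁.toEquiv.symm_apply_apply _))).trans (hθ₂ x)

end CoverData

/-! ### From an isomorphism of covers to the identity of quadratic forms -/

namespace CoverData

variable {K : Type*} [Field K] {D₁ D₂ : CoverData K}

/-- An isomorphism compatible with an isomorphism of the bases commutes with the involutions. -/
theorem apply_conj (h2 : (2 : K) ≠ 0) {α : Iso D₁.curve D₂.curve} {ψ : Iso D₁.base D₂.base}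
    (hα : ∀ x, ψ (proj x) = proj (α x)) {x : D₁.curve} (hx : cw x ≠ 0) :
    α (conj x) = conj (α x) := by
  have h1 : proj (α (conj x)) = proj (α x) := by rw [← hα, ← hα, proj_conj]
  -- The fibre through `α x` contains only it and its conjugate, and injectivity of `α` excludes the
  -- former.
  refine (proj_eq_proj_iff.mp h1).resolve_left fun h => ?_
  exact conj_ne_self h2 hx (α.toEquiv.injective h)

theorem exists_eq_cpt {y : D₂.curve} {u : Fin 3 → K} {hu : u ≠ 0} {hc : eval u D₂.cubic = 0}
    (h : proj y = D₂.pt u hu hc) : ∃ ω hω, y = D₂.cpt u ω hu hc hω := by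
  rw [proj, pt_eq_pt_iff] at h
  obtain ⟨a, ha⟩ := h
  have ha0 : a ≠ 0 := by
    rintro rfl
    exact cu_ne_zero y (by rw [← ha, zero_smul])
  have h1 := cw_sq y
  rw [← ha, eval_q_smul] at h1
  have hω : (cw y / a) ^ 2 = eval u D₂.q := by
    rw [div_pow, h1, mul_div_cancel_left₀ _ (pow_ne_zero 2 ha0)]
  refine ⟨cw y / a, hω, ?_⟩
  conv_lhs => rw [← cpt_cu y]
  rw [cpt_eq_cpt_iff]
  exact ⟨a, ha, mul_div_cancel₀ _ ha0⟩

theorem conj_cpt {u : Fin 3 → K} {w : K} {hu : u ≠ 0} {hc : eval u D₂.cubic = 0}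
    {hw : w ^ 2 = eval u D₂.q} : conj (D₂.cpt u w hu hc hw) =
      D₂.cpt u (-w) hu hc ((neg_sq w).trans hw) := by
  obtain ⟨a, ha, hr⟩ := exists_rep_cpt (D := D₂) (hu := hu) (hc := hc) (hw := hw)
  rw [conj, cpt_eq_cpt_iff]
  exact ⟨a, (cu_eq hr).symm, by rw [cw_eq hr]; ring⟩

/-- Isolates the unknown projective scalar `l`, one for `(u, w)` and another for `(u, -w)`; only
their product survives in the final identity. -/
theorem exists_evalVec_eq {α : D₁.curve → D₂.curve} {d : ℕ} {G : Fin 4 → MvPolynomial (Fin 4) K}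
    (hG : Represents d G α) {x : D₁.curve} (hx : evalVec G x.1.rep ≠ 0) {u U : Fin 3 → K} {w W : K}
    {hu : u ≠ 0} {hc : eval u D₁.cubic = 0} {hw : w ^ 2 = eval u D₁.q}
    {hU : U ≠ 0} {hC : eval U D₂.cubic = 0} {hW : W ^ 2 = eval U D₂.q}
    (hxu : x = D₁.cpt u w hu hc hw) (hα : α x = D₂.cpt U W hU hC hW) :
    ∃ l : K, l ≠ 0 ∧ evalVec G (snoc₃ u w) = l • snoc₃ U W := by
  obtain ⟨a, ha, hr⟩ := exists_rep_eq_smul (snoc₃_ne_zero hu w) (congrArg Subtype.val hxu)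
  rw [hr, evalVec_smul hG.1] at hx
  have hx := right_ne_zero_of_smul hx
  have h1 := hG.apply_mk x (snoc₃_ne_zero hu w) (congrArg Subtype.val hxu) hx
  rw [hα] at h1
  obtain ⟨l, hl⟩ := (Projectivization.mk_eq_mk_iff' K _ _ hx (snoc₃_ne_zero hU W)).mp h1.symm
  refine ⟨l, ?_, hl.symm⟩
  rintro rfl
  exact hx (by rw [← hl, zero_smul])

/-- In coordinates, `α (u, w) = (λ F u, λ ω)` and `α (u, -w) = (μ F u, - μ ω)`. -/
theorem quadratic_identity {w a b a₃ b₃ f ω l m p q : K} (h2 : (2 : K) ≠ 0)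
    (h1 : a + w * b = l * f) (h1' : a - w * b = m * f) (h3 : a₃ + w * b₃ = l * ω)
    (h3' : a₃ - w * b₃ = -(m * ω)) (hp : ω ^ 2 = p) (hq : w ^ 2 = q) :
    a ^ 2 - q * b ^ 2 = l * m * f ^ 2 ∧ w * (b₃ * a - a₃ * b) = l * m * ω * f ∧
      (a ^ 2 - q * b ^ 2) ^ 2 * p = ((b₃ * a - a₃ * b) * f) ^ 2 * q := by
  have e1 : a ^ 2 - q * b ^ 2 = l * m * f ^ 2 := by
    rw [← hq]; linear_combination (a - w * b) * h1 + l * f * h1'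
  have e2 : w * (b₃ * a - a₃ * b) = l * m * ω * f := by
    have : 2 * (w * (b₃ * a - a₃ * b)) = 2 * (l * m * ω * f) := by
      linear_combination (a - w * b) * h3 + l * ω * h1' - (a + w * b) * h3' + m * ω * h1
    exact mul_left_cancel₀ h2 this
  refine ⟨e1, e2, ?_⟩
  rw [e1, ← hp, ← hq]
  linear_combination -(w * (b₃ * a - a₃ * b) + l * m * ω * f) * f ^ 2 * e2

variable [IsAlgClosed K]

/-- An isomorphism of the bases that lifts to the covers is compatible with the quadratic forms. -/
theorem pullbackEq_of_lift (h2 : (2 : K) ≠ 0) (h₁ : D₁.IsNonsingular) (h₂ : D₂.IsNonsingular)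
    {α : Iso D₁.curve D₂.curve} {ψ : Iso D₁.base D₂.base}
    (hα : ∀ x, ψ (proj x) = proj (α x)) : D₁.PullbackEq D₂ ψ 1 := by
  obtain ⟨d, G, hG, hG0⟩ := h₁.exists_represents α.isMorphism_toFun
  choose A B hA hB hAB using fun i => D₁.exists_decomposition (hG.1 i)
  obtain ⟨f, F, hF, hFO⟩ := exists_represents ψ ne_zero_origin D₁.eval_origin
  obtain ⟨j, hj⟩ := Function.ne_iff.mp hFO
  have hFj : ¬ D₁.cubic ∣ F j := not_dvd_of_eval_ne_zero D₁.eval_origin hj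
  -- With `ω² = q₂(F u)`, and up to a common nonzero scalar at each point, `N` is `(F j)²` and `w M`
  -- is `ω F j`. Eliminating the scalar gives `N² q₂(F) = (M F j)² q₁`.
  set N := A j.castSucc ^ 2 - D₁.q * B j.castSucc ^ 2 with hNdef
  set M := B 3 * A j.castSucc - A 3 * B j.castSucc with hMdef
  have hN : N.IsHomogeneous (2 * d + 2) := by
    refine .sub ?_ ?_
    · convert! (hA j.castSucc).pow 2 using 1
      ring
    · convert! D₁.isHomogeneous_q.mul ((hB j.castSucc).pow 2) using 1
      ring
  have hM : M.IsHomogeneous (2 * d + 1) := by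
    refine .sub ?_ ?_
    · convert! (hB 3).mul (hA j.castSucc) using 1
      ring
    · convert! (hA 3).mul (hB j.castSucc) using 1
      ring
  have hNMF : (M * F j).IsHomogeneous (2 * d + 1 + f) := hM.mul (hF.1 j)
  have hT : (N ^ 2 * aeval F D₂.q - (M * F j) ^ 2 * D₁.q).IsHomogeneous
      ((2 * d + 2) * 2 + f * 2) := by
    refine .sub ((hN.pow 2).mul (D₂.isHomogeneous_q.aeval F hF.1)) ?_
    convert! (hNMF.pow 2).mul D₁.isHomogeneous_q using 1
    ring
  have key : ∀ᶠ x : D₁.curve in cofinite, eval (cu x) N ≠ 0 ∧ eval (cu x) (M * F j) ≠ 0 ∧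
      eval (cu x) (F j) ≠ 0 ∧
      eval (cu x) (N ^ 2 * aeval F D₂.q - (M * F j) ^ 2 * D₁.q) = 0 := by
    filter_upwards [hG0, eventually_conj hG0, eventually_z_ne_zero, eventually_cw_ne_zero h₁,
      eventually_cu_ne_zero (hF.1 j) hFj, Iso.eventually (α := α) (eventually_cw_ne_zero h₂)]
      with x hx hx' hz hw hFx hw2
    have hFu : evalVec F (cu x) ≠ 0 := Function.ne_iff.mpr ⟨j, hFx⟩
    obtain ⟨hc', hψ⟩ := eq_pt_of_represents hF (cu_ne_zero x) (eval_cu x) hFu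
    obtain ⟨ω, hω, hy⟩ := exists_eq_cpt ((hα x).symm.trans hψ)
    have hω0 : ω ≠ 0 := by
      rintro rfl
      obtain ⟨a, -, hr⟩ := exists_rep_cpt (D := D₂) (hu := hFu) (hc := hc') (hw := hω)
      rw [← hy] at hr
      exact hw2 ((cw_eq hr).trans (mul_zero a))
    obtain ⟨l, hl, hGl⟩ := exists_evalVec_eq hG hx (cpt_cu x).symm hy
    obtain ⟨m, hm, hGm⟩ := exists_evalVec_eq hG hx' (x := conj x) rfl
      ((apply_conj h2 hα hw).trans ((congrArg conj hy).trans conj_cpt))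
    have e1 := (hAB j.castSucc _ _ (cw_sq x)).symm
    have e2 := (hAB j.castSucc _ (-cw x) ((neg_sq _).trans (cw_sq x))).symm
    have e3 := (hAB 3 _ _ (cw_sq x)).symm
    have e4 := (hAB 3 _ (-cw x) ((neg_sq _).trans (cw_sq x))).symm
    have g1 := congrFun hGl j.castSucc
    have g2 := congrFun hGm j.castSucc
    have g3 := congrFun hGl 3
    have g4 := congrFun hGm 3
    simp only [Pi.smul_apply, smul_eq_mul, snoc₃_castSucc, snoc₃_three] at g1 g2 g3 g4
    simp only [evalVec] at g1 g2 g3 g4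
    rw [g1] at e1
    rw [g2] at e2
    rw [g3] at e3
    rw [g4] at e4
    obtain ⟨r1, r2, r3⟩ := quadratic_identity (l := cu x 2 * l) (m := cu x 2 * m) h2
      (e1.trans (by ring)) ((by ring : _ = _).trans (e2.trans (mul_assoc _ _ _).symm))
      (e3.trans (by ring)) ((by ring : _ = _).trans (e4.trans (by ring))) hω (cw_sq x)
    have hlm : cu x 2 * l * (cu x 2 * m) ≠ 0 := mul_ne_zero (mul_ne_zero hz hl) (mul_ne_zero hz hm)
    refine ⟨?_, ?_, hFx, ?_⟩
    · simp only [hNdef, map_sub, _root_.map_mul, map_pow]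
      rw [r1]
      exact mul_ne_zero hlm (pow_ne_zero 2 hFx)
    · simp only [hMdef, map_sub, _root_.map_mul]
      refine mul_ne_zero (right_ne_zero_of_mul (a := cw x) ?_) hFx
      rw [r2]
      exact mul_ne_zero (mul_ne_zero hlm hω0) hFx
    · simp only [hNdef, hMdef, map_sub, _root_.map_mul, map_pow, eval_aeval]
      exact sub_eq_zero.mpr r3
  have hdvd : D₁.cubic ∣ N ^ 2 * aeval F D₂.q - (M * F j) ^ 2 * D₁.q := by
    refine D₁.dvd_of_eventually hT (eventually_of_proj (key.mono fun x hx => ?_))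
    obtain ⟨a, -, hr⟩ := proj_rep x
    rw [hr, eval_smul_of_isHomogeneous hT, hx.2.2.2, mul_zero]
  obtain ⟨x, hNx, hMx, hFx, -⟩ := key.exists
  obtain ⟨a, ha, hr⟩ := proj_rep x
  have hscale : ∀ v, evalVec (fun i => N * F i) v = eval v N • evalVec F v := fun v => by
    ext i; simp [evalVec]
  -- Multiplying the representative by `N` gives degree `2d + 2 + f`, exactly one more than that of
  -- `H = M F j`, and the constant is 1.
  refine ⟨2 * d + 1 + f, fun i => N * F i, M * F j, ⟨fun i => ?_, fun y h => ?_⟩, hNMF,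
    ⟨proj x, Function.ne_iff.mpr ⟨j, ?_⟩⟩, ⟨proj x, ?_⟩, fun v hv => ?_⟩
  · convert! hN.mul (hF.1 i) using 1
    ring
  · have h' := h
    rw [hscale] at h'
    rw [hF.2 y (right_ne_zero_of_smul h')]
    exact mk_eq_of_smul _ _ _ (hscale _)
  · have hNF := hN.mul (hF.1 j)
    change eval (proj x).1.rep (N * F j) ≠ 0
    rw [hr, eval_smul_of_isHomogeneous hNF, _root_.map_mul]
    exact mul_ne_zero (pow_ne_zero _ ha) (mul_ne_zero hNx hFx)
  · rw [hr, eval_smul_of_isHomogeneous hNMF]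
    exact mul_ne_zero (pow_ne_zero _ ha) hMx
  · obtain ⟨T, hT'⟩ := hdvd
    have h1 := congrArg (eval v) hT'
    simp only [map_sub, _root_.map_mul, map_pow, eval_aeval, hv, zero_mul] at h1
    rw [hscale, eval_q_smul, _root_.map_mul, one_mul]
    linear_combination h1

end CoverData

end

theorem mainTheorem5 {K : Type*} [Field K] [IsAlgClosed K] [DecidableEq K] (h2 : (2 : K) ≠ 0)
    (D₁ D₂ : CoverData K) (h₁ : D₁.IsUDCEC) (h₂ : D₂.IsUDCEC) :
    (Nonempty (CoverCurve.Iso D₁.curve D₂.curve) ↔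
      D₁.jInvariant = D₂.jInvariant ∧
        ∃ ψ : CoverCurve.Iso D₁.base D₂.base, ∃ c : K, c ≠ 0 ∧ D₁.PullbackEq D₂ ψ c) ∧
    (∀ ψ : CoverCurve.Iso D₁.base D₂.base, (∃ c : K, c ≠ 0 ∧ D₁.PullbackEq D₂ ψ c) →
      (∃ ι : CoverCurve.Iso D₁.base D₂.base, ι D₁.origin = D₂.origin) ∧
      ∀ ι : CoverCurve.Iso D₁.base D₂.base, ι D₁.origin = D₂.origin →
        ∃ (R : D₁.weierstrass.toAffine.Point) (ρ : CoverCurve.Iso D₁.base D₁.base),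
          6 • R = 0 ∧ ρ D₁.origin = D₁.origin ∧
          ∀ x, D₁.toPoint (ι.symm (ψ x)) = D₁.toPoint (ρ x) + R) := by
  have hs₁ := h₁.1.isSmoothCubic
  have hs₂ := h₂.1.isSmoothCubic
  refine ⟨⟨?_, ?_⟩, ?_⟩
  · rintro ⟨α⟩
    obtain ⟨ψ, hψ⟩ := CoverData.exists_iso_base h2 h₁ h₂.1 α
    exact ⟨CoverData.jInvariant_eq_of_iso h2 hs₁ hs₂ ψ, ψ, 1, one_ne_zero,
      CoverData.pullbackEq_of_lift h2 h₁.1 h₂.1 hψ⟩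
  · rintro ⟨-, ψ, c, hc, hψ⟩
    obtain ⟨M, hM, hq⟩ := hψ.exists_isLinear h₁.1 h₂.1 ψ hc
    exact hM.nonempty_iso hc hq
  · rintro ψ ⟨c, hc, hψ⟩
    obtain ⟨M, hM, -⟩ := hψ.exists_isLinear h₁.1 h₂.1 ψ hc
    refine ⟨CoverData.exists_iso_origin h2 hs₂ ψ, fun ι hι => ?_⟩
    obtain ⟨R, ρ, hR, hρ, h⟩ := CoverData.exists_translate_comp h2 hs₁ hM hι
    -- The translation is in fact by a 3-torsion point.
    exact ⟨R, ρ, by rw [show 6 = 2 * 3 from rfl, mul_smul, hR, smul_zero], hρ, h⟩
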